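/- Let $G$ be a compact Lie group with normalized Haar measure, let $(\mathcal A,G,\alpha)$ be a free C$^*$-dynamical system with $\mathcal A$ unital (i.e. $(g,x)\mapsto\alpha_g(x)$ is continuous and the span of the functions $g\mapsto x\,\alpha_g(y)$, $x,y\in\mathcal A$, is dense in $C(G,\mathcal A)$), and let $\mathcal B:=\mathcal A^G$. Let $\operatorname{Irr}(G)$ be a set of representatives $(\sigma,V_\sigma)$ of the irreducible unitary representations of $G$, with the trivial class represented on $V_1=\mathbb C$. For each $\sigma\in\operatorname{Irr}(G)$ let $\mathfrak H_\sigma$ be a finite-dimensional Hilbert space and $s(\sigma)\in\mathcal A\otimes\operatorname{Hom}(V_\sigma,\mathfrak H_\sigma)$ an isometry with $\alpha_g(s(\sigma))=s(\sigma)(1\otimes\sigma_g)$ for all $g\in G$, where $\mathfrak H_1=\mathbb C$ and $s(1)=1_{\mathcal A}$. Let $\pi_{\mathcal B}:\mathcal B\to\mathcal L(\mathfrak H_{\mathcal B})$ be a faithful unital $^*$-representation on a Hilbert space. Put $$\mathfrak H:=\bigoplus_{\sigma\in\operatorname{Irr}(G)}\mathfrak H_\sigma\otimes\bar V_\sigma,\qquad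 \mu_g:=\bigoplus_{\sigma\in\operatorname{Irr}(G)}1_{\mathfrak H_\sigma}\otimes\bar\sigma_g .$$ Choose a faithful covariant representation $(\pi,u)$ of $(\mathcal A,G,\alpha)$ on a Hilbert space $\mathfrak H_{\mathcal A}$ (with $\pi$ unital and $u$ strongly continuous) and regard $\mathcal A$ as a subalgebra of $\mathcal L(\mathfrak H_{\mathcal A})$. Identify $L^2(G)=\bigoplus_\sigma V_\sigma\otimes\bar V_\sigma$, where $v\otimes\bar w$ corresponds to the function $h\mapsto\sqrt{\dim V_\sigma}\,\langle w,\sigma_h v\rangle$ (inner products are linear in the second variable). Then $s:=\bigoplus_\sigma s(\sigma)\otimes 1_{\bar V_\sigma}:\mathfrak H_{\mathcal A}\otimes L^2(G)\to\mathfrak H_{\mathcal A}\otimes\mathfrak H$ is a well-defined isometry. Let $j_\alpha(x)$, $x\in\mathcal A$, be the operator on $\mathfrak H_{\mathcal A}\otimes L^2(G)=L^2(G,\mathfrak H_{\mathcal A})$ given by $(j_\alpha(x)f)(h)=\alpha_{h^{-1}}(x)f(h)$, and put $\pi_s(x):=s\,j_\alpha(x)\,s^*$. Then $j_\alpha$ is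 a unital $^*$-homomorphism, and $ss^*$ and all $\pi_s(x)$, $x\in\mathcal A$, are multipliers of $\mathcal B\otimes\mathcal K(\mathfrak H)$. Denote the canonical extension of $\pi_{\mathcal B}\otimes\mathrm{id}:\mathcal B\otimes\mathcal K(\mathfrak H)\to\mathcal L(\mathfrak H_{\mathcal B}\otimes\mathfrak H)$ to the multiplier algebra again by $\pi_{\mathcal B}\otimes\mathrm{id}$. Then $p:=(\pi_{\mathcal B}\otimes\mathrm{id})(ss^*)$ is an orthogonal projection; put $\mathfrak H_p:=p(\mathfrak H_{\mathcal B}\otimes\mathfrak H)$. Each $(\pi_{\mathcal B}\otimes\mathrm{id})(\pi_s(x))$ equals its compression by $p$, and $\mathfrak H_p$ is invariant under all $1\otimes\mu_g$. Moreover, with $\pi_{\mathcal A}(x):=(\pi_{\mathcal B}\otimes\mathrm{id})(\pi_s(x))|_{\mathfrak H_p}$ and $(u_{\mathcal A})_g:=(1\otimes\mu_g)|_{\mathfrak H_p}$, the pair $(\pi_{\mathcal A},u_{\mathcal A})$ is a faithful covariant representation of $(\mathcal A,G,\alpha)$ on $\mathfrak H_p$: $\pi_{\mathcal A}$ is an injective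 unital $^*$-representation, $u_{\mathcal A}$ is a strongly continuous unitary representation, and $\pi_{\mathcal A}(\alpha_g(x))=(u_{\mathcal A})_g\,\pi_{\mathcal A}(x)\,(u_{\mathcal A})_g^*$ for all $g\in G$, $x\in\mathcal A$. Furthermore, $t(\xi):=\xi\otimes 1_{\mathbb C}$, where $1_{\mathbb C}\in\mathbb C=\mathfrak H_1\otimes\bar V_1\subseteq\mathfrak H$, defines an isometry $t:\mathfrak H_{\mathcal B}\to\mathfrak H_p$, and $\pi_{\mathcal A}(b)\,t=t\,\pi_{\mathcal B}(b)$ for all $b\in\mathcal B$. -/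

import Mathlib

open MeasureTheory
open scoped Manifold ContDiff InnerProductSpace InnerProduct Matrix

noncomputable section

namespace LiftCovRep

/-! ### C*-dynamical systems, free actions, covariant representations -/

/-- A C*-dynamical system `(A, G, α)`: an action of `G` on the unital C*-algebra `A` by
*-automorphisms such that `(g, x) ↦ α_g(x)` is continuous. -/
structure CStarDynSystem (A G : Type*) [CStarAlgebra A] [Group G] [TopologicalSpace G] where
  act : G →* (A ≃⋆ₐ[ℂ] A)
  continuous_act : Continuous fun q : G × A => act q.1 q.2

section Systems

variable {A G : Type*} [CStarAlgebra A] [Group G] [TopologicalSpace G]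

/-- The fixed point algebra `B = A^G`. -/
def CStarDynSystem.fixedAlgebra (S : CStarDynSystem A G) : StarSubalgebra ℂ A where
  carrier := {x | ∀ g, S.act g x = x}
  mul_mem' hx hy g := by rw [map_mul, hx g, hy g]
  add_mem' hx hy g := by rw [map_add, hx g, hy g]
  algebraMap_mem' c g := AlgHomClass.commutes (S.act g) c
  star_mem' hx g := by rw [map_star, hx g]

/-- Freeness: the Ellwood map `A ⊗_alg A → C(G, A)`, `x ⊗ y ↦ (g ↦ x α_g(y))`, has dense range.
The range is the linear span of the images of elementary tensors. For compact `G` the topology of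
`C(G, A)` is that of the supremum norm. -/
def CStarDynSystem.IsFree (S : CStarDynSystem A G) : Prop :=
  Dense (Submodule.span ℂ {F : C(G, A) | ∃ x y : A, ∀ g, F g = x * S.act g y} : Set C(G, A))

/-- A covariant representation `(π, u)` of `(A, G, α)` on a Hilbert space `K`: a unital
*-representation `π` and a strongly continuous unitary representation `u` with
`π(α_g(x)) = u_g π(x) u_g^*`. -/
structure CovariantRep (S : CStarDynSystem A G) (K : Type*) [NormedAddCommGroup K]
    [InnerProductSpace ℂ K] [CompleteSpace K] where
  rep : A →⋆ₐ[ℂ] (K →L[ℂ] K)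
  uni : G →* unitary (K →L[ℂ] K)
  continuous_uni : ∀ ξ : K, Continuous fun g => (uni g : K →L[ℂ] K) ξ
  covariant : ∀ (g : G) (x : A),
    rep (S.act g x) = (uni g : K →L[ℂ] K) * rep x * star (uni g : K →L[ℂ] K)

/-- A covariant representation `(π, u)` is faithful if `π` is. -/
def CovariantRep.IsFaithful {S : CStarDynSystem A G} {K : Type*} [NormedAddCommGroup K]
    [InnerProductSpace ℂ K] [CompleteSpace K] (C : CovariantRep S K) : Prop :=
  Function.Injective C.rep

/-- The restriction of `π` to the fixed point algebra. -/
def CovariantRep.restrictFixed {S : CStarDynSystem A G} {K : Type*} [NormedAddCommGroup K]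
    [InnerProductSpace ℂ K] [CompleteSpace K] (C : CovariantRep S K) :
    S.fixedAlgebra →⋆ₐ[ℂ] (K →L[ℂ] K) :=
  C.rep.comp S.fixedAlgebra.subtype

end Systems

/-! ### Irreducible representations -/

/-- A unitary matrix representation on `ℂ^d` is irreducible: `ℂ^d ≠ 0` and there are no proper
nonzero invariant subspaces. -/
def IsIrred {G : Type*} [Group G] {d : ℕ} (ρ : G →* Matrix.unitaryGroup (Fin d) ℂ) : Prop :=
  0 < d ∧ ∀ W : Submodule ℂ (Fin d → ℂ),
    (∀ g, ∀ w ∈ W, (ρ g : Matrix (Fin d) (Fin d) ℂ) *ᵥ w ∈ W) → W = ⊥ ∨ W = ⊤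

/-- Equivalence of representations: there is an invertible intertwiner. -/
def IsEquivRep {G : Type*} [Group G] {d e : ℕ} (ρ : G →* Matrix.unitaryGroup (Fin d) ℂ)
    (τ : G →* Matrix.unitaryGroup (Fin e) ℂ) : Prop :=
  ∃ T : (Fin d → ℂ) ≃ₗ[ℂ] (Fin e → ℂ), ∀ g v,
    T ((ρ g : Matrix (Fin d) (Fin d) ℂ) *ᵥ v) = (τ g : Matrix (Fin e) (Fin e) ℂ) *ᵥ T v

/-- The set `Irrep(G)` of equivalence classes of irreducible representations of a compact group
together with a choice of a representative `σ : G → U(V_σ)` of each class. An orthonormal basis of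
`V_σ` is chosen, that is, `V_σ = ℂ^{d_σ}`. The class of the trivial representation is represented
by the trivial representation on `ℂ`. -/
structure IrrepSystem (G Irr : Type*) [Group G] [TopologicalSpace G] where
  dim : Irr → ℕ
  rep : ∀ σ, G →* Matrix.unitaryGroup (Fin (dim σ)) ℂ
  continuous_rep : ∀ σ, Continuous fun g => (rep σ g : Matrix (Fin (dim σ)) (Fin (dim σ)) ℂ)
  irred : ∀ σ, IsIrred (rep σ)
  inequiv : ∀ σ τ, IsEquivRep (rep σ) (rep τ) → σ = τ
  exhaust : ∀ (d : ℕ) (τ : G →* Matrix.unitaryGroup (Fin d) ℂ),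
    (Continuous fun g => (τ g : Matrix (Fin d) (Fin d) ℂ)) → IsIrred τ →
      ∃ σ, IsEquivRep (rep σ) τ
  one : Irr
  dim_one : dim one = 1
  rep_one : ∀ g, rep one g = 1

/-- For each `σ ∈ Irrep(G)` a finite-dimensional Hilbert space `H_σ = ℂ^{m_σ}` and an isometry
`s(σ) ∈ A ⊗ Hom(V_σ, H_σ) = M_{m_σ × d_σ}(A)` with `α_g(s(σ)) = s(σ) (1 ⊗ σ_g)`, normalized so
that `H_1 = ℂ` and `s(1) = 1_A`. -/
structure IsometryFamily {A G Irr : Type*} [CStarAlgebra A] [Group G] [TopologicalSpace G]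
    (S : CStarDynSystem A G) (R : IrrepSystem G Irr) where
  mult : Irr → ℕ
  s : ∀ σ, Matrix (Fin (mult σ)) (Fin (R.dim σ)) A
  isometry : ∀ σ, (s σ)ᴴ * s σ = 1
  equivariant : ∀ g σ, (s σ).map (S.act g) =
    s σ * (R.rep σ g : Matrix (Fin (R.dim σ)) (Fin (R.dim σ)) ℂ).map (algebraMap ℂ A)
  mult_one : mult R.one = 1
  s_one : ∀ i k, s R.one i k = 1

/-! ### The Hilbert space `K ⊗ H`

For `H = ℓ²(J)` the Hilbert space tensor product `K ⊗ H` is `ℓ²(J, K)`, with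
`ξ ⊗ η = (η_j ξ)_j`. -/

/-- The Hilbert space `ℓ²(J, K) = K ⊗ ℓ²(J)`. -/
abbrev ell2 (J K : Type*) [NormedAddCommGroup K] : Type _ := lp (fun _ : J => K) 2

section Tensor

variable {J K : Type*} [NormedAddCommGroup K] [InnerProductSpace ℂ K]

theorem norm_smul_family (η : ell2 J ℂ) (ξ : K) :
    ∃ h : Memℓp (fun j => (η j) • ξ) 2, ‖(⟨fun j => (η j) • ξ, h⟩ : ell2 J K)‖ ≤ ‖η‖ * ‖ξ‖ := by
  have h2 : 0 < (2 : ENNReal).toReal := by norm_num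
  have hs := lp.hasSum_norm h2 η
  have hs' : HasSum (fun j => ‖(η j) • ξ‖ ^ (2 : ENNReal).toReal)
      (‖η‖ ^ (2 : ENNReal).toReal * ‖ξ‖ ^ (2 : ENNReal).toReal) := by
    have := hs.mul_right (‖ξ‖ ^ (2 : ENNReal).toReal)
    refine this.congr_fun ?_ |> id
    intro j
    rw [norm_smul, Real.mul_rpow (norm_nonneg _) (norm_nonneg _)]
  have hm : Memℓp (fun j => (η j) • ξ) 2 := (memℓp_gen_iff h2).2 hs'.summable
  refine ⟨hm, lp.norm_le_of_tsum_le h2 (by positivity) ?_⟩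
  rw [Real.mul_rpow (norm_nonneg _) (norm_nonneg _)]
  exact hs'.tsum_eq.le

/-- The operator `K → K ⊗ ℓ²(J)`, `ξ ↦ ξ ⊗ η`. -/
def tensorVec (η : ell2 J ℂ) : K →L[ℂ] ell2 J K :=
  LinearMap.mkContinuous
    { toFun := fun ξ => ⟨fun j => (η j) • ξ, (norm_smul_family η ξ).1⟩
      map_add' := fun ξ ζ => by ext j; exact smul_add _ _ _
      map_smul' := fun c ξ => by ext j; exact smul_comm _ _ _ }
    ‖η‖ (fun ξ => (norm_smul_family η ξ).2)

variable [CompleteSpace K]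

/-- The operator `a ⊗ |η⟩⟨ζ|` on `K ⊗ ℓ²(J)`. -/
def tensorRankOne (a : K →L[ℂ] K) (η ζ : ell2 J ℂ) : ell2 J K →L[ℂ] ell2 J K :=
  tensorVec η ∘L a ∘L (tensorVec (K := K) ζ)†

end Tensor

/-! ### The homomorphism `π₂ ⊗ id` and its extension to multipliers

Let `π₁` and `π₂` be faithful representations of a C*-algebra `B` on `K₁` and `K₂`, and identify
`B` with `π₁(B)`. Then `B ⊗ K(ℓ²(J))` (minimal tensor product) is the closed linear span of the
operators `π₁(b) ⊗ |η⟩⟨ζ|` on `K₁ ⊗ ℓ²(J)`. -/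

section Extension

variable {B K₁ K₂ : Type*} [Ring B] [StarRing B] [Algebra ℂ B]
  [NormedAddCommGroup K₁] [InnerProductSpace ℂ K₁] [CompleteSpace K₁]
  [NormedAddCommGroup K₂] [InnerProductSpace ℂ K₂] [CompleteSpace K₂]

/-- The graph of `π₂ ⊗ id : B ⊗ K(ℓ²(J)) → L(K₂ ⊗ ℓ²(J))`: the closed linear span of the pairs
`(b ⊗ |η⟩⟨ζ|, π₂(b) ⊗ |η⟩⟨ζ|)`. -/
def tensorIdGraph (J : Type*) (π₁ : B →⋆ₐ[ℂ] (K₁ →L[ℂ] K₁)) (π₂ : B →⋆ₐ[ℂ] (K₂ →L[ℂ] K₂)) :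
    Submodule ℂ ((ell2 J K₁ →L[ℂ] ell2 J K₁) × (ell2 J K₂ →L[ℂ] ell2 J K₂)) :=
  (Submodule.span ℂ {z | ∃ (b : B) (η ζ : ell2 J ℂ),
    z = (tensorRankOne (π₁ b) η ζ, tensorRankOne (π₂ b) η ζ)}).topologicalClosure

/-- The operator `m` on `K₁ ⊗ ℓ²(J)` is a multiplier of `B ⊗ K(ℓ²(J))`, and `T` is its image
under the canonical extension of the nondegenerate *-homomorphism `Φ = π₂ ⊗ id` to the multiplier
algebra `M(B ⊗ K(ℓ²(J)))`: for all `k ∈ B ⊗ K(ℓ²(J))` one has `mk, km ∈ B ⊗ K(ℓ²(J))`,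
`Φ(mk) = T Φ(k)` and `Φ(km) = Φ(k) T`. -/
def IsTensorIdImage {J : Type*} (π₁ : B →⋆ₐ[ℂ] (K₁ →L[ℂ] K₁)) (π₂ : B →⋆ₐ[ℂ] (K₂ →L[ℂ] K₂))
    (m : ell2 J K₁ →L[ℂ] ell2 J K₁) (T : ell2 J K₂ →L[ℂ] ell2 J K₂) : Prop :=
  ∀ z ∈ tensorIdGraph J π₁ π₂,
    (m ∘L z.1, T ∘L z.2) ∈ tensorIdGraph J π₁ π₂ ∧
    (z.1 ∘L m, z.2 ∘L T) ∈ tensorIdGraph J π₁ π₂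

end Extension

/-! ### The representation `μ` and the isometry `s` -/

section Data

variable {A G Irr : Type*} [CStarAlgebra A] [Group G] [TopologicalSpace G]
  {S : CStarDynSystem A G} {R : IrrepSystem G Irr}

/-- The index set of the orthonormal basis `f_i ⊗ ē_l` (with `i < m_σ`, `l < d_σ`, `σ ∈ Irrep(G)`)
of the Hilbert space `H = ⨁_σ H_σ ⊗ V̄_σ`. Thus `H = ℓ²(F.Basis)`. -/
abbrev IsometryFamily.Basis (F : IsometryFamily S R) : Type _ :=
  Σ σ : Irr, Fin (F.mult σ) × Fin (R.dim σ)

open Classical in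
/-- The vector `1_ℂ ∈ ℂ = H_1 ⊗ V̄_1 ⊆ H`. -/
def IsometryFamily.oneVec (F : IsometryFamily S R) : ell2 F.Basis ℂ :=
  lp.single 2
    ⟨R.one, (Fin.cast F.mult_one.symm 0, Fin.cast R.dim_one.symm 0)⟩ 1

/-- The coordinates of `(1 ⊗ μ_g) f`, where `f ∈ K ⊗ H` and `μ_g = ⨁_σ 1_{H_σ} ⊗ σ̄_g`. The
matrix of `σ̄_g` in the conjugate basis is the entrywise conjugate of the matrix of `σ_g`. -/
def IsometryFamily.muCoord (F : IsometryFamily S R) {K : Type*} [NormedAddCommGroup K]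
    [InnerProductSpace ℂ K] (g : G) (f : F.Basis → K) : F.Basis → K :=
  fun j => ∑ l : Fin (R.dim j.1),
    star ((R.rep j.1 g : Matrix (Fin (R.dim j.1)) (Fin (R.dim j.1)) ℂ) j.2.2 l) •
      f ⟨j.1, (j.2.1, l)⟩

variable [MeasurableSpace G]

/-- The component of `f ∈ L²(G, K) = K ⊗ L²(G)` along the vector `e_k ⊗ ē_l` of
`V_σ ⊗ V̄_σ ⊆ L²(G)`. Here `v ⊗ w̄ ∈ V_σ ⊗ V̄_σ` is the function
`h ↦ √(d_σ) ⟨w, σ_h v⟩`, so that left translation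
`(λ_g f)(h) = f(g⁻¹h)` acts as `1 ⊗ σ̄_g` and right translation `(r_g f)(h) = f(hg)` as
`σ_g ⊗ 1`. -/
def IrrepSystem.coeff (R : IrrepSystem G Irr) (ν : Measure G) {K : Type*} [NormedAddCommGroup K]
    [InnerProductSpace ℂ K] (f : Lp K 2 ν) (σ : Irr) (k l : Fin (R.dim σ)) : K :=
  ∫ h, star ((√(R.dim σ : ℝ) : ℂ) *
    (R.rep σ h : Matrix (Fin (R.dim σ)) (Fin (R.dim σ)) ℂ) l k) • f h ∂ν

/-- The coordinates of `s f`, where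
`s = ⨁_σ s(σ) ⊗ 1_{V̄_σ} : K ⊗ L²(G) = ⨁_σ K ⊗ V_σ ⊗ V̄_σ → ⨁_σ K ⊗ H_σ ⊗ V̄_σ = K ⊗ H`
and `A` acts on `K` by `π`. -/
def IsometryFamily.sCoord (F : IsometryFamily S R) (ν : Measure G) {K : Type*}
    [NormedAddCommGroup K] [InnerProductSpace ℂ K] [CompleteSpace K]
    (π : A →⋆ₐ[ℂ] (K →L[ℂ] K)) (f : Lp K 2 ν) : F.Basis → K :=
  fun j => ∑ k : Fin (R.dim j.1), π (F.s j.1 j.2.1 k) (R.coeff ν f j.1 k j.2.2)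

end Data

end LiftCovRep

end

/-!
The argument has three ingredients.

*The extension of `π₂ ⊗ id` to multipliers.* If `‖π₁ b‖ = ‖π₂ b‖` for all `b`, then both projections
of `tensorIdGraph` are injective, because an operator on `K ⊗ ℓ²(J)` is determined by its entries.
The graph is a C*-algebra, so these projections are isometric, and `π₂ ⊗ id` is a well-defined
isometric *-homomorphism. Multipliers are handled through their columns: if all columns `m (· ⊗
e_j)` and `m† (· ⊗ e_j)` of an operator `m` lie in the Hilbert module `B ⊗ ℓ²(J)`, whose graph
version is `colGraph`, then transporting the columns by `π₂` gives the columns of a bounded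
operator, and this operator is `(π₂ ⊗ id)(m)` (`exists_operator_of_columns`,
`isTensorIdImage_of_columns`). Such images are unique and compatible with the *-algebra operations,
so a representation of the form `s ρ(·) s†` by multipliers yields a representation on the range of
the projection `(π₂ ⊗ id)(s s†)`, which is faithful if `ρ` is (`exists_compressed_rep`).

*The isometry `s`.* The Schur orthogonality relations and the Peter–Weyl theorem say that the
normalized matrix coefficients form an orthonormal basis of `L²(G)`. Completeness is proved by
convolution: on the orthogonal complement of the matrix coefficients, convolution with a hermitian
kernel is a compact self-adjoint operator that commutes with right translations. The eigenspace of a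
nonzero eigenvalue is a finite-dimensional translation-invariant space of continuous functions, and
such a space, if nonzero, is not orthogonal to all matrix coefficients
(`eq_bot_of_orthogonal_entry`). So the operator vanishes (`convOp_eq_zero`), and since the value of
the convolution at `1` is an inner product with the kernel, every element of the complement is
orthogonal to all continuous functions (`topologicalClosure_span_entry`). This gives the unitary
`fourier` from `L²(G, K)` to `⨁_σ K ⊗ V_σ ⊗ V̄_σ`. The isometry `s` is its composition with a
block-diagonal isometry (`exists_block_isometry`).

*The columns of `π_s(x)`.* The adjoint `s†` maps `ξ ⊗ e_j`, with `j = (σ, i, l)`, to the function `h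
↦ π(α_{h⁻¹}(a)) ξ` with `a = √d_σ s(σ)_{il}*` (`adjoint_comp_tensorBasis`). Since `jα(x)` maps such
a function to the one of `xa`, the columns of `π_s(x)` are of the form `s ∘ orbitVec a`. Their
entries are multiples of averages `∫ α_{h⁻¹}(b) dh`, hence lie in the fixed point algebra, and the
columns are norm limits of their finite parts, because the operator-valued function `h ↦
π(α_{h⁻¹}(a))` is a limit in `L²` of sums `∑ φ_r T_r`, where the `φ_r` are matrix coefficients and
the `T_r` are operators (`comp_fieldOp_mem_compactColumns`). So `π_s(x)` is a multiplier
(`exists_isTensorIdImage_conj`).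

Covariance follows from `s λ_g = (1 ⊗ μ_g) s`, where `λ` is left translation, and `λ_g jα(x) λ_g† =
jα(α_g(x))` (`conj_mu`). The intertwining property of `t` follows from `s (const ξ) = ξ ⊗ 1`
(`isometry_const`): constant functions are the trivial isotypic component.
-/

noncomputable section

namespace LiftCovRep

/-! ### Columns of operators on `K ⊗ ℓ²(J)` -/

section Columns

variable {J K : Type*} [NormedAddCommGroup K] [InnerProductSpace ℂ K]

theorem norm_tensorVec_le (η : ell2 J ℂ) : ‖(tensorVec η : K →L[ℂ] ell2 J K)‖ ≤ ‖η‖ :=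
  LinearMap.mkContinuous_norm_le _ (norm_nonneg _) _

@[simp]
theorem tensorVec_apply_apply (η : ell2 J ℂ) (ξ : K) (j : J) : tensorVec η ξ j = η j • ξ := rfl

variable (K) in
/-- The operator `η ↦ (ξ ↦ ξ ⊗ η)`, linear and continuous in `η`. -/
def tensorVecL : ell2 J ℂ →L[ℂ] (K →L[ℂ] ell2 J K) :=
  let f : ell2 J ℂ →ₗ[ℂ] (K →L[ℂ] ell2 J K) :=
    { toFun := fun η => tensorVec η
      map_add' := fun η ζ => by
        refine ContinuousLinearMap.ext fun ξ => lp.ext (funext fun j => ?_)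
        exact add_smul (η j) (ζ j) ξ
      map_smul' := fun c η => by
        refine ContinuousLinearMap.ext fun ξ => lp.ext (funext fun j => ?_)
        exact mul_smul c (η j) ξ }
  have hf : ∀ η, ‖f η‖ ≤ 1 * ‖η‖ := fun η =>
    (norm_tensorVec_le η).trans_eq (one_mul ‖η‖).symm
  ⟨f, AddMonoidHomClass.continuous_of_bound f 1 hf⟩

@[simp]
theorem tensorVecL_apply (η : ell2 J ℂ) : tensorVecL K η = tensorVec η := rfl

open Classical in
/-- The operator `ξ ↦ ξ ⊗ e_j`, where `e_j` is the `j`-th standard basis vector of `ℓ²(J)`. -/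
def tensorBasis (j : J) : K →L[ℂ] ell2 J K := tensorVec (lp.single 2 j 1)

open Classical in
theorem tensorBasis_apply (j : J) (ξ : K) : tensorBasis j ξ = lp.single 2 j ξ := by
  ext i
  rcases eq_or_ne i j with rfl | h
  · simp [tensorBasis]
  · simp [tensorBasis, h]

theorem hasSum_tensorBasis (x : ell2 J K) : HasSum (fun j => tensorBasis j (x j)) x := by
  classical
  simpa only [tensorBasis_apply] using lp.hasSum_single (by norm_num) x

theorem ext_tensorBasis {E : Type*} [NormedAddCommGroup E] [NormedSpace ℂ E]
    {S T : ell2 J K →L[ℂ] E} (h : ∀ j, S ∘L tensorBasis j = T ∘L tensorBasis j) : S = T := by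
  ext x
  have hS := (hasSum_tensorBasis x).mapL S
  have hT := (hasSum_tensorBasis x).mapL T
  refine hS.unique ?_
  convert hT using 2 with j
  exact congrArg (fun f : K →L[ℂ] E => f (x j)) (h j)

theorem norm_tensorBasis_le (j : J) : ‖(tensorBasis j : K →L[ℂ] ell2 J K)‖ ≤ 1 := by
  classical
  refine (norm_tensorVec_le _).trans ?_
  rw [lp.norm_single (by norm_num)]; simp

variable [CompleteSpace K]

theorem tensorVec_adjoint_comp (η ζ : ell2 J ℂ) :
    (tensorVec (K := K) η)† ∘L tensorVec ζ = ⟪η, ζ⟫_ℂ • ContinuousLinearMap.id ℂ K := by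
  ext ξ
  refine ext_inner_left ℂ fun v => ?_
  rw [ContinuousLinearMap.comp_apply, ContinuousLinearMap.adjoint_inner_right]
  refine (lp.hasSum_inner _ _).unique ?_
  have := (lp.hasSum_inner η ζ).mul_right ⟪v, ξ⟫_ℂ
  simpa [inner_smul_left, inner_smul_right, mul_comm, mul_left_comm, mul_assoc] using this

theorem tensorBasis_adjoint_apply (j : J) (x : ell2 J K) :
    ContinuousLinearMap.adjoint (tensorBasis j) x = x j := by
  classical
  refine ext_inner_left ℂ fun v => ?_
  rw [ContinuousLinearMap.adjoint_inner_right, tensorBasis_apply, lp.inner_single_left]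

theorem tensorBasis_adjoint_comp_self (j : J) :
    (tensorBasis j)† ∘L tensorBasis j = ContinuousLinearMap.id ℂ K := by
  classical
  simp [tensorBasis, tensorVec_adjoint_comp]

theorem tensorBasis_adjoint_comp_of_ne {i j : J} (h : i ≠ j) :
    (tensorBasis i)† ∘L tensorBasis j = (0 : K →L[ℂ] K) := by
  classical
  rw [tensorBasis, tensorBasis, tensorVec_adjoint_comp, lp.inner_single_left, lp.single_apply,
    Pi.single_eq_of_ne h]
  simp

/-- The projection onto the coordinates in a finite set. -/
def coordProj (s : Finset J) : ell2 J K →L[ℂ] ell2 J K :=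
  ∑ j ∈ s, tensorBasis j ∘L (tensorBasis j)†

theorem coordProj_apply (s : Finset J) (x : ell2 J K) :
    coordProj s x = ∑ j ∈ s, tensorBasis j (x j) := by
  simp [coordProj, tensorBasis_adjoint_apply]

theorem isStarProjection_coordProj (s : Finset J) :
    IsStarProjection (coordProj s : ell2 J K →L[ℂ] ell2 J K) := by
  classical
  constructor
  · refine ext_tensorBasis fun j => ?_
    have key : ∀ t : Finset J, (coordProj t : ell2 J K →L[ℂ] ell2 J K) ∘L tensorBasis j =
        if j ∈ t then tensorBasis j else 0 := by
      intro t
      rw [coordProj, ContinuousLinearMap.finsetSum_comp]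
      split_ifs with h
      · rw [Finset.sum_eq_single j]
        · rw [ContinuousLinearMap.comp_assoc, tensorBasis_adjoint_comp_self,
            ContinuousLinearMap.comp_id]
        · intro i _ hi
          rw [ContinuousLinearMap.comp_assoc, tensorBasis_adjoint_comp_of_ne hi,
            ContinuousLinearMap.comp_zero]
        · exact fun h' => absurd h h'
      · refine Finset.sum_eq_zero fun i hi => ?_
        rw [ContinuousLinearMap.comp_assoc,
          tensorBasis_adjoint_comp_of_ne (by rintro rfl; exact h hi), ContinuousLinearMap.comp_zero]
    rw [ContinuousLinearMap.mul_def, ContinuousLinearMap.comp_assoc, key]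
    split_ifs with h
    · rw [key, if_pos h]
    · simp
  · rw [IsSelfAdjoint, ContinuousLinearMap.star_eq_adjoint, coordProj, map_sum]
    simp [ContinuousLinearMap.adjoint_comp]

theorem norm_coordProj_le (s : Finset J) : ‖(coordProj s : ell2 J K →L[ℂ] ell2 J K)‖ ≤ 1 :=
  IsStarProjection.norm_le _ (isStarProjection_coordProj s)

end Columns

/-! ### The homomorphism `π₂ ⊗ id` and its extension to multipliers -/

section Extension

variable {J B K₁ K₂ : Type*} [Ring B] [StarRing B] [Algebra ℂ B]
  [NormedAddCommGroup K₁] [InnerProductSpace ℂ K₁] [CompleteSpace K₁]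
  [NormedAddCommGroup K₂] [InnerProductSpace ℂ K₂] [CompleteSpace K₂]
  {π₁ : B →⋆ₐ[ℂ] (K₁ →L[ℂ] K₁)} {π₂ : B →⋆ₐ[ℂ] (K₂ →L[ℂ] K₂)}

theorem tensorRankOne_mul {K : Type*} [NormedAddCommGroup K] [InnerProductSpace ℂ K]
    [CompleteSpace K] (π : B →⋆ₐ[ℂ] (K →L[ℂ] K)) (b b' : B) (η ζ η' ζ' : ell2 J ℂ) :
    tensorRankOne (π b) η ζ * tensorRankOne (π b') η' ζ' =
      ⟪ζ, η'⟫_ℂ • tensorRankOne (π (b * b')) η ζ' := by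
  ext1 x
  have h := congrArg (fun f : K →L[ℂ] K => f (π b' (ContinuousLinearMap.adjoint (tensorVec ζ') x)))
    (tensorVec_adjoint_comp (K := K) ζ η')
  simp only [ContinuousLinearMap.comp_apply, _root_.smul_apply,
    ContinuousLinearMap.id_apply] at h
  simp [tensorRankOne, ContinuousLinearMap.mul_def, h]

theorem star_tensorRankOne {K : Type*} [NormedAddCommGroup K] [InnerProductSpace ℂ K]
    [CompleteSpace K] (π : B →⋆ₐ[ℂ] (K →L[ℂ] K)) (b : B) (η ζ : ell2 J ℂ) :
    star (tensorRankOne (π b) η ζ) = tensorRankOne (π (star b)) ζ η := by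
  simp [tensorRankOne, ContinuousLinearMap.star_eq_adjoint, ContinuousLinearMap.adjoint_comp,
    map_star, ContinuousLinearMap.comp_assoc]

/-- If both coordinate projections of a closed *-subalgebra of a product of C*-algebras are
injective, then they are isometric. -/
theorem norm_fst_eq_norm_snd_of_injective {A₁ A₂ : Type*} [CStarAlgebra A₁] [CStarAlgebra A₂]
    (𝒢 : NonUnitalStarSubalgebra ℂ (A₁ × A₂)) (h𝒢 : IsClosed (SetLike.coe 𝒢))
    (h₁ : ∀ w ∈ 𝒢, w.1 = 0 → w.2 = 0) (h₂ : ∀ w ∈ 𝒢, w.2 = 0 → w.1 = 0)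
    {z : A₁ × A₂} (hz : z ∈ 𝒢) : ‖z.1‖ = ‖z.2‖ := by
  let _ : NonUnitalCStarAlgebra 𝒢 :=
    NonUnitalStarSubalgebra.nonUnitalCStarAlgebra 𝒢 (h_closed := h𝒢)
  let p₁ : 𝒢 →⋆ₙₐ[ℂ] A₁ :=
    (NonUnitalStarAlgHom.fst ℂ _ _).comp (NonUnitalStarSubalgebraClass.subtype 𝒢)
  let p₂ : 𝒢 →⋆ₙₐ[ℂ] A₂ :=
    (NonUnitalStarAlgHom.snd ℂ _ _).comp (NonUnitalStarSubalgebraClass.subtype 𝒢)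
  have i₁ : Function.Injective p₁ := by
    rw [injective_iff_map_eq_zero]
    rintro ⟨w, hw⟩ h
    exact Subtype.ext (Prod.ext h (h₁ w hw h))
  have i₂ : Function.Injective p₂ := by
    rw [injective_iff_map_eq_zero]
    rintro ⟨w, hw⟩ h
    exact Subtype.ext (Prod.ext (h₂ w hw h) h)
  exact (NonUnitalStarAlgHom.norm_map p₁ i₁ ⟨z, hz⟩).trans
    (NonUnitalStarAlgHom.norm_map p₂ i₂ ⟨z, hz⟩).symm

section Graph

variable (J π₁ π₂)

/-- The linear span of the pairs `(b ⊗ |η⟩⟨ζ|, π₂(b) ⊗ |η⟩⟨ζ|)`, a *-subalgebra of the product of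
the two operator algebras. -/
def tensorIdSpan : NonUnitalStarSubalgebra ℂ
    ((ell2 J K₁ →L[ℂ] ell2 J K₁) × (ell2 J K₂ →L[ℂ] ell2 J K₂)) where
  __ := Submodule.span ℂ {z | ∃ (b : B) (η ζ : ell2 J ℂ),
    z = (tensorRankOne (π₁ b) η ζ, tensorRankOne (π₂ b) η ζ)}
  mul_mem' {x y} hx hy := by
    refine Submodule.span_induction₂
      (p := fun x y _ _ => x * y ∈ Submodule.span ℂ {z | ∃ (b : B) (η ζ : ell2 J ℂ),
        z = (tensorRankOne (π₁ b) η ζ, tensorRankOne (π₂ b) η ζ)}) ?_ ?_ ?_ ?_ ?_ ?_ ?_ hx hy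
    · rintro _ _ ⟨b, η, ζ, rfl⟩ ⟨b', η', ζ', rfl⟩
      rw [Prod.mk_mul_mk, tensorRankOne_mul, tensorRankOne_mul, ← Prod.smul_mk]
      exact Submodule.smul_mem _ _ (Submodule.subset_span ⟨b * b', η, ζ', rfl⟩)
    · intro y _; simp
    · intro x _; simp
    · intro x y z _ _ _ h1 h2; rw [add_mul]; exact add_mem h1 h2
    · intro x y z _ _ _ h1 h2; rw [mul_add]; exact add_mem h1 h2
    · intro r x y _ _ h; rw [smul_mul_assoc]; exact Submodule.smul_mem _ _ h
    · intro r x y _ _ h; rw [mul_smul_comm]; exact Submodule.smul_mem _ _ h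
  star_mem' {x} hx := by
    refine Submodule.span_induction
      (p := fun x _ => star x ∈ Submodule.span ℂ {z | ∃ (b : B) (η ζ : ell2 J ℂ),
        z = (tensorRankOne (π₁ b) η ζ, tensorRankOne (π₂ b) η ζ)}) ?_ ?_ ?_ ?_ hx
    · rintro _ ⟨b, η, ζ, rfl⟩
      exact Submodule.subset_span ⟨star b, ζ, η,
        Prod.ext (star_tensorRankOne π₁ b η ζ) (star_tensorRankOne π₂ b η ζ)⟩
    · simp
    · intro x y _ _ h1 h2; rw [star_add]; exact add_mem h1 h2
    · intro r x _ h; rw [star_smul]; exact Submodule.smul_mem _ _ h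

end Graph

theorem tensorIdGraph_star_mem {z} (hz : z ∈ tensorIdGraph J π₁ π₂) :
    star z ∈ tensorIdGraph J π₁ π₂ :=
  star_mem (S := NonUnitalStarSubalgebra ℂ _) (s := (tensorIdSpan J π₁ π₂).topologicalClosure) hz

theorem rankOne_mem_tensorIdGraph (b : B) (η ζ : ell2 J ℂ) :
    (tensorRankOne (π₁ b) η ζ, tensorRankOne (π₂ b) η ζ) ∈ tensorIdGraph J π₁ π₂ :=
  Submodule.le_topologicalClosure _ (Submodule.subset_span ⟨b, η, ζ, rfl⟩)

/-- A closed submodule that contains the pairs of elementary operators contains the whole graph. -/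
theorem tensorIdGraph_le
    {P : Submodule ℂ ((ell2 J K₁ →L[ℂ] ell2 J K₁) × (ell2 J K₂ →L[ℂ] ell2 J K₂))}
    (hP : IsClosed (SetLike.coe P))
    (h : ∀ (b : B) (η ζ : ell2 J ℂ),
      (tensorRankOne (π₁ b) η ζ, tensorRankOne (π₂ b) η ζ) ∈ P) :
    tensorIdGraph J π₁ π₂ ≤ P := by
  refine Submodule.topologicalClosure_minimal _ (Submodule.span_le.2 ?_) hP
  rintro _ ⟨b, η, ζ, rfl⟩
  exact h b η ζ

/-- The matrix entry `(i, j)` of an operator on `K ⊗ ℓ²(J)`, as a linear map. -/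
def entryL {K : Type*} [NormedAddCommGroup K] [InnerProductSpace ℂ K] [CompleteSpace K] (i j : J) :
    (ell2 J K →L[ℂ] ell2 J K) →L[ℂ] (K →L[ℂ] K) :=
  ContinuousLinearMap.compL ℂ K (ell2 J K) K ((tensorBasis i)†) ∘L
    (ContinuousLinearMap.compL ℂ K (ell2 J K) (ell2 J K)).flip (tensorBasis j)

theorem entryL_apply {K : Type*} [NormedAddCommGroup K] [InnerProductSpace ℂ K] [CompleteSpace K]
    (i j : J) (T : ell2 J K →L[ℂ] ell2 J K) :
    entryL i j T = (tensorBasis i)† ∘L T ∘L tensorBasis j := rfl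

open Classical in
theorem entryL_tensorRankOne {K : Type*} [NormedAddCommGroup K] [InnerProductSpace ℂ K]
    [CompleteSpace K] (π : B →⋆ₐ[ℂ] (K →L[ℂ] K)) (b : B) (η ζ : ell2 J ℂ) (i j : J) :
    entryL i j (tensorRankOne (π b) η ζ) =
      π ((⟪lp.single 2 i (1 : ℂ), η⟫_ℂ * ⟪ζ, lp.single 2 j (1 : ℂ)⟫_ℂ) • b) := by
  change (tensorVec _)† ∘L (tensorVec η ∘L π b ∘L (tensorVec ζ)†) ∘L tensorVec _ = _
  rw [ContinuousLinearMap.comp_assoc, ContinuousLinearMap.comp_assoc,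
    tensorVec_adjoint_comp, ← ContinuousLinearMap.comp_assoc, tensorVec_adjoint_comp, map_smul]
  ext ξ
  simp [smul_smul, mul_comm]

section Isometric

variable (hiso : ∀ b, ‖π₁ b‖ = ‖π₂ b‖)

include hiso in
/-- Corresponding matrix entries of the two components of an element of the graph have the same
norm, because they are limits of pairs `(π₁(b), π₂(b))`. -/
theorem norm_entry_eq {z} (hz : z ∈ tensorIdGraph J π₁ π₂) (i j : J) :
    ‖(tensorBasis i)† ∘L z.1 ∘L tensorBasis j‖ = ‖(tensorBasis i)† ∘L z.2 ∘L tensorBasis j‖ := by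
  classical
  let R : Submodule ℂ ((K₁ →L[ℂ] K₁) × (K₂ →L[ℂ] K₂)) :=
    LinearMap.range ((π₁ : B →ₗ[ℂ] _).prod (π₂ : B →ₗ[ℂ] _))
  have hR : ∀ w ∈ R.topologicalClosure, ‖w.1‖ = ‖w.2‖ := by
    intro w hw
    refine closure_minimal (s := SetLike.coe R) (t := {w | ‖w.1‖ = ‖w.2‖}) ?_
      (isClosed_eq (by fun_prop) (by fun_prop)) hw
    rintro _ ⟨b, rfl⟩
    exact hiso b
  let E : ((ell2 J K₁ →L[ℂ] ell2 J K₁) × (ell2 J K₂ →L[ℂ] ell2 J K₂)) →L[ℂ]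
      ((K₁ →L[ℂ] K₁) × (K₂ →L[ℂ] K₂)) :=
    ContinuousLinearMap.prodMap (entryL (K := K₁) i j) (entryL (K := K₂) i j)
  have key : tensorIdGraph J π₁ π₂ ≤ R.topologicalClosure.comap E.toLinearMap := by
    refine tensorIdGraph_le ?_ fun b η ζ => ?_
    · exact R.isClosed_topologicalClosure.preimage E.continuous
    · refine R.le_topologicalClosure
        ⟨(⟪lp.single 2 i (1 : ℂ), η⟫_ℂ * ⟪ζ, lp.single 2 j (1 : ℂ)⟫_ℂ) • b, ?_⟩
      exact Prod.ext (entryL_tensorRankOne π₁ b η ζ i j).symm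
        (entryL_tensorRankOne π₂ b η ζ i j).symm
  have h : ‖entryL i j z.1‖ = ‖entryL i j z.2‖ := hR (E z) (key hz)
  rwa [entryL_apply, entryL_apply] at h

theorem eq_zero_of_entries {K : Type*} [NormedAddCommGroup K] [InnerProductSpace ℂ K]
    [CompleteSpace K] {T : ell2 J K →L[ℂ] ell2 J K}
    (h : ∀ i j, ‖(tensorBasis i)† ∘L T ∘L tensorBasis j‖ = 0) : T = 0 := by
  refine ext_tensorBasis fun j => ?_
  ext ξ i
  have := congrArg (fun f : K →L[ℂ] K => f ξ) (norm_eq_zero.1 (h i j))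
  simpa [tensorBasis_adjoint_apply] using this

include hiso in
theorem snd_eq_zero_of_fst_eq_zero {z} (hz : z ∈ tensorIdGraph J π₁ π₂) (h : z.1 = 0) :
    z.2 = 0 :=
  eq_zero_of_entries fun i j => by rw [← norm_entry_eq hiso hz, h]; simp

include hiso in
theorem fst_eq_zero_of_snd_eq_zero {z} (hz : z ∈ tensorIdGraph J π₁ π₂) (h : z.2 = 0) :
    z.1 = 0 :=
  eq_zero_of_entries fun i j => by rw [norm_entry_eq hiso hz, h]; simp

include hiso in
/-- `π₂ ⊗ id` is isometric: both coordinate projections of the graph, a C*-algebra, are injective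
*-homomorphisms. -/
theorem norm_fst_eq_norm_snd {z} (hz : z ∈ tensorIdGraph J π₁ π₂) : ‖z.1‖ = ‖z.2‖ :=
  norm_fst_eq_norm_snd_of_injective (tensorIdSpan J π₁ π₂).topologicalClosure
    (tensorIdSpan J π₁ π₂).isClosed_topologicalClosure
    (fun _ hw => snd_eq_zero_of_fst_eq_zero hiso hw)
    (fun _ hw => fst_eq_zero_of_snd_eq_zero hiso hw) hz

end Isometric

end Extension

/-! ### Multipliers and their columns -/

section Multipliers

variable {J B K₁ K₂ : Type*} [Ring B] [StarRing B] [Algebra ℂ B]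
  [NormedAddCommGroup K₁] [InnerProductSpace ℂ K₁] [CompleteSpace K₁]
  [NormedAddCommGroup K₂] [InnerProductSpace ℂ K₂] [CompleteSpace K₂]
  {π₁ : B →⋆ₐ[ℂ] (K₁ →L[ℂ] K₁)} {π₂ : B →⋆ₐ[ℂ] (K₂ →L[ℂ] K₂)}

theorem tensorIdGraph_mul_mem {z w} (hz : z ∈ tensorIdGraph J π₁ π₂)
    (hw : w ∈ tensorIdGraph J π₁ π₂) :
    (z.1 ∘L w.1, z.2 ∘L w.2) ∈ tensorIdGraph J π₁ π₂ :=
  mul_mem (S := NonUnitalStarSubalgebra ℂ _) (s := (tensorIdSpan J π₁ π₂).topologicalClosure) hz hw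

theorem tensorIdGraph_adjoint_mem {z} (hz : z ∈ tensorIdGraph J π₁ π₂) :
    (z.1†, z.2†) ∈ tensorIdGraph J π₁ π₂ :=
  tensorIdGraph_star_mem hz

theorem tensorBasis_mem_tensorIdGraph (b : B) (i j : J) :
    (tensorBasis i ∘L π₁ b ∘L (tensorBasis j)†, tensorBasis i ∘L π₂ b ∘L (tensorBasis j)†) ∈
      tensorIdGraph J π₁ π₂ := by
  classical
  exact rankOne_mem_tensorIdGraph b _ _

theorem tensorBasis_mem_tensorIdGraph_one (i j : J) :
    (tensorBasis i ∘L (tensorBasis j)†, tensorBasis i ∘L (tensorBasis j)†) ∈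
      tensorIdGraph J π₁ π₂ := by
  have := tensorBasis_mem_tensorIdGraph (π₁ := π₁) (π₂ := π₂) 1 i j
  rw [map_one, map_one] at this
  exact this

section Graph

variable (J π₁ π₂)

/-- The closed linear span of the pairs of columns `(b ⊗ |η⟩, π₂(b) ⊗ |η⟩)`. Its first coordinates
form the Hilbert `B`-module `B ⊗ ℓ²(J)`. -/
def colGraph : Submodule ℂ ((K₁ →L[ℂ] ell2 J K₁) × (K₂ →L[ℂ] ell2 J K₂)) :=
  (Submodule.span ℂ {z | ∃ (b : B) (η : ell2 J ℂ),
    z = (tensorVec η ∘L π₁ b, tensorVec η ∘L π₂ b)}).topologicalClosure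

end Graph

theorem tensorVec_mem_colGraph (b : B) (η : ell2 J ℂ) :
    (tensorVec η ∘L π₁ b, tensorVec η ∘L π₂ b) ∈ colGraph J π₁ π₂ :=
  Submodule.le_topologicalClosure _ (Submodule.subset_span ⟨b, η, rfl⟩)

theorem tensorBasis_mem_colGraph (b : B) (j : J) :
    (tensorBasis j ∘L π₁ b, tensorBasis j ∘L π₂ b) ∈ colGraph J π₁ π₂ := by
  classical
  exact tensorVec_mem_colGraph b _

theorem colGraph_le
    {P : Submodule ℂ ((K₁ →L[ℂ] ell2 J K₁) × (K₂ →L[ℂ] ell2 J K₂))}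
    (hP : IsClosed (SetLike.coe P))
    (h : ∀ (b : B) (η : ell2 J ℂ), (tensorVec η ∘L π₁ b, tensorVec η ∘L π₂ b) ∈ P) :
    colGraph J π₁ π₂ ≤ P := by
  refine Submodule.topologicalClosure_minimal _ (Submodule.span_le.2 ?_) hP
  rintro _ ⟨b, η, rfl⟩
  exact h b η

/-- Right multiplication of operators by a fixed operator, in both components. -/
def precompPair {E₁ F₁ G₁ E₂ F₂ G₂ : Type*} [NormedAddCommGroup E₁] [NormedSpace ℂ E₁]
    [NormedAddCommGroup F₁] [NormedSpace ℂ F₁] [NormedAddCommGroup G₁] [NormedSpace ℂ G₁]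
    [NormedAddCommGroup E₂] [NormedSpace ℂ E₂]
    [NormedAddCommGroup F₂] [NormedSpace ℂ F₂] [NormedAddCommGroup G₂] [NormedSpace ℂ G₂]
    (S₁ : E₁ →L[ℂ] F₁) (S₂ : E₂ →L[ℂ] F₂) :
    ((F₁ →L[ℂ] G₁) × (F₂ →L[ℂ] G₂)) →L[ℂ] ((E₁ →L[ℂ] G₁) × (E₂ →L[ℂ] G₂)) :=
  ContinuousLinearMap.prodMap ((ContinuousLinearMap.compL ℂ E₁ F₁ G₁).flip S₁)
    ((ContinuousLinearMap.compL ℂ E₂ F₂ G₂).flip S₂)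

theorem mem_comap_precompPair {E₁ F₁ G₁ E₂ F₂ G₂ : Type*} [NormedAddCommGroup E₁]
    [NormedSpace ℂ E₁] [NormedAddCommGroup F₁] [NormedSpace ℂ F₁]
    [NormedAddCommGroup G₁] [NormedSpace ℂ G₁] [NormedAddCommGroup E₂] [NormedSpace ℂ E₂]
    [NormedAddCommGroup F₂] [NormedSpace ℂ F₂] [NormedAddCommGroup G₂] [NormedSpace ℂ G₂]
    {S₁ : E₁ →L[ℂ] F₁} {S₂ : E₂ →L[ℂ] F₂}
    {P : Submodule ℂ ((E₁ →L[ℂ] G₁) × (E₂ →L[ℂ] G₂))} {z : (F₁ →L[ℂ] G₁) × (F₂ →L[ℂ] G₂)} :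
    z ∈ P.comap (precompPair S₁ S₂).toLinearMap ↔ (z.1 ∘L S₁, z.2 ∘L S₂) ∈ P := Iff.rfl

/-- Left multiplication of operators by a fixed operator, in both components. -/
def postcompPair {E₁ F₁ G₁ E₂ F₂ G₂ : Type*} [NormedAddCommGroup E₁] [NormedSpace ℂ E₁]
    [NormedAddCommGroup F₁] [NormedSpace ℂ F₁] [NormedAddCommGroup G₁] [NormedSpace ℂ G₁]
    [NormedAddCommGroup E₂] [NormedSpace ℂ E₂]
    [NormedAddCommGroup F₂] [NormedSpace ℂ F₂] [NormedAddCommGroup G₂] [NormedSpace ℂ G₂]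
    (S₁ : F₁ →L[ℂ] G₁) (S₂ : F₂ →L[ℂ] G₂) :
    ((E₁ →L[ℂ] F₁) × (E₂ →L[ℂ] F₂)) →L[ℂ] ((E₁ →L[ℂ] G₁) × (E₂ →L[ℂ] G₂)) :=
  ContinuousLinearMap.prodMap (ContinuousLinearMap.compL ℂ E₁ F₁ G₁ S₁)
    (ContinuousLinearMap.compL ℂ E₂ F₂ G₂ S₂)

theorem mem_comap_postcompPair {E₁ F₁ G₁ E₂ F₂ G₂ : Type*} [NormedAddCommGroup E₁]
    [NormedSpace ℂ E₁] [NormedAddCommGroup F₁] [NormedSpace ℂ F₁]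
    [NormedAddCommGroup G₁] [NormedSpace ℂ G₁] [NormedAddCommGroup E₂] [NormedSpace ℂ E₂]
    [NormedAddCommGroup F₂] [NormedSpace ℂ F₂] [NormedAddCommGroup G₂] [NormedSpace ℂ G₂]
    {S₁ : F₁ →L[ℂ] G₁} {S₂ : F₂ →L[ℂ] G₂}
    {P : Submodule ℂ ((E₁ →L[ℂ] G₁) × (E₂ →L[ℂ] G₂))} {z : (E₁ →L[ℂ] F₁) × (E₂ →L[ℂ] F₂)} :
    z ∈ P.comap (postcompPair S₁ S₂).toLinearMap ↔ (S₁ ∘L z.1, S₂ ∘L z.2) ∈ P := Iff.rfl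

/-- A column followed by an elementary row is in the graph of `π₂ ⊗ id`. -/
theorem colGraph_comp_mem {x} (hx : x ∈ colGraph J π₁ π₂) (b : B) (ζ : ell2 J ℂ) :
    (x.1 ∘L (π₁ b ∘L (tensorVec ζ)†), x.2 ∘L (π₂ b ∘L (tensorVec ζ)†)) ∈
      tensorIdGraph J π₁ π₂ := by
  have key : colGraph J π₁ π₂ ≤ (tensorIdGraph J π₁ π₂).comap
      (precompPair (π₁ b ∘L (tensorVec ζ)†) (π₂ b ∘L (tensorVec ζ)†)).toLinearMap := by
    refine colGraph_le ?_ fun c η => ?_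
    · exact (Submodule.isClosed_topologicalClosure _).preimage
        (precompPair (π₁ b ∘L (tensorVec ζ)†) (π₂ b ∘L (tensorVec ζ)†)).continuous
    · rw [mem_comap_precompPair]
      have := rankOne_mem_tensorIdGraph (π₁ := π₁) (π₂ := π₂) (c * b) η ζ
      rw [map_mul, map_mul] at this
      exact this
  exact mem_comap_precompPair.1 (key hx)

/-- A column, put into the `j`-th place of an otherwise zero operator, gives an element of
`B ⊗ K(ℓ²(J))`. -/
theorem colGraph_comp_tensorBasis_mem {x} (hx : x ∈ colGraph J π₁ π₂) (j : J) :
    (x.1 ∘L (tensorBasis j)†, x.2 ∘L (tensorBasis j)†) ∈ tensorIdGraph J π₁ π₂ := by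
  classical
  have := colGraph_comp_mem hx 1 (lp.single 2 j 1)
  rw [map_one, map_one] at this
  exact this

theorem comp_tensorBasis_adjoint_comp {K E : Type*} [NormedAddCommGroup K] [InnerProductSpace ℂ K]
    [CompleteSpace K] [NormedAddCommGroup E] [NormedSpace ℂ E] (x : K →L[ℂ] E) (j : J) :
    (x ∘L (tensorBasis j)†) ∘L tensorBasis j = x := by
  rw [ContinuousLinearMap.comp_assoc, tensorBasis_adjoint_comp_self, ContinuousLinearMap.comp_id]

theorem norm_comp_tensorBasis_adjoint {K E : Type*} [NormedAddCommGroup K]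
    [InnerProductSpace ℂ K] [CompleteSpace K] [NormedAddCommGroup E] [NormedSpace ℂ E]
    (x : K →L[ℂ] E) (j : J) : ‖x ∘L (tensorBasis j)†‖ = ‖x‖ := by
  refine le_antisymm ?_ ?_
  · refine (ContinuousLinearMap.opNorm_comp_le _ _).trans ?_
    rw [LinearIsometryEquiv.norm_map]
    exact mul_le_of_le_one_right (norm_nonneg _) (norm_tensorBasis_le j)
  · conv_lhs => rw [← comp_tensorBasis_adjoint_comp x j]
    exact (ContinuousLinearMap.opNorm_comp_le _ _).trans
      (mul_le_of_le_one_right (norm_nonneg _) (norm_tensorBasis_le j))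

/-- A pair of operators that maps the pairs of basis columns into the graph of columns, and whose
adjoints do so, consists of a multiplier and its image. -/
theorem isTensorIdImage_of_columns {m : ell2 J K₁ →L[ℂ] ell2 J K₁} {T : ell2 J K₂ →L[ℂ] ell2 J K₂}
    (h : ∀ j, (m ∘L tensorBasis j, T ∘L tensorBasis j) ∈ colGraph J π₁ π₂)
    (h' : ∀ j, (m† ∘L tensorBasis j, T† ∘L tensorBasis j) ∈ colGraph J π₁ π₂) :
    IsTensorIdImage π₁ π₂ m T := by
  classical
  have left : ∀ (m : ell2 J K₁ →L[ℂ] ell2 J K₁) (T : ell2 J K₂ →L[ℂ] ell2 J K₂),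
      (∀ j, (m ∘L tensorBasis j, T ∘L tensorBasis j) ∈ colGraph J π₁ π₂) →
      ∀ z ∈ tensorIdGraph J π₁ π₂, (m ∘L z.1, T ∘L z.2) ∈ tensorIdGraph J π₁ π₂ := by
    intro m T h
    have key : tensorIdGraph J π₁ π₂ ≤
        (tensorIdGraph J π₁ π₂).comap (postcompPair m T).toLinearMap := by
      refine tensorIdGraph_le ((Submodule.isClosed_topologicalClosure _).preimage
        (postcompPair m T).continuous) fun b η ζ => ?_
      rw [mem_comap_postcompPair]
      -- the vectors `η` with this property form a closed set that contains the basis vectors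
      let f : ell2 J ℂ →L[ℂ]
          (ell2 J K₁ →L[ℂ] ell2 J K₁) × (ell2 J K₂ →L[ℂ] ell2 J K₂) :=
        postcompPair m T ∘L precompPair (π₁ b ∘L (tensorVec ζ)†) (π₂ b ∘L (tensorVec ζ)†) ∘L
          (tensorVecL K₁).prod (tensorVecL K₂)
      have hf : ∀ j, f (lp.single 2 j 1) ∈ tensorIdGraph J π₁ π₂ := by
        intro j
        exact colGraph_comp_mem (h j) b ζ
      have hη := (hasSum_tensorBasis η).mapL f
      refine (Submodule.isClosed_topologicalClosure _).mem_of_tendsto hη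
        (Filter.Eventually.of_forall fun s => ?_)
      refine Submodule.sum_mem _ fun j _ => ?_
      have : tensorBasis j (η j) = η j • (lp.single 2 j 1 : ell2 J ℂ) := by
        rw [tensorBasis_apply, ← lp.single_smul, smul_eq_mul, mul_one]
      rw [this, map_smul]
      exact Submodule.smul_mem _ _ (hf j)
    intro z hz
    exact mem_comap_postcompPair.1 (key hz)
  intro z hz
  refine ⟨left m T h z hz, ?_⟩
  have := tensorIdGraph_adjoint_mem (left _ _ h' _ (tensorIdGraph_adjoint_mem hz))
  simpa only [ContinuousLinearMap.adjoint_comp, ContinuousLinearMap.adjoint_adjoint] using this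

section Isometric

variable (hiso : ∀ b, ‖π₁ b‖ = ‖π₂ b‖)

include hiso in
theorem norm_fst_eq_norm_snd_of_mem_colGraph (j : J) {x} (hx : x ∈ colGraph J π₁ π₂) :
    ‖x.1‖ = ‖x.2‖ := by
  have := norm_fst_eq_norm_snd hiso (colGraph_comp_tensorBasis_mem hx j)
  rwa [norm_comp_tensorBasis_adjoint, norm_comp_tensorBasis_adjoint] at this

include hiso in
theorem eq_of_mem_tensorIdGraph {z : ell2 J K₁ →L[ℂ] ell2 J K₁} {w w' : ell2 J K₂ →L[ℂ] ell2 J K₂}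
    (h : (z, w) ∈ tensorIdGraph J π₁ π₂) (h' : (z, w') ∈ tensorIdGraph J π₁ π₂) : w = w' := by
  have := snd_eq_zero_of_fst_eq_zero hiso (Submodule.sub_mem _ h h') (sub_self z)
  exact sub_eq_zero.1 this

/-- Columns `c_j` in `π₂`-coordinates that correspond to the columns of a bounded operator `m` are
the columns of a bounded operator, because `π₂ ⊗ id` is isometric on the operators
`m (1 ⊗ P)` with `P` a coordinate projection of finite rank. -/
theorem exists_operator_of_columns (hiso : ∀ b, ‖π₁ b‖ = ‖π₂ b‖)
    {m : ell2 J K₁ →L[ℂ] ell2 J K₁} {c : J → K₂ →L[ℂ] ell2 J K₂}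
    (hc : ∀ j, (m ∘L tensorBasis j, c j) ∈ colGraph J π₁ π₂) :
    ∃ T : ell2 J K₂ →L[ℂ] ell2 J K₂, ∀ j, T ∘L tensorBasis j = c j := by
  classical
  have bound : ∀ (s : Finset J) (x : ell2 J K₂),
      ‖∑ j ∈ s, c j (x j)‖ ≤ ‖m‖ * ‖∑ j ∈ s, tensorBasis j (x j)‖ := by
    intro s x
    have hmem : (m ∘L coordProj s, ∑ j ∈ s, c j ∘L (tensorBasis j)†) ∈
        tensorIdGraph J π₁ π₂ := by
      have := Submodule.sum_mem (tensorIdGraph J π₁ π₂) (t := s)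
        fun j _ => colGraph_comp_tensorBasis_mem (hc j) j
      convert this using 1
      rw [Prod.ext_iff, Prod.fst_sum, Prod.snd_sum]
      refine ⟨?_, rfl⟩
      rw [coordProj, ContinuousLinearMap.comp_finsetSum]
      rfl
    have hn := norm_fst_eq_norm_snd hiso hmem
    have hle : ‖∑ j ∈ s, c j ∘L (tensorBasis j)†‖ ≤ ‖m‖ := by
      rw [← hn]
      exact (ContinuousLinearMap.opNorm_comp_le _ _).trans
        (mul_le_of_le_one_right (norm_nonneg _) (norm_coordProj_le s))
    have hx : (∑ j ∈ s, c j ∘L (tensorBasis j)†) (coordProj s x) = ∑ j ∈ s, c j (x j) := by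
      rw [_root_.sum_apply]
      refine Finset.sum_congr rfl fun j hj => ?_
      rw [ContinuousLinearMap.comp_apply, tensorBasis_adjoint_apply, coordProj_apply,
        lp.coeFn_sum, Finset.sum_apply, Finset.sum_eq_single j]
      · rw [tensorBasis_apply, lp.single_apply, Pi.single_eq_same]
      · intro i _ hi
        rw [tensorBasis_apply, lp.single_apply, Pi.single_eq_of_ne hi.symm]
      · exact fun h => absurd hj h
    rw [← hx, ← coordProj_apply]
    exact (ContinuousLinearMap.le_opNorm _ _).trans
      (mul_le_mul_of_nonneg_right hle (norm_nonneg _))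
  have summ : ∀ x : ell2 J K₂, Summable fun j => c j (x j) := by
    intro x
    rw [summable_iff_vanishing_norm]
    intro ε hε
    obtain ⟨s, hs⟩ := summable_iff_vanishing_norm.1 (hasSum_tensorBasis x).summable
      (ε / (‖m‖ + 1)) (by positivity)
    refine ⟨s, fun t ht => (bound t x).trans_lt ?_⟩
    have := (lt_div_iff₀ (by positivity)).1 (hs t ht)
    nlinarith [norm_nonneg (∑ j ∈ t, tensorBasis j (x j)), norm_nonneg m]
  let T₀ : ell2 J K₂ →ₗ[ℂ] ell2 J K₂ :=
    { toFun := fun x => ∑' j, c j (x j)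
      map_add' := fun x y => by
        rw [← (summ x).tsum_add (summ y)]
        exact tsum_congr fun j => map_add (c j) (x j) (y j)
      map_smul' := fun r x => by
        rw [RingHom.id_apply, ← (summ x).tsum_const_smul]
        exact tsum_congr fun j => map_smul (c j) r (x j) }
  have hT₀ : ∀ x, ‖T₀ x‖ ≤ ‖m‖ * ‖x‖ := by
    intro x
    exact le_of_tendsto_of_tendsto (summ x).hasSum.norm
      ((hasSum_tensorBasis x).norm.const_mul ‖m‖)
      (Filter.Eventually.of_forall fun s => bound s x)
  refine ⟨⟨T₀, AddMonoidHomClass.continuous_of_bound T₀ ‖m‖ hT₀⟩, fun j => ?_⟩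
  ext1 ξ
  change ∑' i, c i (tensorBasis j ξ i) = c j ξ
  rw [tsum_eq_single j]
  · rw [tensorBasis_apply, lp.single_apply, Pi.single_eq_same]
  · intro i hi
    rw [tensorBasis_apply, lp.single_apply, Pi.single_eq_of_ne hi, map_zero]

/-- An operator `m` such that the columns of `m` and `m†` lie in `B ⊗ ℓ²(J)` is a multiplier of
`B ⊗ K(ℓ²(J))`, and its image under the extension of `π₂ ⊗ id` exists. -/
theorem exists_isTensorIdImage (hiso : ∀ b, ‖π₁ b‖ = ‖π₂ b‖) {m : ell2 J K₁ →L[ℂ] ell2 J K₁}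
    (h : ∀ j, ∃ c, (m ∘L tensorBasis j, c) ∈ colGraph J π₁ π₂)
    (h' : ∀ j, ∃ c, (m† ∘L tensorBasis j, c) ∈ colGraph J π₁ π₂) :
    ∃ T, IsTensorIdImage π₁ π₂ m T := by
  choose c hc using h
  choose c' hc' using h'
  obtain ⟨T, hT⟩ := exists_operator_of_columns hiso hc
  obtain ⟨T', hT'⟩ := exists_operator_of_columns hiso hc'
  have hTT' : T† = T' := by
    refine ext_tensorBasis fun j => ?_
    ext ξ i
    have e₁ := tensorIdGraph_mul_mem
      (tensorIdGraph_adjoint_mem (colGraph_comp_tensorBasis_mem (hc i) i))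
      (tensorBasis_mem_tensorIdGraph_one (π₁ := π₁) (π₂ := π₂) j j)
    have e₂ := tensorIdGraph_mul_mem (tensorBasis_mem_tensorIdGraph_one (π₁ := π₁) (π₂ := π₂) i i)
      (colGraph_comp_tensorBasis_mem (hc' j) j)
    rw [← hT] at e₁
    rw [← hT'] at e₂
    simp only [ContinuousLinearMap.adjoint_comp, ContinuousLinearMap.adjoint_adjoint,
      ContinuousLinearMap.comp_assoc] at e₁ e₂
    have e := eq_of_mem_tensorIdGraph hiso e₁ e₂
    have := congrArg (fun f : ell2 J K₂ →L[ℂ] ell2 J K₂ => f (tensorBasis j ξ) i) e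
    simpa [tensorBasis_adjoint_apply, tensorBasis_apply] using this
  refine ⟨T, isTensorIdImage_of_columns (fun j => ?_) fun j => ?_⟩
  · rw [hT]; exact hc j
  · rw [hTT', hT']; exact hc' j

end Isometric

end Multipliers

/-! ### The extension of `π₂ ⊗ id` and the compression to the range of a projection -/

section Image

variable {J B K₁ K₂ : Type*} [Ring B] [StarRing B] [Algebra ℂ B]
  [NormedAddCommGroup K₁] [InnerProductSpace ℂ K₁] [CompleteSpace K₁]
  [NormedAddCommGroup K₂] [InnerProductSpace ℂ K₂] [CompleteSpace K₂]
  {π₁ : B →⋆ₐ[ℂ] (K₁ →L[ℂ] K₁)} {π₂ : B →⋆ₐ[ℂ] (K₂ →L[ℂ] K₂)}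
  {m n : ell2 J K₁ →L[ℂ] ell2 J K₁} {T T' S : ell2 J K₂ →L[ℂ] ell2 J K₂}

theorem IsTensorIdImage.comp (hm : IsTensorIdImage π₁ π₂ m T) (hn : IsTensorIdImage π₁ π₂ n S) :
    IsTensorIdImage π₁ π₂ (m ∘L n) (T ∘L S) := fun z hz =>
  ⟨(hm _ (hn z hz).1).1, (hn _ (hm z hz).2).2⟩

theorem IsTensorIdImage.add (hm : IsTensorIdImage π₁ π₂ m T) (hn : IsTensorIdImage π₁ π₂ n S) :
    IsTensorIdImage π₁ π₂ (m + n) (T + S) := fun z hz => by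
  have h₁ := Submodule.add_mem _ (hm z hz).1 (hn z hz).1
  have h₂ := Submodule.add_mem _ (hm z hz).2 (hn z hz).2
  rw [Prod.mk_add_mk, ← ContinuousLinearMap.add_comp, ← ContinuousLinearMap.add_comp] at h₁
  rw [Prod.mk_add_mk, ← ContinuousLinearMap.comp_add, ← ContinuousLinearMap.comp_add] at h₂
  exact ⟨h₁, h₂⟩

theorem IsTensorIdImage.smul (hm : IsTensorIdImage π₁ π₂ m T) (c : ℂ) :
    IsTensorIdImage π₁ π₂ (c • m) (c • T) := fun z hz => by
  have h₁ := Submodule.smul_mem _ c (hm z hz).1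
  have h₂ := Submodule.smul_mem _ c (hm z hz).2
  rw [Prod.smul_mk, ← ContinuousLinearMap.smul_comp, ← ContinuousLinearMap.smul_comp] at h₁
  rw [Prod.smul_mk, ← ContinuousLinearMap.comp_smul, ← ContinuousLinearMap.comp_smul] at h₂
  exact ⟨h₁, h₂⟩

theorem IsTensorIdImage.adjoint (hm : IsTensorIdImage π₁ π₂ m T) :
    IsTensorIdImage π₁ π₂ (m†) (T†) := fun z hz => by
  have h := hm _ (tensorIdGraph_adjoint_mem hz)
  have h₁ := tensorIdGraph_adjoint_mem h.1
  have h₂ := tensorIdGraph_adjoint_mem h.2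
  simp only [ContinuousLinearMap.adjoint_comp, ContinuousLinearMap.adjoint_adjoint] at h₁ h₂
  exact ⟨h₂, h₁⟩

variable (hiso : ∀ b, ‖π₁ b‖ = ‖π₂ b‖)

include hiso in
/-- If a multiplier maps a basis column to the column of an element of `B`, so does its image. -/
theorem IsTensorIdImage.comp_tensorBasis_eq (hm : IsTensorIdImage π₁ π₂ m T) {i j : J} {b : B}
    (h : m ∘L tensorBasis j = tensorBasis i ∘L π₁ b) :
    T ∘L tensorBasis j = tensorBasis i ∘L π₂ b := by
  have h₁ := (hm _ (tensorBasis_mem_tensorIdGraph_one j j)).1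
  have h₂ := tensorBasis_mem_tensorIdGraph (π₁ := π₁) (π₂ := π₂) b i j
  simp only [← ContinuousLinearMap.comp_assoc] at h₁ h₂
  rw [h] at h₁
  have e := congrArg (fun f => f ∘L tensorBasis j) (eq_of_mem_tensorIdGraph hiso h₁ h₂)
  simpa only [comp_tensorBasis_adjoint_comp] using e

include hiso in
theorem IsTensorIdImage.unique (hT : IsTensorIdImage π₁ π₂ m T) (hT' : IsTensorIdImage π₁ π₂ m T') :
    T = T' := by
  refine ext_tensorBasis fun j => ?_
  have e := eq_of_mem_tensorIdGraph hiso (hT _ (tensorBasis_mem_tensorIdGraph_one j j)).1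
    (hT' _ (tensorBasis_mem_tensorIdGraph_one j j)).1
  have e := congrArg (fun f => f ∘L tensorBasis j) e
  simp only [← ContinuousLinearMap.comp_assoc, comp_tensorBasis_adjoint_comp] at e
  exact e

include hiso in
theorem IsTensorIdImage.eq_zero (hT : IsTensorIdImage π₁ π₂ m 0) : m = 0 := by
  refine ext_tensorBasis fun j => ?_
  have e := fst_eq_zero_of_snd_eq_zero hiso (hT _ (tensorBasis_mem_tensorIdGraph_one j j)).1
    (ContinuousLinearMap.zero_comp _)
  have e := congrArg (fun f => f ∘L tensorBasis j) e
  simp only [← ContinuousLinearMap.comp_assoc, comp_tensorBasis_adjoint_comp] at e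
  exact e

theorem isometry_adjoint_comp_self {H K : Type*} [NormedAddCommGroup H] [InnerProductSpace ℂ H]
    [CompleteSpace H] [NormedAddCommGroup K] [InnerProductSpace ℂ K] [CompleteSpace K]
    (s : H →ₗᵢ[ℂ] K) :
    s.toContinuousLinearMap† ∘L s.toContinuousLinearMap = ContinuousLinearMap.id ℂ H := by
  ext x
  refine ext_inner_left ℂ fun v => ?_
  rw [ContinuousLinearMap.comp_apply, ContinuousLinearMap.adjoint_inner_right]
  exact s.inner_map_map v x

theorem isometry_adjoint_apply {H K : Type*} [NormedAddCommGroup H] [InnerProductSpace ℂ H]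
    [CompleteSpace H] [NormedAddCommGroup K] [InnerProductSpace ℂ K] [CompleteSpace K]
    (s : H →ₗᵢ[ℂ] K) (x : H) :
    ContinuousLinearMap.adjoint s.toContinuousLinearMap (s x) = x :=
  congrArg (fun f : H →L[ℂ] H => f x) (isometry_adjoint_comp_self s)

theorem eq_zero_of_conj_isometry {H K : Type*} [NormedAddCommGroup H] [InnerProductSpace ℂ H]
    [CompleteSpace H] [NormedAddCommGroup K] [InnerProductSpace ℂ K] [CompleteSpace K]
    (s : H →ₗᵢ[ℂ] K) {T : H →L[ℂ] H}
    (h : s.toContinuousLinearMap ∘L T ∘L s.toContinuousLinearMap† = 0) : T = 0 := by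
  ext ξ
  have h3 : s (T (ContinuousLinearMap.adjoint s.toContinuousLinearMap (s ξ))) = 0 :=
    DFunLike.congr_fun h (s ξ)
  rw [isometry_adjoint_apply] at h3
  exact s.injective (h3.trans (map_zero s).symm)

/-- If `ρ` is a unital representation on `H` and `s : H → K₁ ⊗ ℓ²(J)` an isometry such that all
operators `s ρ(x) s†` are multipliers of `B ⊗ K(ℓ²(J))`, then `x ↦ (π₂ ⊗ id)(s ρ(x) s†)` is a unital
representation on the range of the projection `(π₂ ⊗ id)(s s†)`. -/
theorem exists_compressed_rep {A H : Type*} [CStarAlgebra A] [NormedAddCommGroup H]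
    [InnerProductSpace ℂ H] [CompleteSpace H] (hiso : ∀ b, ‖π₁ b‖ = ‖π₂ b‖)
    (ρ : A →⋆ₐ[ℂ] (H →L[ℂ] H)) (s : H →ₗᵢ[ℂ] ell2 J K₁)
    (hex : ∀ x, ∃ T, IsTensorIdImage π₁ π₂
      (s.toContinuousLinearMap ∘L ρ x ∘L s.toContinuousLinearMap†) T) :
    ∃ (Hp : Submodule ℂ (ell2 J K₂)) (_ : CompleteSpace Hp),
      (∀ q, IsTensorIdImage π₁ π₂ (s.toContinuousLinearMap ∘L s.toContinuousLinearMap†) q ↔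
        q = Hp.starProjection) ∧
      ∃ rep : A →⋆ₐ[ℂ] (Hp →L[ℂ] Hp),
        (∀ x T, IsTensorIdImage π₁ π₂
          (s.toContinuousLinearMap ∘L ρ x ∘L s.toContinuousLinearMap†) T ↔
            T = Hp.subtypeL ∘L rep x ∘L Hp.subtypeL†) ∧
        (Function.Injective ρ → Function.Injective rep) := by
  choose Φ hΦ using hex
  have hss := isometry_adjoint_comp_self s
  have cancel : ∀ Y : ell2 J K₁ →L[ℂ] H,
      s.toContinuousLinearMap† ∘L s.toContinuousLinearMap ∘L Y = Y := by
    intro Y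
    rw [← ContinuousLinearMap.comp_assoc, hss, ContinuousLinearMap.id_comp]
  have hmul : ∀ x y, Φ (x * y) = Φ x ∘L Φ y := fun x y => by
    refine (hΦ (x * y)).unique hiso ?_
    convert (hΦ x).comp (hΦ y) using 1
    rw [map_mul]
    simp only [ContinuousLinearMap.comp_assoc, cancel, ContinuousLinearMap.mul_def]
  have hadd : ∀ x y, Φ (x + y) = Φ x + Φ y := fun x y => by
    refine (hΦ (x + y)).unique hiso ?_
    convert (hΦ x).add (hΦ y) using 1
    rw [map_add, ContinuousLinearMap.add_comp, ContinuousLinearMap.comp_add]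
  have hsmul : ∀ (c : ℂ) x, Φ (c • x) = c • Φ x := fun c x => by
    refine (hΦ (c • x)).unique hiso ?_
    convert (hΦ x).smul c using 1
    rw [map_smul, ContinuousLinearMap.smul_comp, ContinuousLinearMap.comp_smul]
  have hstar : ∀ x, Φ (star x) = (Φ x)† := fun x => by
    refine (hΦ (star x)).unique hiso ?_
    convert (hΦ x).adjoint using 1
    simp only [ContinuousLinearMap.adjoint_comp, ContinuousLinearMap.adjoint_adjoint, map_star,
      ContinuousLinearMap.star_eq_adjoint, ContinuousLinearMap.comp_assoc]
  have hone : IsTensorIdImage π₁ π₂ (s.toContinuousLinearMap ∘L s.toContinuousLinearMap†) (Φ 1) := by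
    have := hΦ 1
    rwa [map_one] at this
  have hp : IsStarProjection (Φ 1) := by
    refine ⟨?_, ?_⟩
    · rw [IsIdempotentElem, ContinuousLinearMap.mul_def, ← hmul, mul_one]
    · rw [IsSelfAdjoint, ContinuousLinearMap.star_eq_adjoint, ← hstar, star_one]
  obtain ⟨Hp, hcomp, hproj⟩ : ∃ (Hp : Submodule ℂ (ell2 J K₂)) (_ : CompleteSpace Hp),
      Φ 1 = Hp.starProjection := by
    obtain ⟨_, hE⟩ := isStarProjection_iff_eq_starProjection_range.1 hp
    have hc : IsClosed (SetLike.coe (Φ 1).range) :=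
      ContinuousLinearMap.IsIdempotentElem.isClosed_range hp.isIdempotentElem
    exact ⟨(Φ 1).range, hc.completeSpace_coe, hE⟩
  have hι : Hp.subtypeL ∘L Hp.subtypeL† = Φ 1 := by
    rw [hproj, Submodule.adjoint_subtypeL]; rfl
  have hι' : Hp.subtypeL† ∘L Hp.subtypeL = ContinuousLinearMap.id ℂ Hp :=
    isometry_adjoint_comp_self Hp.subtypeₗᵢ
  have hΦι : ∀ x, Hp.subtypeL ∘L (Hp.subtypeL† ∘L Φ x ∘L Hp.subtypeL) ∘L Hp.subtypeL† = Φ x := by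
    intro x
    calc _ = (Hp.subtypeL ∘L Hp.subtypeL†) ∘L Φ x ∘L (Hp.subtypeL ∘L Hp.subtypeL†) := rfl
      _ = Φ x := by rw [hι, ← hmul, ← hmul, mul_one, one_mul]
  refine ⟨Hp, hcomp, fun q => ⟨fun h => ?_, fun h => ?_⟩, ?_⟩
  · rw [← hproj]; exact h.unique hiso hone
  · rw [h, ← hproj]; exact hone
  let rep : A →⋆ₐ[ℂ] (Hp →L[ℂ] Hp) :=
    { toFun := fun x => Hp.subtypeL† ∘L Φ x ∘L Hp.subtypeL
      map_one' := by
        calc _ = Hp.subtypeL† ∘L (Hp.subtypeL ∘L Hp.subtypeL†) ∘L Hp.subtypeL := by rw [hι]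
          _ = (Hp.subtypeL† ∘L Hp.subtypeL) ∘L (Hp.subtypeL† ∘L Hp.subtypeL) := rfl
          _ = 1 := by rw [hι']; rfl
      map_mul' := fun x y => by
        calc _ = Hp.subtypeL† ∘L (Φ x ∘L Φ 1 ∘L Φ y) ∘L Hp.subtypeL := by
              rw [← hmul, ← hmul, one_mul]
          _ = _ := by rw [← hι]; rfl
      map_zero' := by
        have : Φ 0 = 0 := by simpa using hsmul 0 0
        rw [this, ContinuousLinearMap.zero_comp, ContinuousLinearMap.comp_zero]
      map_add' := fun x y => by
        rw [hadd, ContinuousLinearMap.add_comp, ContinuousLinearMap.comp_add]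
      commutes' := fun c => by
        rw [Algebra.algebraMap_eq_smul_one, hsmul, ContinuousLinearMap.smul_comp,
          ContinuousLinearMap.comp_smul, Algebra.algebraMap_eq_smul_one]
        congr 1
        calc _ = Hp.subtypeL† ∘L (Hp.subtypeL ∘L Hp.subtypeL†) ∘L Hp.subtypeL := by rw [hι]
          _ = (Hp.subtypeL† ∘L Hp.subtypeL) ∘L (Hp.subtypeL† ∘L Hp.subtypeL) := rfl
          _ = 1 := by rw [hι']; rfl
      map_star' := fun x => by
        rw [hstar, ContinuousLinearMap.star_eq_adjoint, ContinuousLinearMap.adjoint_comp,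
          ContinuousLinearMap.adjoint_comp, ContinuousLinearMap.adjoint_adjoint]
        rfl }
  have hrep : ∀ x, rep x = Hp.subtypeL† ∘L Φ x ∘L Hp.subtypeL := fun x => rfl
  refine ⟨rep, fun x T => ⟨fun h => ?_, fun h => ?_⟩, fun hρ => ?_⟩
  · rw [hrep, hΦι]; exact h.unique hiso (hΦ x)
  · rw [h, hrep, hΦι]; exact hΦ x
  · rw [injective_iff_map_eq_zero]
    intro x hx
    have h0 : Φ x = 0 := by
      rw [← hΦι, ← hrep, hx, ContinuousLinearMap.zero_comp, ContinuousLinearMap.comp_zero]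
    have h1 := hΦ x
    rw [h0] at h1
    exact (injective_iff_map_eq_zero ρ).1 hρ x (eq_zero_of_conj_isometry s (h1.eq_zero hiso))

end Image

/-! ### Block-diagonal isometries -/

section Block

variable {Λ : Type*} {X Y : Λ → Type*} [∀ σ, Fintype (X σ)] [∀ σ, Fintype (Y σ)]
  {K : Type*} [NormedAddCommGroup K] [InnerProductSpace ℂ K] [CompleteSpace K]

open Classical in
/-- A family of finite matrices of operators that are isometries defines an isometry between the
Hilbert space direct sums. -/
theorem exists_block_isometry (M : ∀ σ, Y σ → X σ → (K →L[ℂ] K))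
    (hM : ∀ σ x x', ∑ y, (M σ y x)† ∘L M σ y x' =
      if x = x' then ContinuousLinearMap.id ℂ K else 0) :
    ∃ U : ell2 (Σ σ, X σ) K →ₗᵢ[ℂ] ell2 (Σ σ, Y σ) K,
      ∀ f σ y, U f ⟨σ, y⟩ = ∑ x, M σ y x (f ⟨σ, x⟩) := by
  have h2 : 0 < (2 : ENNReal).toReal := by norm_num
  have block : ∀ σ (v : X σ → K), ∑ y, ‖∑ x, M σ y x (v x)‖ ^ (2 : ENNReal).toReal =
      ∑ x, ‖v x‖ ^ (2 : ENNReal).toReal := by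
    intro σ v
    simp only [ENNReal.toReal_ofNat, Real.rpow_two]
    have : ((∑ y, ‖∑ x, M σ y x (v x)‖ ^ 2 : ℝ) : ℂ) = ((∑ x, ‖v x‖ ^ 2 : ℝ) : ℂ) := by
      have hn : ∀ v : K, ((‖v‖ ^ 2 : ℝ) : ℂ) = ⟪v, v⟫_ℂ := fun v => by
        rw [inner_self_eq_norm_sq_to_K, Complex.ofReal_pow]; rfl
      rw [Complex.ofReal_sum, Complex.ofReal_sum]
      simp only [hn]
      calc ∑ y, ⟪∑ x, M σ y x (v x), ∑ x, M σ y x (v x)⟫_ℂ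
          = ∑ y, ∑ x, ∑ x', ⟪v x, ((M σ y x)† ∘L M σ y x') (v x')⟫_ℂ := by
            refine Finset.sum_congr rfl fun y _ => ?_
            rw [sum_inner]
            refine Finset.sum_congr rfl fun x _ => ?_
            rw [inner_sum]
            refine Finset.sum_congr rfl fun x' _ => ?_
            rw [ContinuousLinearMap.comp_apply, ContinuousLinearMap.adjoint_inner_right]
        _ = ∑ x, ∑ x', ⟪v x, (∑ y, (M σ y x)† ∘L M σ y x') (v x')⟫_ℂ := by
            rw [Finset.sum_comm]
            refine Finset.sum_congr rfl fun x _ => ?_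
            rw [Finset.sum_comm]
            refine Finset.sum_congr rfl fun x' _ => ?_
            rw [_root_.sum_apply, inner_sum]
        _ = ∑ x, ⟪v x, v x⟫_ℂ := by
            refine Finset.sum_congr rfl fun x _ => ?_
            simp only [hM]
            rw [Finset.sum_eq_single x]
            · simp
            · intro x' _ h; simp [h.symm]
            · intro h; exact absurd (Finset.mem_univ _) h
    exact_mod_cast this
  have hsum : ∀ f : ell2 (Σ σ, X σ) K,
      HasSum (fun j : Σ σ, Y σ => ‖∑ x, M j.1 j.2 x (f ⟨j.1, x⟩)‖ ^ (2 : ENNReal).toReal)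
        (‖f‖ ^ (2 : ENNReal).toReal) := by
    intro f
    have h := (lp.hasSum_norm h2 f).sigma fun σ => hasSum_fintype _
    simp only [← block] at h
    have hs : Summable
        (fun j : Σ σ, Y σ => ‖∑ x, M j.1 j.2 x (f ⟨j.1, x⟩)‖ ^ (2 : ENNReal).toReal) := by
      refine (summable_sigma_of_nonneg fun j => by positivity).2
        ⟨fun σ => (hasSum_fintype _).summable, ?_⟩
      simpa only [tsum_fintype] using h.summable
    have h' := hs.hasSum.sigma fun σ => hasSum_fintype _
    rw [← h'.unique h]
    exact hs.hasSum
  let U₀ : ell2 (Σ σ, X σ) K →ₗ[ℂ] ell2 (Σ σ, Y σ) K :=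
    { toFun := fun f => ⟨fun j => ∑ x, M j.1 j.2 x (f ⟨j.1, x⟩),
        (memℓp_gen_iff h2).2 (hsum f).summable⟩
      map_add' := fun f g => by
        refine lp.ext (funext fun j => ?_)
        change ∑ x, M j.1 j.2 x (f ⟨j.1, x⟩ + g ⟨j.1, x⟩) =
          ∑ x, M j.1 j.2 x (f ⟨j.1, x⟩) + ∑ x, M j.1 j.2 x (g ⟨j.1, x⟩)
        simp only [map_add, Finset.sum_add_distrib]
      map_smul' := fun c f => by
        refine lp.ext (funext fun j => ?_)
        change ∑ x, M j.1 j.2 x (c • f ⟨j.1, x⟩) = c • ∑ x, M j.1 j.2 x (f ⟨j.1, x⟩)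
        simp only [map_smul, Finset.smul_sum] }
  refine ⟨⟨U₀, fun f => ?_⟩, fun f σ y => rfl⟩
  have h := (lp.hasSum_norm h2 (U₀ f)).unique (hsum f)
  simp only [ENNReal.toReal_ofNat, Real.rpow_two] at h
  exact (sq_eq_sq₀ (norm_nonneg _) (norm_nonneg _)).1 h

end Block

/-! ### Haar measure on a compact group -/

section Haar

variable {G : Type*} [Group G] [TopologicalSpace G] [IsTopologicalGroup G] [CompactSpace G]
  [MeasurableSpace G] [BorelSpace G] (ν : Measure G) [ν.IsHaarMeasure]
  [IsProbabilityMeasure ν]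

/-- Compact groups are unimodular: a right translate of `ν` is a left-invariant probability measure,
and therefore equal to `ν`. -/
theorem isMulRightInvariant_of_compact : ν.IsMulRightInvariant := by
  refine ⟨fun g => ?_⟩
  have h := Measure.isMulInvariant_eq_smul_of_compactSpace (ν.map (· * g)) ν
  have h1 := congrArg (fun μ : Measure G => μ Set.univ) h
  simp only [Measure.smul_apply, measure_univ] at h1
  rw [Measure.map_apply (by fun_prop) MeasurableSet.univ, Set.preimage_univ, measure_univ] at h1
  rw [h]
  have h2 : Measure.haarScalarFactor (ν.map (· * g)) ν = 1 := by
    simpa [ENNReal.smul_def] using h1.symm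
  rw [h2, one_smul]

theorem integrable_of_continuous {E : Type*} [NormedAddCommGroup E] {f : G → E}
    (hf : Continuous f) : Integrable f ν :=
  hf.integrable_of_hasCompactSupport (HasCompactSupport.of_compactSpace f)

end Haar

/-! ### Schur orthogonality -/

section Schur

variable {G : Type*} [Group G]

theorem unitary_entry_mul {d : ℕ} (ρ : G →* Matrix.unitaryGroup (Fin d) ℂ) (g h : G)
    (l k : Fin d) : (ρ (g * h) : Matrix (Fin d) (Fin d) ℂ) l k =
      ∑ m, (ρ g : Matrix (Fin d) (Fin d) ℂ) l m * (ρ h : Matrix (Fin d) (Fin d) ℂ) m k := by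
  rw [map_mul, Submonoid.coe_mul, Matrix.mul_apply]

theorem unitary_entry_inv {d : ℕ} (ρ : G →* Matrix.unitaryGroup (Fin d) ℂ) (g : G)
    (l k : Fin d) : (ρ g⁻¹ : Matrix (Fin d) (Fin d) ℂ) l k =
      star ((ρ g : Matrix (Fin d) (Fin d) ℂ) k l) := by
  rw [map_inv]; rfl

/-- **Schur's lemma**: a nonzero intertwiner between irreducible representations is invertible. -/
theorem eq_zero_or_isEquivRep {d e : ℕ} {ρ : G →* Matrix.unitaryGroup (Fin d) ℂ}
    {τ : G →* Matrix.unitaryGroup (Fin e) ℂ} (hρ : IsIrred ρ) (hτ : IsIrred τ)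
    (T : (Fin d → ℂ) →ₗ[ℂ] (Fin e → ℂ))
    (hT : ∀ g v, T ((ρ g : Matrix (Fin d) (Fin d) ℂ) *ᵥ v) =
      (τ g : Matrix (Fin e) (Fin e) ℂ) *ᵥ T v) :
    T = 0 ∨ Function.Bijective T := by
  rcases hρ.2 (LinearMap.ker T) (fun g w hw => by
    rw [LinearMap.mem_ker] at hw ⊢; rw [hT, hw, Matrix.mulVec_zero]) with h | h
  · rcases hτ.2 (LinearMap.range T) (fun g w hw => by
      obtain ⟨v, rfl⟩ := hw; exact ⟨_, hT g v⟩) with h' | h'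
    · exact Or.inl (LinearMap.range_eq_bot.1 h')
    · exact Or.inr ⟨LinearMap.ker_eq_bot.1 h, LinearMap.range_eq_top.1 h'⟩
  · exact Or.inl (LinearMap.ker_eq_top.1 h)

/-- **Schur's lemma**: a self-intertwiner of an irreducible representation is a scalar. -/
theorem exists_eq_smul_of_intertwines {d : ℕ} {ρ : G →* Matrix.unitaryGroup (Fin d) ℂ}
    (hρ : IsIrred ρ) (T : (Fin d → ℂ) →ₗ[ℂ] (Fin d → ℂ))
    (hT : ∀ g v, T ((ρ g : Matrix (Fin d) (Fin d) ℂ) *ᵥ v) =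
      (ρ g : Matrix (Fin d) (Fin d) ℂ) *ᵥ T v) :
    ∃ c : ℂ, T = c • LinearMap.id := by
  have : Nonempty (Fin d) := ⟨⟨0, hρ.1⟩⟩
  obtain ⟨c, hc⟩ := Module.End.exists_eigenvalue T
  obtain ⟨v, hv, hv0⟩ := hc.exists_hasEigenvector
  refine ⟨c, sub_eq_zero.1 ?_⟩
  rcases eq_zero_or_isEquivRep hρ hρ (T - c • LinearMap.id) (fun g w => by
    simp [hT, Matrix.mulVec_sub, Matrix.mulVec_smul]) with h | h
  · exact h
  · refine absurd (h.1 (a₁ := v) (a₂ := 0) ?_) hv0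
    simp [Module.End.mem_eigenspace_iff.1 hv]

variable [TopologicalSpace G] {Irr : Type*} (R : IrrepSystem G Irr)

/-- The matrix coefficient `h ↦ (σ_h)_{lk}` as a continuous function. -/
def IrrepSystem.entry (σ : Irr) (l k : Fin (R.dim σ)) : C(G, ℂ) where
  toFun h := (R.rep σ h : Matrix (Fin (R.dim σ)) (Fin (R.dim σ)) ℂ) l k
  continuous_toFun := (R.continuous_rep σ).matrix_elem l k

theorem IrrepSystem.entry_apply (σ : Irr) (l k : Fin (R.dim σ)) (h : G) :
    R.entry σ l k h = (R.rep σ h : Matrix (Fin (R.dim σ)) (Fin (R.dim σ)) ℂ) l k := rfl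

theorem IrrepSystem.entry_mul (σ : Irr) (l k : Fin (R.dim σ)) (g h : G) :
    R.entry σ l k (g * h) = ∑ m, R.entry σ l m g * R.entry σ m k h :=
  unitary_entry_mul _ _ _ _ _

theorem IrrepSystem.entry_inv (σ : Irr) (l k : Fin (R.dim σ)) (g : G) :
    R.entry σ l k g⁻¹ = star (R.entry σ k l g) :=
  unitary_entry_inv _ _ _ _

variable [IsTopologicalGroup G] [CompactSpace G]
  [MeasurableSpace G] [BorelSpace G] (ν : Measure G) [ν.IsHaarMeasure]
  [IsProbabilityMeasure ν]

/-- The averaged rank-one operator `∫ τ_h† |l'⟩⟨l| σ_h dh` intertwines `σ` and `τ`. -/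
theorem IrrepSystem.average_intertwines (σ τ : Irr) (l : Fin (R.dim σ)) (l' : Fin (R.dim τ))
    (g : G) (k' : Fin (R.dim τ)) (k : Fin (R.dim σ)) :
    ∑ m, (∫ h, star (R.entry τ l' k' h) * R.entry σ l m h ∂ν) * R.entry σ m k g =
      ∑ m, R.entry τ k' m g * ∫ h, star (R.entry τ l' m h) * R.entry σ l k h ∂ν := by
  have := isMulRightInvariant_of_compact ν
  have hint : ∀ (a b) (c d), Integrable (fun h => star (R.entry τ a b h) * R.entry σ c d h) ν :=
    fun a b c d => integrable_of_continuous ν (by fun_prop)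
  calc ∑ m, (∫ h, star (R.entry τ l' k' h) * R.entry σ l m h ∂ν) * R.entry σ m k g
      = ∫ h, star (R.entry τ l' k' h) * R.entry σ l k (h * g) ∂ν := by
        simp only [← integral_mul_const]
        rw [← integral_finsetSum _ fun m _ => (hint _ _ _ _).mul_const _]
        refine integral_congr_ae (Filter.Eventually.of_forall fun h => ?_)
        simp only [R.entry_mul, Finset.mul_sum, mul_assoc]
    _ = ∫ h, star (R.entry τ l' k' (h * g⁻¹)) * R.entry σ l k h ∂ν := by
        rw [← integral_mul_right_eq_self _ g⁻¹]
        simp only [inv_mul_cancel_right]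
    _ = _ := by
        simp only [← integral_const_mul]
        rw [← integral_finsetSum _ fun m _ => (hint _ _ _ _).const_mul _]
        refine integral_congr_ae (Filter.Eventually.of_forall fun h => ?_)
        simp only [R.entry_mul, R.entry_inv, star_sum, star_mul', star_star, Finset.sum_mul]
        exact Finset.sum_congr rfl fun m _ => by ring

open Classical in
/-- **Schur orthogonality** for one representation. -/
theorem IrrepSystem.integral_entry_mul_entry (σ : Irr) (l k l' k' : Fin (R.dim σ)) :
    ∫ h, star (R.entry σ l' k' h) * R.entry σ l k h ∂ν =
      if l = l' ∧ k = k' then (R.dim σ : ℂ)⁻¹ else 0 := by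
  let T : Matrix (Fin (R.dim σ)) (Fin (R.dim σ)) ℂ :=
    Matrix.of fun k' k => ∫ h, star (R.entry σ l' k' h) * R.entry σ l k h ∂ν
  have hT : ∀ g, T * (R.rep σ g : Matrix (Fin (R.dim σ)) (Fin (R.dim σ)) ℂ) =
      (R.rep σ g : Matrix (Fin (R.dim σ)) (Fin (R.dim σ)) ℂ) * T := by
    intro g
    ext a b
    rw [Matrix.mul_apply, Matrix.mul_apply]
    exact R.average_intertwines ν σ σ l l' g a b
  obtain ⟨c, hc⟩ := exists_eq_smul_of_intertwines (R.irred σ) T.mulVecLin (fun g v => by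
    simp only [Matrix.mulVecLin_apply, Matrix.mulVec_mulVec, hT])
  have hTc : ∀ a b, T a b = if a = b then c else 0 := by
    intro a b
    have := congrArg (fun f => f (Pi.single b 1) a) hc
    simp only [Matrix.mulVecLin_apply, Matrix.mulVec_single_one, Matrix.col_apply] at this
    rw [this]
    simp [Pi.single_apply]
  have htr : (R.dim σ : ℂ) * c = if l = l' then 1 else 0 := by
    calc (R.dim σ : ℂ) * c = ∑ a, T a a := by simp [hTc]
      _ = ∫ h, ∑ a, star (R.entry σ l' a h) * R.entry σ l a h ∂ν := by
        rw [integral_finsetSum _ fun m _ => integrable_of_continuous ν (by fun_prop)]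
        rfl
      _ = ∫ _, (if l = l' then 1 else 0 : ℂ) ∂ν := by
        refine integral_congr_ae (Filter.Eventually.of_forall fun h => ?_)
        have := congrFun (congrFun (Matrix.mem_unitaryGroup_iff.1 (R.rep σ h).2) l) l'
        rw [Matrix.mul_apply, Matrix.one_apply] at this
        simp only
        rw [← this]
        exact Finset.sum_congr rfl fun a _ => by
          rw [Matrix.star_apply, mul_comm]; rfl
      _ = _ := by simp
  have hd : (R.dim σ : ℂ) ≠ 0 := by exact_mod_cast (R.irred σ).1.ne'
  have hc' : c = if l = l' then (R.dim σ : ℂ)⁻¹ else 0 := by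
    rw [← mul_right_inj' hd, htr]
    split_ifs <;> simp [hd]
  change T k' k = _
  rw [hTc, hc']
  by_cases h1 : l = l' <;> by_cases h2 : k = k' <;> simp [h1, h2, eq_comm]

/-- **Schur orthogonality** for inequivalent representations. -/
theorem IrrepSystem.integral_entry_mul_entry_of_ne {σ τ : Irr} (hστ : σ ≠ τ)
    (l k : Fin (R.dim σ)) (l' k' : Fin (R.dim τ)) :
    ∫ h, star (R.entry τ l' k' h) * R.entry σ l k h ∂ν = 0 := by
  let T : Matrix (Fin (R.dim τ)) (Fin (R.dim σ)) ℂ :=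
    Matrix.of fun k' k => ∫ h, star (R.entry τ l' k' h) * R.entry σ l k h ∂ν
  have hT : ∀ g, T * (R.rep σ g : Matrix (Fin (R.dim σ)) (Fin (R.dim σ)) ℂ) =
      (R.rep τ g : Matrix (Fin (R.dim τ)) (Fin (R.dim τ)) ℂ) * T := by
    intro g
    ext a b
    rw [Matrix.mul_apply, Matrix.mul_apply]
    exact R.average_intertwines ν σ τ l l' g a b
  have hT' : ∀ g v, T.mulVecLin ((R.rep σ g : Matrix _ _ ℂ) *ᵥ v) =
      (R.rep τ g : Matrix _ _ ℂ) *ᵥ T.mulVecLin v := fun g v => by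
    simp only [Matrix.mulVecLin_apply, Matrix.mulVec_mulVec, hT]
  rcases eq_zero_or_isEquivRep (R.irred σ) (R.irred τ) T.mulVecLin hT' with h | h
  · have := congrArg (fun f => f (Pi.single k 1) k') h
    exact (by simpa using this : T k' k = 0)
  · exact absurd (R.inequiv σ τ ⟨LinearEquiv.ofBijective T.mulVecLin h, hT'⟩) hστ

end Schur

/-! ### Translation-invariant spaces of continuous functions -/

section PeterWeyl

variable {G : Type*} [Group G] [TopologicalSpace G] [IsTopologicalGroup G] [CompactSpace G]

/-- The right translate `x ↦ u(xg)` of a continuous function, as a continuous function of `g`. -/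
def rightTranslate (u : C(G, ℂ)) : C(G, C(G, ℂ)) :=
  ContinuousMap.curry ⟨fun q : G × G => u (q.2 * q.1), by fun_prop⟩

@[simp]
theorem rightTranslate_apply (u : C(G, ℂ)) (g x : G) : rightTranslate u g x = u (x * g) := rfl

theorem rightTranslate_one (u : C(G, ℂ)) : rightTranslate u 1 = u := by ext x; simp

theorem rightTranslate_mul (u : C(G, ℂ)) (g h : G) :
    rightTranslate u (g * h) = rightTranslate (rightTranslate u h) g := by
  ext x; simp [mul_assoc]

theorem rightTranslate_sum {ι : Type*} (s : Finset ι) (c : ι → ℂ) (u : ι → C(G, ℂ)) (g : G) :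
    rightTranslate (∑ i ∈ s, c i • u i) g = ∑ i ∈ s, c i • rightTranslate (u i) g := by
  ext x; simp [ContinuousMap.sum_apply]

variable [MeasurableSpace G] [BorelSpace G] (ν : Measure G) [ν.IsHaarMeasure]
  [IsProbabilityMeasure ν]

/-- The class in `L²(G)` of a continuous function. -/
def toL2 : C(G, ℂ) →L[ℂ] Lp ℂ 2 ν := ContinuousMap.toLp 2 ν ℂ

theorem inner_toL2 (u v : C(G, ℂ)) : ⟪toL2 ν u, toL2 ν v⟫_ℂ = ∫ x, star (u x) * v x ∂ν := by
  refine (ContinuousMap.inner_toLp ν u v).trans ?_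
  refine integral_congr_ae (Filter.Eventually.of_forall fun x => ?_)
  exact mul_comm _ _

theorem toL2_injective : Function.Injective (toL2 ν) := ContinuousMap.toLp_injective ν

theorem inner_toL2_rightTranslate (u v : C(G, ℂ)) (g : G) :
    ⟪toL2 ν (rightTranslate u g), toL2 ν (rightTranslate v g)⟫_ℂ = ⟪toL2 ν u, toL2 ν v⟫_ℂ := by
  have := isMulRightInvariant_of_compact ν
  rw [inner_toL2, inner_toL2]
  exact integral_mul_right_eq_self (fun x => star (u x) * v x) g

variable {Irr : Type*} (R : IrrepSystem G Irr)

/-- A finite-dimensional space of continuous functions has a basis that is orthonormal in `L²`. -/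
theorem exists_orthonormal_continuous (ν : Measure G) [ν.IsHaarMeasure] [IsProbabilityMeasure ν]
    (E : Submodule ℂ C(G, ℂ)) [FiniteDimensional ℂ E] :
    ∃ (d : ℕ) (e : Fin d → C(G, ℂ)), (∀ i, e i ∈ E) ∧
      (∀ i j, ⟪toL2 ν (e i), toL2 ν (e j)⟫_ℂ = if i = j then 1 else 0) ∧
      ∀ u ∈ E, u = ∑ i, ⟪toL2 ν (e i), toL2 ν u⟫_ℂ • e i := by
  let E₁ : Submodule ℂ (Lp ℂ 2 ν) := E.map (toL2 ν).toLinearMap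
  have : FiniteDimensional ℂ E₁ := inferInstanceAs (FiniteDimensional ℂ (E.map _))
  let b := stdOrthonormalBasis ℂ E₁
  have hb : ∀ i, ∃ u ∈ E, toL2 ν u = b i := fun i => (b i).2
  choose e heE heb using hb
  refine ⟨_, e, heE, fun i j => ?_, fun u hu => toL2_injective ν ?_⟩
  · rw [heb, heb]
    exact orthonormal_iff_ite.1 b.orthonormal i j
  · have h := b.sum_repr' ⟨toL2 ν u, u, hu, rfl⟩
    have h' := congrArg Subtype.val h
    rw [map_sum]
    simp only [map_smul, heb]
    simpa using h'.symm

/-- The matrices of the right translations with respect to an orthonormal basis of an invariant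
space of continuous functions form a continuous unitary representation. -/
theorem exists_unitary_of_rightTranslate (ν : Measure G) [ν.IsHaarMeasure]
    [IsProbabilityMeasure ν] {d : ℕ} (e : Fin d → C(G, ℂ))
    (horth : ∀ i j, ⟪toL2 ν (e i), toL2 ν (e j)⟫_ℂ = if i = j then 1 else 0)
    (hinv : ∀ g j, rightTranslate (e j) g =
      ∑ i, ⟪toL2 ν (e i), toL2 ν (rightTranslate (e j) g)⟫_ℂ • e i) :
    ∃ τ : G →* Matrix.unitaryGroup (Fin d) ℂ,
      (Continuous fun g => (τ g : Matrix (Fin d) (Fin d) ℂ)) ∧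
      ∀ g j, rightTranslate (e j) g = ∑ i, (τ g : Matrix (Fin d) (Fin d) ℂ) i j • e i := by
  let t : G → Matrix (Fin d) (Fin d) ℂ := fun g =>
    Matrix.of fun i j => ⟪toL2 ν (e i), toL2 ν (rightTranslate (e j) g)⟫_ℂ
  have hcoord : ∀ (i : Fin d) (c : Fin d → ℂ), ⟪toL2 ν (e i), toL2 ν (∑ j, c j • e j)⟫_ℂ = c i := by
    intro i c
    rw [map_sum, inner_sum, Finset.sum_eq_single i]
    · rw [map_smul, inner_smul_right, horth, if_pos rfl, mul_one]
    · intro j _ hj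
      rw [map_smul, inner_smul_right, horth, if_neg hj.symm, mul_zero]
    · exact fun h => absurd (Finset.mem_univ i) h
  have ht : ∀ g j, rightTranslate (e j) g = ∑ i, t g i j • e i := hinv
  have htmul : ∀ g h, t (g * h) = t g * t h := by
    intro g h
    ext i j
    change ⟪toL2 ν (e i), toL2 ν (rightTranslate (e j) (g * h))⟫_ℂ = _
    have : rightTranslate (e j) (g * h) = ∑ k, (t g * t h) k j • e k := by
      rw [rightTranslate_mul, ht h j, rightTranslate_sum]
      simp only [ht g, Finset.smul_sum, Matrix.mul_apply, Finset.sum_smul, smul_smul]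
      rw [Finset.sum_comm]
      refine Finset.sum_congr rfl fun k _ => Finset.sum_congr rfl fun m _ => ?_
      rw [mul_comm]
    rw [this, hcoord i fun k => (t g * t h) k j]
  have htu : ∀ g, t g ∈ Matrix.unitaryGroup (Fin d) ℂ := by
    intro g
    rw [Matrix.mem_unitaryGroup_iff']
    ext i j
    have h := inner_toL2_rightTranslate ν (e i) (e j) g
    rw [horth, ht g i, map_sum, sum_inner] at h
    rw [Matrix.mul_apply, Matrix.one_apply, ← h]
    refine Finset.sum_congr rfl fun m _ => ?_
    rw [map_smul, inner_smul_left]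
    rfl
  refine ⟨⟨⟨fun g => ⟨t g, htu g⟩, Subtype.ext ?_⟩, fun g h => Subtype.ext (htmul g h)⟩, ?_, ht⟩
  · ext i j
    change ⟪toL2 ν (e i), toL2 ν (rightTranslate (e j) 1)⟫_ℂ = _
    rw [rightTranslate_one, horth]
    rfl
  · refine continuous_matrix fun i j => ?_
    exact continuous_const.inner ((toL2 ν).continuous.comp (rightTranslate (e j)).continuous)

/-- A nonzero finite-dimensional right-invariant space `E` of continuous functions that contains no
smaller one contains a nonzero combination of matrix coefficients: right translation on `E` is an
irreducible unitary representation `τ`, and `u(g) = (r_g u)(1)` expresses the elements of `E`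
through the matrix coefficients of `τ`. -/
theorem exists_mem_span_entry (ν : Measure G) [ν.IsHaarMeasure] [IsProbabilityMeasure ν]
    {Irr : Type*} (R : IrrepSystem G Irr) (E : Submodule ℂ C(G, ℂ)) [FiniteDimensional ℂ E]
    (hE : E ≠ ⊥) (hinv : ∀ g, ∀ u ∈ E, rightTranslate u g ∈ E)
    (hmin : ∀ F ≤ E, (∀ g, ∀ u ∈ F, rightTranslate u g ∈ F) → F = ⊥ ∨ F = E) :
    ∃ u ∈ E, u ≠ 0 ∧ u ∈ Submodule.span ℂ
      (Set.range fun i : Σ σ, Fin (R.dim σ) × Fin (R.dim σ) => R.entry i.1 i.2.1 i.2.2) := by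
  obtain ⟨d, e, heE, horth, hexp⟩ := exists_orthonormal_continuous ν E
  obtain ⟨τ, hτc, ht⟩ := exists_unitary_of_rightTranslate ν e horth
    fun g j => hexp _ (hinv g _ (heE j))
  let Ψ : (Fin d → ℂ) →ₗ[ℂ] C(G, ℂ) := Fintype.linearCombination ℂ e
  have hΨ : ∀ w, Ψ w = ∑ j, w j • e j := fun w => Fintype.linearCombination_apply ℂ e w
  have hΨinj : Function.Injective Ψ := by
    refine linearIndependent_iff_injective_fintypeLinearCombination.1 ?_
    have ho : Orthonormal ℂ fun i => toL2 ν (e i) := orthonormal_iff_ite.2 horth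
    exact LinearIndependent.of_comp (toL2 ν).toLinearMap ho.linearIndependent
  have hΨmem : ∀ w, Ψ w ∈ E := fun w => by
    rw [hΨ]; exact Submodule.sum_mem _ fun j _ => Submodule.smul_mem _ _ (heE j)
  have hΨt : ∀ g w, Ψ ((τ g : Matrix (Fin d) (Fin d) ℂ) *ᵥ w) = rightTranslate (Ψ w) g := by
    intro g w
    rw [hΨ, hΨ, rightTranslate_sum]
    simp only [ht, Finset.smul_sum, Matrix.mulVec, dotProduct, Finset.sum_smul]
    rw [Finset.sum_comm]
    refine Finset.sum_congr rfl fun j _ => Finset.sum_congr rfl fun i _ => ?_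
    rw [smul_smul, mul_comm]
  have hd0 : 0 < d := by
    obtain ⟨u, hu, hu0⟩ := Submodule.exists_mem_ne_zero_of_ne_bot hE
    by_contra h
    obtain rfl : d = 0 := by omega
    exact hu0 (by rw [hexp u hu, Finset.univ_eq_empty, Finset.sum_empty])
  have hτi : IsIrred τ := by
    refine ⟨hd0, fun W hW => ?_⟩
    rcases hmin (W.map Ψ) (by rintro _ ⟨w, _, rfl⟩; exact hΨmem w) (by
      rintro g _ ⟨w, hw, rfl⟩
      exact ⟨_, hW g w hw, hΨt g w⟩) with h | h
    · left
      rw [eq_bot_iff]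
      intro w hw
      have h0 : Ψ w ∈ W.map Ψ := ⟨w, hw, rfl⟩
      rw [h, Submodule.mem_bot] at h0
      exact hΨinj (h0.trans (map_zero Ψ).symm)
    · right
      rw [eq_top_iff]
      intro w _
      have : Ψ w ∈ W.map Ψ := h ▸ hΨmem w
      obtain ⟨w', hw', hww'⟩ := this
      exact hΨinj hww' ▸ hw'
  obtain ⟨σ, S, hS⟩ := R.exhaust d τ hτc hτi
  let j₀ : Fin d := ⟨0, hd0⟩
  refine ⟨e j₀, heE j₀, fun h => ?_, ?_⟩
  · have := horth j₀ j₀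
    rw [h] at this
    simp at this
  -- `e_j(g) = (r_g e_j)(1) = ∑ i, τ_ij(g) e_i(1)`, and `τ` is conjugate to `σ`
  have key : e j₀ = ∑ l, ∑ k, (S.symm (Pi.single j₀ 1) k *
      ∑ i, S (Pi.single l 1) i * e i 1) • R.entry σ l k := by
    ext g
    have h1 : e j₀ g = ∑ i, (τ g : Matrix (Fin d) (Fin d) ℂ) i j₀ * e i 1 := by
      have := DFunLike.congr_fun (ht g j₀) (1 : G)
      simpa [ContinuousMap.sum_apply] using this
    have h2 : ∀ i, (τ g : Matrix (Fin d) (Fin d) ℂ) i j₀ =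
        ∑ l, ∑ k, R.entry σ l k g * S.symm (Pi.single j₀ 1) k * S (Pi.single l 1) i := by
      intro i
      have h := hS g (S.symm (Pi.single j₀ 1))
      rw [LinearEquiv.apply_symm_apply, Matrix.mulVec_single_one] at h
      have h' := congrFun h i
      rw [Matrix.col_apply] at h'
      rw [← h']
      have hsum : ∀ v : Fin (R.dim σ) → ℂ, S v i = ∑ l, v l * S (Pi.single l 1) i := by
        intro v
        conv_lhs => rw [← (Pi.basisFun ℂ (Fin (R.dim σ))).sum_repr v]
        simp
      rw [hsum]
      refine Finset.sum_congr rfl fun l _ => ?_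
      rw [Matrix.mulVec, dotProduct, Finset.sum_mul]
      rfl
    rw [h1]
    simp only [h2, ContinuousMap.sum_apply, ContinuousMap.smul_apply, smul_eq_mul,
      Finset.sum_mul, Finset.mul_sum]
    rw [Finset.sum_comm]
    refine Finset.sum_congr rfl fun l _ => ?_
    rw [Finset.sum_comm]
    refine Finset.sum_congr rfl fun k _ => Finset.sum_congr rfl fun i _ => by ring
  rw [key]
  exact Submodule.sum_mem _ fun l _ => Submodule.sum_mem _ fun k _ =>
    Submodule.smul_mem _ _ (Submodule.subset_span ⟨⟨σ, l, k⟩, rfl⟩)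

/-- A finite-dimensional right-invariant space of continuous functions that is orthogonal to all
matrix coefficients of irreducible representations is zero. -/
theorem eq_bot_of_orthogonal_entry (E : Submodule ℂ C(G, ℂ)) [FiniteDimensional ℂ E]
    (hinv : ∀ g, ∀ u ∈ E, rightTranslate u g ∈ E)
    (horth : ∀ u ∈ E, ∀ σ l k, ⟪toL2 ν (R.entry σ l k), toL2 ν u⟫_ℂ = 0) : E = ⊥ := by
  by_contra hE
  -- an invariant nonzero subspace of the least possible dimension
  let P : Set ℕ := {n | ∃ F ≤ E, F ≠ ⊥ ∧ (∀ g, ∀ u ∈ F, rightTranslate u g ∈ F) ∧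
    Module.finrank ℂ F = n}
  have hP : P.Nonempty := ⟨_, E, le_rfl, hE, hinv, rfl⟩
  obtain ⟨F, hFE, hF, hFinv, hFn⟩ := Nat.sInf_mem hP
  have hFfin : FiniteDimensional ℂ F := Submodule.finiteDimensional_of_le hFE
  obtain ⟨u, huF, hu0, hu⟩ := exists_mem_span_entry ν R F hF hFinv (by
    intro F' hF' hinv'
    by_cases h : F' = ⊥
    · exact Or.inl h
    · right
      refine Submodule.eq_of_le_of_finrank_le hF' ?_
      rw [hFn]
      exact Nat.sInf_le ⟨F', hF'.trans hFE, h, hinv', rfl⟩)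
  have hzero : ⟪toL2 ν u, toL2 ν u⟫_ℂ = 0 := by
    refine Submodule.span_induction (p := fun v _ => ⟪toL2 ν v, toL2 ν u⟫_ℂ = 0) ?_ ?_ ?_ ?_ hu
    · rintro _ ⟨i, rfl⟩; exact horth u (hFE huF) _ _ _
    · simp
    · intro x y _ _ hx hy; rw [map_add, inner_add_left, hx, hy, add_zero]
    · intro c x _ hx; rw [map_smul, inner_smul_left, hx, mul_zero]
  refine hu0 (toL2_injective ν ?_)
  rw [map_zero]
  exact inner_self_eq_zero.1 hzero

end PeterWeyl

/-! ### Completeness of the matrix coefficients -/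

section Convolution

variable {G : Type*} [Group G] [TopologicalSpace G] [IsTopologicalGroup G] [CompactSpace G]
  [SecondCountableTopology G] [MeasurableSpace G] [BorelSpace G]

/-- The kernel `y ↦ (x ↦ k(xy⁻¹))` of convolution with `k`. -/
def convKernel (k : C(G, ℂ)) : C(G, C(G, ℂ)) :=
  ContinuousMap.curry ⟨fun q : G × G => k (q.2 * q.1⁻¹), by fun_prop⟩

/-- The operator `f ↦ ∫ f(y) κ(y) dy` from `L²(G)` to continuous functions, for an
`L²`-function `κ` with values in the continuous functions. -/
def kernelOp (ν : Measure G) : Lp C(G, ℂ) 2 ν →L[ℂ] Lp ℂ 2 ν →L[ℂ] C(G, ℂ) :=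
  (ContinuousLinearMap.lsmul ℂ ℂ (E := C(G, ℂ))).flip.lpPairing ν 2 2

theorem kernelOp_apply (ν : Measure G) (κ : Lp C(G, ℂ) 2 ν) (f : Lp ℂ 2 ν) :
    kernelOp ν κ f = ∫ y, f y • κ y ∂ν :=
  ContinuousLinearMap.lpPairing_eq_integral _ _ _

theorem isCompactOperator_kernelOp (ν : Measure G) [ν.IsHaarMeasure] [IsProbabilityMeasure ν]
    (κ : Lp C(G, ℂ) 2 ν) : IsCompactOperator (kernelOp ν κ) := by
  refine Lp.induction (p := 2) ENNReal.ofNat_ne_top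
    (motive := fun κ => IsCompactOperator (kernelOp ν κ)) ?_ ?_ ?_ κ
  · intro c s hs hμs
    have h : (kernelOp ν (indicatorConstLp 2 hs hμs.ne c) : Lp ℂ 2 ν → C(G, ℂ)) =
        ContinuousLinearMap.toSpanSingleton ℂ c ∘L
          innerSL ℂ (indicatorConstLp 2 hs hμs.ne (1 : ℂ)) := by
      ext1 f
      have h1 : kernelOp ν (indicatorConstLp 2 hs hμs.ne c) f = ∫ y in s, f y • c ∂ν := by
        rw [kernelOp_apply, ← integral_indicator hs]
        refine integral_congr_ae ?_
        filter_upwards [indicatorConstLp_coeFn (p := 2) (hs := hs) (hμs := hμs.ne) (c := c)]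
          with y hy
        rw [hy]
        by_cases hys : y ∈ s <;> simp [hys]
      rw [h1, integral_smul_const, ContinuousLinearMap.comp_apply, innerSL_apply_apply,
        L2.inner_indicatorConstLp_one, ContinuousLinearMap.toSpanSingleton_apply]
    change IsCompactOperator (kernelOp ν (indicatorConstLp 2 hs hμs.ne c))
    rw [h]
    exact (isCompactOperator_of_locallyCompactSpace_rng
      (ContinuousLinearMap.toSpanSingleton ℂ c)).comp_clm _
  · intro f g hf hg _ h1 h2
    rw [map_add]
    exact h1.add h2
  · exact isClosed_setOfPred_isCompactOperator.preimage (kernelOp ν).continuous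

/-- Convolution `f ↦ (x ↦ ∫ k(xy⁻¹) f(y) dy)` with a continuous function, from `L²(G)` to the
continuous functions. -/
def convOp (ν : Measure G) [ν.IsHaarMeasure] [IsProbabilityMeasure ν] (k : C(G, ℂ)) :
    Lp ℂ 2 ν →L[ℂ] C(G, ℂ) :=
  kernelOp ν (ContinuousMap.toLp 2 ν ℂ (convKernel k))

theorem convOp_eq_integral (ν : Measure G) [ν.IsHaarMeasure] [IsProbabilityMeasure ν]
    (k : C(G, ℂ)) (f : Lp ℂ 2 ν) : 
    Integrable (fun y => f y • convKernel k y) ν ∧ convOp ν k f = ∫ y, f y • convKernel k y ∂ν := by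
  constructor
  · have hf : Integrable f ν := (Lp.memLp f).integrable (by norm_num)
    refine hf.smul_of_top_left ?_
    exact (MemLp.of_bound (convKernel k).continuous.aestronglyMeasurable ‖convKernel k‖
      (Filter.Eventually.of_forall fun y => ContinuousMap.norm_coe_le_norm (convKernel k) y))
  · rw [convOp, kernelOp_apply]
    refine integral_congr_ae ?_
    filter_upwards [ContinuousMap.coeFn_toLp (p := 2) (𝕜 := ℂ) ν (convKernel k)] with y hy
    rw [hy]

theorem convOp_apply (ν : Measure G) [ν.IsHaarMeasure] [IsProbabilityMeasure ν] (k : C(G, ℂ))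
    (f : Lp ℂ 2 ν) (x : G) : convOp ν k f x = ∫ y, k (x * y⁻¹) * f y ∂ν := by
  obtain ⟨hi, h⟩ := convOp_eq_integral ν k f
  rw [h]
  refine ((ContinuousMap.evalCLM ℂ x).integral_comp_comm hi).symm.trans ?_
  refine integral_congr_ae (Filter.Eventually.of_forall fun y => ?_)
  exact mul_comm _ _

theorem convOp_toL2 (ν : Measure G) [ν.IsHaarMeasure] [IsProbabilityMeasure ν] (k v : C(G, ℂ))
    (x : G) : convOp ν k (toL2 ν v) x = ∫ y, k (x * y⁻¹) * v y ∂ν := by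
  rw [convOp_apply]
  refine integral_congr_ae ?_
  filter_upwards [ContinuousMap.coeFn_toLp (p := 2) (𝕜 := ℂ) ν v] with y hy
  rw [toL2, hy]

/-- Convolution with a function `k` such that `k(x⁻¹) = conj k(x)` is symmetric. -/
theorem inner_toL2_convOp (ν : Measure G) [ν.IsHaarMeasure] [IsProbabilityMeasure ν] {k : C(G, ℂ)}
    (hk : ∀ x, k x⁻¹ = star (k x)) (f g : Lp ℂ 2 ν) :
    ⟪toL2 ν (convOp ν k g), f⟫_ℂ = ⟪g, toL2 ν (convOp ν k f)⟫_ℂ := by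
  obtain ⟨hi, h⟩ := convOp_eq_integral ν k f
  have h1 : ⟪g, toL2 ν (convOp ν k f)⟫_ℂ =
      ∫ y, ((innerSL ℂ g) ∘L toL2 ν) (f y • convKernel k y) ∂ν := by
    rw [h]
    exact (((innerSL ℂ g) ∘L toL2 ν).integral_comp_comm hi).symm
  rw [h1, L2.inner_def]
  refine integral_congr_ae ?_
  filter_upwards [ContinuousMap.coeFn_toLp (p := 2) (𝕜 := ℂ) ν (convOp ν k g)] with y hy
  rw [map_smul, toL2, hy, convOp_apply, RCLike.inner_apply, smul_eq_mul]
  congr 1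
  rw [← integral_conj]
  change _ = ⟪g, toL2 ν (convKernel k y)⟫_ℂ
  rw [L2.inner_def]
  refine integral_congr_ae ?_
  filter_upwards [ContinuousMap.coeFn_toLp (p := 2) (𝕜 := ℂ) ν (convKernel k y)] with x hx
  rw [toL2, hx, RCLike.inner_apply, map_mul]
  congr 1
  change star (k (y * x⁻¹)) = k (x * y⁻¹)
  rw [← hk, mul_inv_rev, inv_inv]

/-- Convolution maps matrix coefficients to combinations of matrix coefficients. -/
theorem convOp_entry (ν : Measure G) [ν.IsHaarMeasure] [IsProbabilityMeasure ν] {Irr : Type*}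
    (R : IrrepSystem G Irr) (k : C(G, ℂ)) (σ : Irr) (l j : Fin (R.dim σ)) :
    convOp ν k (toL2 ν (R.entry σ l j)) =
      ∑ m, (∫ y, k y⁻¹ * R.entry σ l m y ∂ν) • R.entry σ m j := by
  have := isMulRightInvariant_of_compact ν
  ext x
  rw [convOp_toL2, ← integral_mul_right_eq_self _ x]
  simp only [mul_inv_rev, mul_inv_cancel_left, ContinuousMap.sum_apply, ContinuousMap.smul_apply,
    IrrepSystem.entry_mul, Finset.mul_sum, smul_eq_mul]
  rw [integral_finsetSum _ fun m _ => integrable_of_continuous ν (by fun_prop)]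
  refine Finset.sum_congr rfl fun m _ => ?_
  rw [← integral_mul_const]
  simp only [mul_assoc]

theorem rightTranslate_convOp (ν : Measure G) [ν.IsHaarMeasure] [IsProbabilityMeasure ν]
    (k u : C(G, ℂ)) (g : G) : rightTranslate (convOp ν k (toL2 ν u)) g =
      convOp ν k (toL2 ν (rightTranslate u g)) := by
  have := isMulRightInvariant_of_compact ν
  ext x
  rw [rightTranslate_apply, convOp_toL2, convOp_toL2, ← integral_mul_right_eq_self _ g]
  simp

/-- A compact symmetric operator vanishes on a closed invariant subspace that contains no
eigenvectors for nonzero eigenvalues. -/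
theorem apply_eq_zero_of_no_eigenvector {H : Type*} [NormedAddCommGroup H]
    [InnerProductSpace ℂ H] {T : H →L[ℂ] H} (hTc : IsCompactOperator T)
    (hTs : T.toLinearMap.IsSymmetric) (Q : Submodule ℂ H) [CompleteSpace Q]
    (hTQ : ∀ v ∈ Q, T v ∈ Q) (hQ : ∀ v ∈ Q, ∀ c : ℂ, c ≠ 0 → T v = c • v → v = 0)
    {f : H} (hf : f ∈ Q) : T f = 0 := by
  have hT0 : T.restrict hTQ = 0 := by
    refine (ContinuousLinearMap.eq_zero_of_forall_hasEigenvalue_eq_zero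
      (hTc.restrict' (f := T.toLinearMap) hTQ) (hTs.restrict_invariant hTQ)).1 fun c hc => ?_
    by_contra hc0
    obtain ⟨q, hq⟩ := hc.exists_hasEigenvector
    exact hq.2 (Subtype.ext (hQ q q.2 c hc0 (congrArg Subtype.val hq.apply_eq_smul)))
  exact congrArg Subtype.val (DFunLike.congr_fun hT0 ⟨f, hf⟩)

/-- The orthogonal complement of the matrix coefficients. -/
def entryCompl (ν : Measure G) [ν.IsHaarMeasure] [IsProbabilityMeasure ν] {Irr : Type*}
    (R : IrrepSystem G Irr) : Submodule ℂ (Lp ℂ 2 ν) :=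
  (Submodule.span ℂ (Set.range
    fun i : Σ σ, Fin (R.dim σ) × Fin (R.dim σ) => toL2 ν (R.entry i.1 i.2.1 i.2.2)))ᗮ

theorem mem_entryCompl (ν : Measure G) [ν.IsHaarMeasure] [IsProbabilityMeasure ν] {Irr : Type*}
    {R : IrrepSystem G Irr} {v : Lp ℂ 2 ν} :
    v ∈ entryCompl ν R ↔ ∀ σ l j, ⟪toL2 ν (R.entry σ l j), v⟫_ℂ = 0 := by
  refine ⟨fun h σ l j => h _ (Submodule.subset_span ⟨⟨σ, l, j⟩, rfl⟩), fun h w hw => ?_⟩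
  refine Submodule.span_induction (p := fun w _ => ⟪w, v⟫_ℂ = 0) ?_ ?_ ?_ ?_ hw
  · rintro _ ⟨i, rfl⟩; exact h _ _ _
  · exact inner_zero_left _
  · intro x y _ _ hx hy; rw [inner_add_left, hx, hy, add_zero]
  · intro c x _ hx; rw [inner_smul_left, hx, mul_zero]

theorem rightTranslate_mem_entryCompl (ν : Measure G) [ν.IsHaarMeasure] [IsProbabilityMeasure ν]
    {Irr : Type*} {R : IrrepSystem G Irr} {u : C(G, ℂ)} (hu : toL2 ν u ∈ entryCompl ν R) (g : G) :
    toL2 ν (rightTranslate u g) ∈ entryCompl ν R := by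
  rw [mem_entryCompl] at hu ⊢
  intro σ l j
  have h1 : R.entry σ l j = rightTranslate (rightTranslate (R.entry σ l j) g⁻¹) g := by
    rw [← rightTranslate_mul, mul_inv_cancel, rightTranslate_one]
  have h2 : rightTranslate (R.entry σ l j) g⁻¹ =
      ∑ m, R.entry σ m j g⁻¹ • R.entry σ l m := by
    ext x
    rw [rightTranslate_apply, IrrepSystem.entry_mul]
    simp [ContinuousMap.sum_apply, mul_comm]
  rw [h1, inner_toL2_rightTranslate, h2, map_sum, sum_inner]
  refine Finset.sum_eq_zero fun m _ => ?_
  rw [map_smul, inner_smul_left, hu, mul_zero]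

/-- Convolution has no eigenvector for a nonzero eigenvalue in the orthogonal complement of the
matrix coefficients: the eigenspace would be a finite-dimensional right-invariant space of
continuous functions orthogonal to all matrix coefficients. -/
theorem eq_zero_of_convOp_eq_smul (ν : Measure G) [ν.IsHaarMeasure] [IsProbabilityMeasure ν]
    {Irr : Type*} (R : IrrepSystem G Irr) (k : C(G, ℂ)) (q : Lp ℂ 2 ν) (hq : q ∈ entryCompl ν R)
    (c : ℂ) (hc : c ≠ 0) (hqc : toL2 ν (convOp ν k q) = c • q) : q = 0 := by
  let T : Lp ℂ 2 ν →L[ℂ] Lp ℂ 2 ν := toL2 ν ∘L convOp ν k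
  have hTc : IsCompactOperator T :=
    IsCompactOperator.clm_comp (isCompactOperator_kernelOp ν _) (toL2 ν)
  let E : Submodule ℂ C(G, ℂ) := (entryCompl ν R).comap (toL2 ν).toLinearMap ⊓
    LinearMap.ker ((convOp ν k ∘L toL2 ν).toLinearMap - c • LinearMap.id)
  have hE : ∀ u, u ∈ E ↔ toL2 ν u ∈ entryCompl ν R ∧ convOp ν k (toL2 ν u) = c • u := by
    intro u
    rw [Submodule.mem_inf, LinearMap.mem_ker, LinearMap.sub_apply, sub_eq_zero]
    rfl
  have := ContinuousLinearMap.finite_dimensional_eigenspace (T := T) hTc c hc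
  have hEfin : FiniteDimensional ℂ E := by
    refine FiniteDimensional.of_injective
      (((toL2 ν).toLinearMap.domRestrict E).codRestrict
        (Module.End.eigenspace T.toLinearMap c) fun u => ?_) ?_
    · rw [Module.End.mem_eigenspace_iff]
      change toL2 ν (convOp ν k (toL2 ν (u : C(G, ℂ)))) = c • toL2 ν (u : C(G, ℂ))
      rw [((hE _).1 u.2).2, map_smul]
    · intro u v huv
      exact Subtype.ext (toL2_injective ν (congrArg Subtype.val huv))
  have hE0 : E = ⊥ := by
    refine eq_bot_of_orthogonal_entry ν R E (fun g u hu => ?_) fun u hu =>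
      (mem_entryCompl ν).1 ((hE u).1 hu).1
    obtain ⟨h1, h2⟩ := (hE u).1 hu
    refine (hE _).2 ⟨rightTranslate_mem_entryCompl ν h1 g, ?_⟩
    rw [← rightTranslate_convOp, h2]
    rfl
  have hqE : convOp ν k q ∈ E := by
    refine (hE _).2 ⟨hqc ▸ Submodule.smul_mem _ _ hq, ?_⟩
    rw [hqc, map_smul]
  rw [hE0, Submodule.mem_bot] at hqE
  rw [hqE, map_zero] at hqc
  exact (smul_eq_zero.1 hqc.symm).resolve_left hc

/-- Convolution with a symmetric function annihilates the orthogonal complement of the matrix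
coefficients. -/
theorem convOp_eq_zero (ν : Measure G) [ν.IsHaarMeasure] [IsProbabilityMeasure ν] {Irr : Type*}
    (R : IrrepSystem G Irr) {k : C(G, ℂ)} (hk : ∀ x, k x⁻¹ = star (k x)) (f : Lp ℂ 2 ν)
    (hf : f ∈ entryCompl ν R) : convOp ν k f = 0 := by
  have hTc : IsCompactOperator (toL2 ν ∘L convOp ν k) :=
    IsCompactOperator.clm_comp (isCompactOperator_kernelOp ν _) (toL2 ν)
  have hTs : (toL2 ν ∘L convOp ν k).toLinearMap.IsSymmetric := fun v w =>
    inner_toL2_convOp ν hk w v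
  have : CompleteSpace (entryCompl ν R) :=
    (Submodule.isClosed_orthogonal _).completeSpace_coe
  refine toL2_injective ν ?_
  rw [map_zero]
  refine apply_eq_zero_of_no_eigenvector hTc hTs (entryCompl ν R) (fun v hv => ?_)
    (fun v hv c hc h => eq_zero_of_convOp_eq_smul ν R k v hv c hc h) hf
  rw [mem_entryCompl] at hv ⊢
  intro σ l j
  refine (inner_toL2_convOp ν hk v _).symm.trans ?_
  rw [convOp_entry, map_sum, sum_inner]
  refine Finset.sum_eq_zero fun m _ => ?_
  rw [map_smul, inner_smul_left, hv, mul_zero]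

/-- **Peter–Weyl theorem**: the matrix coefficients span a dense subspace of `L²(G)`. -/
theorem topologicalClosure_span_entry (ν : Measure G) [ν.IsHaarMeasure] [IsProbabilityMeasure ν]
    {Irr : Type*} (R : IrrepSystem G Irr) :
    (Submodule.span ℂ (Set.range fun i : Σ σ, Fin (R.dim σ) × Fin (R.dim σ) =>
      toL2 ν (R.entry i.1 i.2.1 i.2.2))).topologicalClosure = ⊤ := by
  rw [Submodule.topologicalClosure_eq_top_iff, eq_bot_iff]
  intro f hf
  have hsymm : ∀ k : C(G, ℂ), (∀ x, k x⁻¹ = star (k x)) → ⟪toL2 ν k, f⟫_ℂ = 0 := by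
    intro k hk
    have h := DFunLike.congr_fun (convOp_eq_zero ν R hk f hf) (1 : G)
    rw [convOp_apply] at h
    rw [L2.inner_def]
    refine Eq.trans ?_ h
    refine integral_congr_ae ?_
    filter_upwards [ContinuousMap.coeFn_toLp (p := 2) (𝕜 := ℂ) ν k] with y hy
    rw [toL2, hy, RCLike.inner_apply, one_mul, hk, mul_comm]
    rfl
  have hall : ∀ v : C(G, ℂ), ⟪toL2 ν v, f⟫_ℂ = 0 := by
    intro v
    let v' : C(G, ℂ) := ⟨fun x => star (v x⁻¹), by fun_prop⟩
    have hv' : ∀ x, v' x = star (v x⁻¹) := fun x => rfl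
    have h1 := hsymm (v + v') fun x => by simp [hv', add_comm]
    have h2 := hsymm (Complex.I • (v - v')) fun x => by simp [hv']; ring
    rw [map_add, inner_add_left] at h1
    rw [map_smul, inner_smul_left, map_sub, inner_sub_left, mul_eq_zero] at h2
    have h3 := h2.resolve_left (by simp)
    linear_combination (h1 + h3) / 2
  have hd : DenseRange (toL2 ν) := ContinuousMap.toLp_denseRange ℂ ν ℂ (by norm_num)
  have hzero : (fun w : Lp ℂ 2 ν => ⟪w, f⟫_ℂ) = fun _ => 0 :=
    hd.equalizer (by fun_prop) continuous_const (funext hall)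
  exact inner_self_eq_zero.1 (congrFun hzero f)

end Convolution

/-! ### Vector-valued `L²`-functions and their Fourier decomposition -/

section VectorValued

theorem memLp_top_of_continuous {G E : Type*} [TopologicalSpace G] [CompactSpace G]
    [SecondCountableTopology G] [MeasurableSpace G] [BorelSpace G] (ν : Measure G)
    [NormedAddCommGroup E] {φ : G → E} (hφ : Continuous φ) : MemLp φ ⊤ ν :=
  memLp_top_of_bound hφ.aestronglyMeasurable ‖(⟨φ, hφ⟩ : C(G, E))‖
    (Filter.Eventually.of_forall fun y => ContinuousMap.norm_coe_le_norm ⟨φ, hφ⟩ y)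

variable {G : Type*} [Group G] [TopologicalSpace G] [IsTopologicalGroup G] [CompactSpace G]
  [SecondCountableTopology G] [MeasurableSpace G] [BorelSpace G] (ν : Measure G)
  [ν.IsHaarMeasure] [IsProbabilityMeasure ν]

/-- The elementary tensor `φ ⊗ e ∈ L²(G, E)`, `h ↦ φ(h) e`. -/
def tensorL2 {E : Type*} [NormedAddCommGroup E] [NormedSpace ℂ E] (e : E) :
    Lp ℂ 2 ν →L[ℂ] Lp E 2 ν :=
  (ContinuousLinearMap.toSpanSingleton ℂ e).compLpL 2 ν

theorem coeFn_tensorL2 {E : Type*} [NormedAddCommGroup E] [NormedSpace ℂ E] (e : E)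
    (φ : Lp ℂ 2 ν) : tensorL2 ν e φ =ᵐ[ν] fun h => φ h • e :=
  ContinuousLinearMap.coeFn_compLpL _ _

/-- A closed subspace of `L²(G, E)` that contains all elementary tensors of matrix coefficients is
everything. -/
theorem eq_top_of_tensorL2_entry_mem {E : Type*} [NormedAddCommGroup E] [NormedSpace ℂ E]
    [CompleteSpace E] {Irr : Type*} (R : IrrepSystem G Irr) (P : Submodule ℂ (Lp E 2 ν))
    (hP : IsClosed (SetLike.coe P))
    (h : ∀ e σ l k, tensorL2 ν e (toL2 ν (R.entry σ l k)) ∈ P) : P = ⊤ := by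
  have h1 : ∀ e φ, tensorL2 ν e φ ∈ P := by
    intro e φ
    have hle : (Submodule.span ℂ (Set.range fun i : Σ σ, Fin (R.dim σ) × Fin (R.dim σ) =>
        toL2 ν (R.entry i.1 i.2.1 i.2.2))).topologicalClosure ≤
        P.comap (tensorL2 ν e).toLinearMap := by
      refine Submodule.topologicalClosure_minimal _ ?_ (hP.preimage (tensorL2 ν e).continuous)
      rw [Submodule.span_le]
      rintro _ ⟨i, rfl⟩
      exact h e _ _ _
    rw [topologicalClosure_span_entry] at hle
    exact hle trivial
  rw [eq_top_iff]
  intro f _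
  refine Lp.induction (p := 2) ENNReal.ofNat_ne_top (motive := fun f => f ∈ P) ?_ ?_ hP f
  · intro c s hs hμs
    have : indicatorConstLp 2 hs hμs.ne c = tensorL2 ν c (indicatorConstLp 2 hs hμs.ne (1 : ℂ)) := by
      refine Lp.ext ?_
      filter_upwards [coeFn_tensorL2 ν c (indicatorConstLp 2 hs hμs.ne (1 : ℂ)),
        indicatorConstLp_coeFn (p := 2) (hs := hs) (hμs := hμs.ne) (c := c),
        indicatorConstLp_coeFn (p := 2) (hs := hs) (hμs := hμs.ne) (c := (1 : ℂ))] with y h1 h2 h3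
      rw [h1, h2, h3]
      by_cases hys : y ∈ s <;> simp [hys]
    change indicatorConstLp 2 hs hμs.ne c ∈ P
    rw [this]
    exact h1 _ _
  · intro f g hf hg _ h1 h2
    exact P.add_mem h1 h2

variable {K : Type*} [NormedAddCommGroup K] [InnerProductSpace ℂ K] [CompleteSpace K]

theorem inner_tensorL2 (φ ψ : Lp ℂ 2 ν) (ξ ζ : K) :
    ⟪tensorL2 ν ξ φ, tensorL2 ν ζ ψ⟫_ℂ = ⟪φ, ψ⟫_ℂ * ⟪ξ, ζ⟫_ℂ := by
  rw [L2.inner_def, L2.inner_def, ← integral_mul_const]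
  refine integral_congr_ae ?_
  filter_upwards [coeFn_tensorL2 ν ξ φ, coeFn_tensorL2 ν ζ ψ] with h h1 h2
  rw [h1, h2, inner_smul_left, inner_smul_right, RCLike.inner_apply]
  ring

/-- The operator `ξ ↦ (h ↦ Φ(h) ξ)` from `K` to `L²(G, K)` given by an `L²`-function `Φ` with
values in the operators on `K`. -/
def fieldOp : Lp (K →L[ℂ] K) 2 ν →L[ℂ] K →L[ℂ] Lp K 2 ν :=
  (Lp.constL ⊤ ν ℂ).precomp (Lp K 2 ν) ∘L
    (ContinuousLinearMap.id ℂ (K →L[ℂ] K)).holderL ν 2 ⊤ 2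

theorem coeFn_fieldOp (Φ : Lp (K →L[ℂ] K) 2 ν) (ξ : K) :
    fieldOp ν Φ ξ =ᵐ[ν] fun h => Φ h ξ := by
  have h1 := (ContinuousLinearMap.id ℂ (K →L[ℂ] K)).coeFn_holder (r := 2) Φ (Lp.const ⊤ ν ξ)
  filter_upwards [h1, Lp.coeFn_const ⊤ ν ξ] with h h1 h2
  refine h1.trans ?_
  rw [h2]
  rfl

/-- Multiplication by a continuous function with values in the operators on `K`. -/
def multOp : C(G, K →L[ℂ] K) →L[ℂ] Lp K 2 ν →L[ℂ] Lp K 2 ν :=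
  (ContinuousLinearMap.id ℂ (K →L[ℂ] K)).holderL ν ⊤ 2 2 ∘L ContinuousMap.toLp ⊤ ν ℂ

theorem coeFn_multOp (φ : C(G, K →L[ℂ] K)) (f : Lp K 2 ν) :
    multOp ν φ f =ᵐ[ν] fun h => φ h (f h) := by
  have h1 := (ContinuousLinearMap.id ℂ (K →L[ℂ] K)).coeFn_holder (r := 2)
    (ContinuousMap.toLp ⊤ ν ℂ φ) f
  filter_upwards [h1, ContinuousMap.coeFn_toLp (p := ⊤) (𝕜 := ℂ) ν φ] with h h1 h2
  refine h1.trans ?_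
  rw [h2]
  rfl

/-- The operator `ξ ↦ (h ↦ φ(h) ξ)` given by a continuous function `φ`. -/
def contFieldOp (φ : C(G, K →L[ℂ] K)) : K →L[ℂ] Lp K 2 ν :=
  fieldOp ν (ContinuousMap.toLp 2 ν ℂ φ)

theorem coeFn_contFieldOp (φ : C(G, K →L[ℂ] K)) (ξ : K) :
    contFieldOp ν φ ξ =ᵐ[ν] fun h => φ h ξ := by
  filter_upwards [coeFn_fieldOp ν (ContinuousMap.toLp 2 ν ℂ φ) ξ,
    ContinuousMap.coeFn_toLp (p := 2) (𝕜 := ℂ) ν φ] with h h1 h2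
  rw [contFieldOp, h1, h2]

theorem fieldOp_tensorL2 (φ : Lp ℂ 2 ν) (T : K →L[ℂ] K) (ξ : K) :
    fieldOp ν (tensorL2 ν T φ) ξ = tensorL2 ν (T ξ) φ := by
  refine Lp.ext ?_
  filter_upwards [coeFn_fieldOp ν (tensorL2 ν T φ) ξ, coeFn_tensorL2 ν T φ,
    coeFn_tensorL2 ν (T ξ) φ] with h h1 h2 h3
  rw [h1, h2, h3]
  rfl

/-- The isometry `ξ ↦ ξ ⊗ φ` for a unit vector `φ` of `L²(G)`. -/
def tensorL2Isometry (φ : Lp ℂ 2 ν) (hφ : ‖φ‖ = 1) : K →ₗᵢ[ℂ] Lp K 2 ν where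
  toLinearMap := (fieldOp ν (tensorL2 ν (ContinuousLinearMap.id ℂ K) φ)).toLinearMap
  norm_map' ξ := by
    change ‖fieldOp ν (tensorL2 ν (ContinuousLinearMap.id ℂ K) φ) ξ‖ = ‖ξ‖
    rw [fieldOp_tensorL2, @norm_eq_sqrt_re_inner ℂ, inner_tensorL2, inner_self_eq_norm_sq_to_K, hφ,
      @norm_eq_sqrt_re_inner ℂ]
    simp

theorem tensorL2Isometry_apply (φ : Lp ℂ 2 ν) (hφ : ‖φ‖ = 1) (ξ : K) :
    tensorL2Isometry ν φ hφ ξ = tensorL2 ν ξ φ :=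
  fieldOp_tensorL2 ν φ _ ξ

end VectorValued

section Columns

variable {J K : Type*} [NormedAddCommGroup K] [InnerProductSpace ℂ K] [CompleteSpace K]

theorem inner_tensorBasis_left (j : J) (ξ : K) (x : ell2 J K) :
    ⟪tensorBasis j ξ, x⟫_ℂ = ⟪ξ, x j⟫_ℂ := by
  rw [← tensorBasis_adjoint_apply, ContinuousLinearMap.adjoint_inner_right]

theorem tensorBasis_apply_eq_single [DecidableEq J] (j : J) (ξ : K) :
    tensorBasis j ξ = lp.single 2 j ξ := by
  rw [tensorBasis_apply]
  congr!

end Columns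

section Fourier

variable {G : Type*} [Group G] [TopologicalSpace G] [IsTopologicalGroup G] [CompactSpace G]
  [SecondCountableTopology G] [MeasurableSpace G] [BorelSpace G] (ν : Measure G)
  [ν.IsHaarMeasure] [IsProbabilityMeasure ν] {Irr : Type*} (R : IrrepSystem G Irr)

/-- The normalized matrix coefficient `√d_σ σ_{lk}`, indexed by `(σ, (k, l))`. -/
def normEntry (i : Σ σ, Fin (R.dim σ) × Fin (R.dim σ)) : Lp ℂ 2 ν :=
  (√(R.dim i.1 : ℝ) : ℂ) • toL2 ν (R.entry i.1 i.2.2 i.2.1)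

theorem orthonormal_normEntry : Orthonormal ℂ (normEntry ν R) := by
  classical
  rw [orthonormal_iff_ite]
  rintro ⟨σ, k, l⟩ ⟨τ, k', l'⟩
  rw [normEntry, normEntry, inner_smul_left, inner_smul_right, inner_toL2]
  rcases eq_or_ne τ σ with rfl | h
  · have hd : (R.dim τ : ℂ) ≠ 0 := Nat.cast_ne_zero.2 (R.irred τ).1.ne'
    rw [IrrepSystem.integral_entry_mul_entry]
    have hsq : (√(R.dim τ : ℝ) : ℂ) * (√(R.dim τ : ℝ) : ℂ) = R.dim τ := by
      rw [← Complex.ofReal_mul, Real.mul_self_sqrt (Nat.cast_nonneg _), Complex.ofReal_natCast]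
    by_cases h : l' = l ∧ k' = k
    · rw [if_pos h, if_pos (by rw [h.1, h.2]), Complex.conj_ofReal, ← mul_assoc, hsq,
        mul_inv_cancel₀ hd]
    · rw [if_neg h, if_neg (by rintro ⟨⟩; exact h ⟨rfl, rfl⟩), mul_zero, mul_zero]
  · rw [IrrepSystem.integral_entry_mul_entry_of_ne R ν h, mul_zero, mul_zero, if_neg]
    rintro ⟨⟩
    exact h rfl

variable (K : Type*) [NormedAddCommGroup K] [InnerProductSpace ℂ K] [CompleteSpace K]

theorem isHilbertSum_normEntry :
    IsHilbertSum ℂ (fun _ : Σ σ, Fin (R.dim σ) × Fin (R.dim σ) => K)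
      fun i => tensorL2Isometry ν (normEntry ν R i) ((orthonormal_normEntry ν R).1 i) := by
  refine IsHilbertSum.mk ?_ ?_
  · intro i j hij ξ ζ
    rw [tensorL2Isometry_apply, tensorL2Isometry_apply, inner_tensorL2,
      (orthonormal_normEntry ν R).2 hij, zero_mul]
  · refine (eq_top_of_tensorL2_entry_mem ν R _ (Submodule.isClosed_topologicalClosure _) ?_).ge
    intro ξ σ l k
    refine Submodule.le_topologicalClosure _ (Submodule.mem_iSup_of_mem ⟨σ, k, l⟩ ?_)
    have hd : (√(R.dim σ : ℝ) : ℂ) ≠ 0 := by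
      rw [Complex.ofReal_ne_zero, Real.sqrt_ne_zero']
      exact Nat.cast_pos.2 (R.irred σ).1
    refine ⟨((√(R.dim σ : ℝ) : ℂ))⁻¹ • ξ, ?_⟩
    change tensorL2Isometry ν _ _ _ = _
    rw [map_smul, tensorL2Isometry_apply, normEntry, map_smul, smul_smul, inv_mul_cancel₀ hd,
      one_smul]

/-- The isomorphism `K ⊗ L²(G) = ⨁_σ K ⊗ V_σ ⊗ V̄_σ` of the Peter–Weyl theorem. -/
def fourier : Lp K 2 ν ≃ₗᵢ[ℂ] ell2 (Σ σ, Fin (R.dim σ) × Fin (R.dim σ)) K :=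
  (isHilbertSum_normEntry ν R K).linearIsometryEquiv

variable {K}

theorem fourier_symm_tensorBasis (i : Σ σ, Fin (R.dim σ) × Fin (R.dim σ)) (ξ : K) :
    (fourier ν R K).symm (tensorBasis i ξ) = tensorL2 ν ξ (normEntry ν R i) := by
  classical
  rw [tensorBasis_apply_eq_single, fourier, IsHilbertSum.linearIsometryEquiv_symm_apply_single,
    tensorL2Isometry_apply]

theorem fourier_tensorL2 (i : Σ σ, Fin (R.dim σ) × Fin (R.dim σ)) (ξ : K) :
    fourier ν R K (tensorL2 ν ξ (normEntry ν R i)) = tensorBasis i ξ := by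
  rw [← fourier_symm_tensorBasis, LinearIsometryEquiv.apply_symm_apply]

theorem fourier_apply (f : Lp K 2 ν) (σ : Irr) (k l : Fin (R.dim σ)) :
    fourier ν R K f ⟨σ, k, l⟩ = R.coeff ν f σ k l := by
  classical
  refine ext_inner_left ℂ fun ξ => ?_
  have h1 : ⟪ξ, fourier ν R K f ⟨σ, k, l⟩⟫_ℂ = ⟪tensorL2 ν ξ (normEntry ν R ⟨σ, k, l⟩), f⟫_ℂ := by
    rw [← (fourier ν R K).inner_map_map, fourier_tensorL2, inner_tensorBasis_left]
  have hi : Integrable (fun h => star ((√(R.dim σ : ℝ) : ℂ) *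
      (R.rep σ h : Matrix (Fin (R.dim σ)) (Fin (R.dim σ)) ℂ) l k) • f h) ν := by
    have hc : Continuous fun h => star ((√(R.dim σ : ℝ) : ℂ) * R.entry σ l k h) := by fun_prop
    exact (((Lp.memLp f).integrable (by norm_num)).smul_of_top_right
      (memLp_top_of_continuous ν hc))
  rw [h1, IrrepSystem.coeff, ← integral_inner hi, L2.inner_def]
  refine integral_congr_ae ?_
  filter_upwards [coeFn_tensorL2 ν ξ (normEntry ν R ⟨σ, k, l⟩),
    Lp.coeFn_smul (√(R.dim σ : ℝ) : ℂ) (toL2 ν (R.entry σ l k)),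
    ContinuousMap.coeFn_toLp (p := 2) (𝕜 := ℂ) ν (R.entry σ l k)] with h h1 h2 h3
  rw [h1, normEntry, h2, Pi.smul_apply, toL2, h3, inner_smul_left, inner_smul_right]
  rfl

end Fourier

/-! ### The representation `jα` and the isometry `s` -/

section Orbit

theorem continuous_starAlgHom {A B : Type*} [CStarAlgebra A] [CStarAlgebra B] (π : A →⋆ₐ[ℂ] B) :
    Continuous π :=
  AddMonoidHomClass.continuous_of_bound π 1 fun x => by
    rw [one_mul]; exact NonUnitalStarAlgHom.norm_apply_le π x

variable {A G : Type*} [CStarAlgebra A] [Group G] [TopologicalSpace G] [IsTopologicalGroup G]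
  [CompactSpace G] (S : CStarDynSystem A G)
  {K : Type*} [NormedAddCommGroup K] [InnerProductSpace ℂ K] [CompleteSpace K]
  (π : A →⋆ₐ[ℂ] (K →L[ℂ] K))

theorem CStarDynSystem.continuous_act_inv (a : A) : Continuous fun h : G => S.act h⁻¹ a :=
  S.continuous_act.comp (by fun_prop : Continuous fun h : G => (h⁻¹, a))

/-- The operator-valued function `h ↦ π(α_{h⁻¹}(a))`. -/
def orbitMap (a : A) : C(G, K →L[ℂ] K) where
  toFun h := π (S.act h⁻¹ a)
  continuous_toFun := (continuous_starAlgHom π).comp (S.continuous_act_inv a)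

theorem orbitMap_apply (a : A) (h : G) : orbitMap S π a h = π (S.act h⁻¹ a) := rfl

variable [SecondCountableTopology G] [MeasurableSpace G] [BorelSpace G] (ν : Measure G)
  [ν.IsHaarMeasure] [IsProbabilityMeasure ν]

theorem multOp_orbitMap_one : multOp ν (orbitMap S π 1) = 1 := by
  ext1 f
  refine Lp.ext ?_
  filter_upwards [coeFn_multOp ν (orbitMap S π 1) f] with h hh
  rw [hh, orbitMap_apply, map_one, map_one]
  rfl

/-- The representation `jα` of `A` on `L²(G, K)`, `(jα(x) f)(h) = π(α_{h⁻¹}(x)) f(h)`. -/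
def orbitRep : A →⋆ₐ[ℂ] (Lp K 2 ν →L[ℂ] Lp K 2 ν) where
  toFun x := multOp ν (orbitMap S π x)
  map_one' := multOp_orbitMap_one S π ν
  map_mul' x y := by
    ext1 f
    refine Lp.ext ?_
    rw [mul_apply_eq_comp]
    filter_upwards [coeFn_multOp ν (orbitMap S π (x * y)) f, coeFn_multOp ν (orbitMap S π y) f,
      coeFn_multOp ν (orbitMap S π x) (multOp ν (orbitMap S π y) f)] with h h1 h2 h3
    rw [h1, h3, h2, orbitMap_apply, map_mul, map_mul]
    rfl
  map_zero' := by
    have : orbitMap S π 0 = 0 := by ext1 h; rw [orbitMap_apply, map_zero, map_zero]; rfl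
    rw [this, map_zero]
  map_add' x y := by
    have : orbitMap S π (x + y) = orbitMap S π x + orbitMap S π y := by
      ext1 h; rw [orbitMap_apply, map_add, map_add]; rfl
    rw [this, map_add]
  commutes' c := by
    have : orbitMap S π (algebraMap ℂ A c) = c • orbitMap S π 1 := by
      ext1 h
      rw [ContinuousMap.smul_apply, orbitMap_apply, orbitMap_apply, Algebra.algebraMap_eq_smul_one,
        map_smul, map_smul]
    rw [this, map_smul, Algebra.algebraMap_eq_smul_one]
    congr 1
    exact multOp_orbitMap_one S π ν
  map_star' x := by
    ext1 f
    refine ext_inner_left ℂ fun g => ?_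
    rw [ContinuousLinearMap.star_eq_adjoint, ContinuousLinearMap.adjoint_inner_right, L2.inner_def,
      L2.inner_def]
    refine integral_congr_ae ?_
    filter_upwards [coeFn_multOp ν (orbitMap S π x) g,
      coeFn_multOp ν (orbitMap S π (star x)) f] with h h1 h2
    rw [h1, h2, orbitMap_apply, orbitMap_apply, map_star, map_star,
      ContinuousLinearMap.star_eq_adjoint, ContinuousLinearMap.adjoint_inner_right]

theorem coeFn_orbitRep (x : A) (f : Lp K 2 ν) :
    orbitRep S π ν x f =ᵐ[ν] fun h => π (S.act h⁻¹ x) (f h) :=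
  coeFn_multOp ν (orbitMap S π x) f

/-- The operator `K → L²(G, K)`, `ξ ↦ (h ↦ π(α_{h⁻¹}(a)) ξ)`. -/
def orbitVec (a : A) : K →L[ℂ] Lp K 2 ν := contFieldOp ν (orbitMap S π a)

theorem coeFn_orbitVec (a : A) (ξ : K) :
    orbitVec S π ν a ξ =ᵐ[ν] fun h => π (S.act h⁻¹ a) ξ :=
  coeFn_contFieldOp ν (orbitMap S π a) ξ

theorem orbitRep_comp_orbitVec (x a : A) :
    orbitRep S π ν x ∘L orbitVec S π ν a = orbitVec S π ν (x * a) := by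
  ext1 ξ
  refine Lp.ext ?_
  rw [ContinuousLinearMap.comp_apply]
  filter_upwards [coeFn_orbitRep S π ν x (orbitVec S π ν a ξ), coeFn_orbitVec S π ν a ξ,
    coeFn_orbitVec S π ν (x * a) ξ] with h h1 h2 h3
  rw [h1, h2, h3, map_mul, map_mul]
  rfl

/-- `jα` is faithful if `π` is. -/
theorem orbitRep_injective (hπ : Function.Injective π) : Function.Injective (orbitRep S π ν) := by
  rw [injective_iff_map_eq_zero]
  intro x hx
  refine hπ ?_
  rw [map_zero]
  ext1 ξ
  have h1 : orbitVec S π ν x ξ = 0 := by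
    rw [← mul_one x, ← orbitRep_comp_orbitVec, hx]
    rfl
  have h2 : (fun h : G => π (S.act h⁻¹ x) ξ) =ᵐ[ν] fun _ => 0 :=
    (coeFn_orbitVec S π ν x ξ).symm.trans (by rw [h1]; exact Lp.coeFn_zero K 2 ν)
  have h3 := congrFun ((Continuous.ae_eq_iff_eq ν
    ((ContinuousLinearMap.apply ℂ K ξ).continuous.comp (orbitMap S π x).continuous)
    continuous_const).1 h2) 1
  change π (S.act 1⁻¹ x) ξ = 0 at h3
  rwa [inv_one, map_one] at h3

/-- The conditional expectation `a ↦ ∫ α_{h⁻¹}(a) dh` onto the fixed point algebra. -/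
def average (a : A) : A := ∫ h, S.act h⁻¹ a ∂ν

theorem average_mem_fixedAlgebra (a : A) : average S ν a ∈ S.fixedAlgebra := by
  intro g
  have := isMulRightInvariant_of_compact ν
  let T : A →L[ℂ] A :=
    { toFun := S.act g
      map_add' := map_add _
      map_smul' := map_smul _
      cont := S.continuous_act.comp (by fun_prop : Continuous fun a : A => (g, a)) }
  have h1 : T (average S ν a) = ∫ h, T (S.act h⁻¹ a) ∂ν :=
    (T.integral_comp_comm (integrable_of_continuous ν (S.continuous_act_inv a))).symm
  refine h1.trans ?_
  rw [average, ← integral_mul_right_eq_self _ g]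
  refine integral_congr_ae (Filter.Eventually.of_forall fun h => ?_)
  change (S.act g * S.act (h * g)⁻¹) a = S.act h⁻¹ a
  rw [← map_mul, mul_inv_rev, mul_inv_cancel_left]

theorem rep_average_apply (a : A) (ξ : K) :
    π (average S ν a) ξ = ∫ h, π (S.act h⁻¹ a) ξ ∂ν := by
  let T : A →L[ℂ] K := ContinuousLinearMap.apply ℂ K ξ ∘L
    ({ toFun := π
       map_add' := map_add π
       map_smul' := map_smul π
       cont := continuous_starAlgHom π } : A →L[ℂ] (K →L[ℂ] K))
  exact (T.integral_comp_comm (integrable_of_continuous ν (S.continuous_act_inv a))).symm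

end Orbit

section Isometry

variable {A G Irr : Type*} [CStarAlgebra A] [Group G] [TopologicalSpace G] [IsTopologicalGroup G]
  [CompactSpace G] [SecondCountableTopology G] [MeasurableSpace G] [BorelSpace G]
  {S : CStarDynSystem A G} {R : IrrepSystem G Irr} (F : IsometryFamily S R) (ν : Measure G)
  [ν.IsHaarMeasure] [IsProbabilityMeasure ν]
  {K : Type*} [NormedAddCommGroup K] [InnerProductSpace ℂ K] [CompleteSpace K]
  (π : A →⋆ₐ[ℂ] (K →L[ℂ] K))

/-- The isometry `s`: the Fourier decomposition of `L²(G, K)` followed by the block-diagonal isometry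
with the blocks `π(s(σ)) ⊗ 1`. -/
theorem IsometryFamily.exists_isometry :
    ∃ s : Lp K 2 ν →ₗᵢ[ℂ] ell2 F.Basis K, ∀ f, ⇑(s f) = F.sCoord ν π f := by
  obtain ⟨U, hU⟩ := exists_block_isometry (K := K)
    (X := fun σ => Fin (R.dim σ) × Fin (R.dim σ)) (Y := fun σ => Fin (F.mult σ) × Fin (R.dim σ))
    (fun σ y x => if y.2 = x.2 then π (F.s σ y.1 x.1) else 0) (by
      rintro σ ⟨k, l⟩ ⟨k', l'⟩
      rw [Fintype.sum_prod_type]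
      have h1 : ∀ i, ∑ m, (if m = l then π (F.s σ i k) else 0 : K →L[ℂ] K)† ∘L
          (if m = l' then π (F.s σ i k') else 0 : K →L[ℂ] K) =
          if l = l' then π (star (F.s σ i k) * F.s σ i k') else 0 := by
        intro i
        rw [Finset.sum_eq_single l]
        · rw [if_pos rfl]
          split_ifs
          · rw [map_mul, map_star]; rfl
          · exact ContinuousLinearMap.comp_zero _
        · intro m _ hm
          rw [if_neg hm, map_zero, ContinuousLinearMap.zero_comp]
        · exact fun h => absurd (Finset.mem_univ l) h
      simp only [h1]
      by_cases hl : l = l'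
      · have h2 := congrFun (congrFun (F.isometry σ) k) k'
        rw [Matrix.mul_apply] at h2
        simp only [Matrix.conjTranspose_apply] at h2
        simp only [if_pos hl]
        rw [← map_sum, h2, Matrix.one_apply]
        by_cases hk : k = k'
        · rw [if_pos hk, if_pos (by rw [hk, hl]), map_one]; rfl
        · rw [if_neg hk, if_neg (fun h => hk (congrArg Prod.fst h)), map_zero]
      · simp only [if_neg hl, Finset.sum_const_zero]
        rw [if_neg (fun h => hl (congrArg Prod.snd h))])
  refine ⟨U.comp (fourier ν R K).toLinearIsometry, fun f => ?_⟩
  funext ⟨σ, i, l⟩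
  refine (hU _ σ (i, l)).trans ?_
  rw [Fintype.sum_prod_type]
  refine Finset.sum_congr rfl fun k _ => ?_
  rw [Finset.sum_eq_single l]
  · rw [if_pos rfl]
    exact congrArg _ (fourier_apply ν R f σ k l)
  · intro m _ hm
    rw [if_neg (fun h => hm h.symm)]
    rfl
  · exact fun h => absurd (Finset.mem_univ l) h

/-- The equivariance of `s(σ)` turns the coordinates of `s f` into
`√d_σ ∫ π(α_{h⁻¹}(s(σ)_{il})) f(h) dh`. -/
theorem IsometryFamily.sCoord_apply (f : Lp K 2 ν) (σ : Irr) (i : Fin (F.mult σ))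
    (l : Fin (R.dim σ)) : F.sCoord ν π f ⟨σ, i, l⟩ =
      ∫ h, (√(R.dim σ : ℝ) : ℂ) • π (S.act h⁻¹ (F.s σ i l)) (f h) ∂ν := by
  have hi : ∀ k, Integrable (fun h => star ((√(R.dim σ : ℝ) : ℂ) *
      (R.rep σ h : Matrix (Fin (R.dim σ)) (Fin (R.dim σ)) ℂ) l k) • f h) ν := by
    intro k
    have hc : Continuous fun h => star ((√(R.dim σ : ℝ) : ℂ) * R.entry σ l k h) := by fun_prop
    exact (((Lp.memLp f).integrable (by norm_num)).smul_of_top_right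
      (memLp_top_of_continuous ν hc))
  have h1 : F.sCoord ν π f ⟨σ, i, l⟩ = ∑ k, ∫ h, π (F.s σ i k) (star ((√(R.dim σ : ℝ) : ℂ) *
      (R.rep σ h : Matrix (Fin (R.dim σ)) (Fin (R.dim σ)) ℂ) l k) • f h) ∂ν :=
    Finset.sum_congr rfl fun k _ => ((π (F.s σ i k)).integral_comp_comm (hi k)).symm
  rw [h1, ← integral_finsetSum _ fun k _ => (π (F.s σ i k)).integrable_comp (hi k)]
  refine integral_congr_ae (Filter.Eventually.of_forall fun h => ?_)
  have h2 : S.act h⁻¹ (F.s σ i l) = ∑ k, star (R.entry σ l k h) • F.s σ i k := by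
    have := congrFun (congrFun (F.equivariant h⁻¹ σ) i) l
    rw [Matrix.map_apply, Matrix.mul_apply] at this
    rw [this]
    refine Finset.sum_congr rfl fun k _ => ?_
    rw [Matrix.map_apply, unitary_entry_inv, ← Algebra.commutes, ← Algebra.smul_def]
    rfl
  change ∑ k, π (F.s σ i k) _ = (√(R.dim σ : ℝ) : ℂ) • π (S.act h⁻¹ (F.s σ i l)) (f h)
  rw [h2, map_sum, _root_.sum_apply, Finset.smul_sum]
  refine Finset.sum_congr rfl fun k _ => ?_
  rw [map_smul, map_smul, _root_.smul_apply, smul_smul, star_mul', ← R.entry_apply]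
  congr 2
  exact Complex.conj_ofReal _

variable {F ν π} {s : Lp K 2 ν →ₗᵢ[ℂ] ell2 F.Basis K}

/-- The entries of `s κ(a)`, where `κ(a) ξ` is the function `h ↦ π(α_{h⁻¹}(a)) ξ`, lie in the
fixed point algebra. -/
theorem exists_entry_comp_orbitVec (hs : ∀ f, ⇑(s f) = F.sCoord ν π f) (a : A) (j : F.Basis) :
    ∃ b : S.fixedAlgebra, (tensorBasis j)† ∘L s.toContinuousLinearMap ∘L orbitVec S π ν a =
      π.comp S.fixedAlgebra.subtype b := by
  obtain ⟨σ, i, l⟩ := j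
  refine ⟨(√(R.dim σ : ℝ) : ℂ) • ⟨average S ν (F.s σ i l * a), average_mem_fixedAlgebra S ν _⟩, ?_⟩
  ext1 ξ
  rw [map_smul, _root_.smul_apply]
  change ContinuousLinearMap.adjoint (tensorBasis _) (s (orbitVec S π ν a ξ)) =
    (√(R.dim σ : ℝ) : ℂ) • π (average S ν (F.s σ i l * a)) ξ
  rw [tensorBasis_adjoint_apply, hs, F.sCoord_apply, rep_average_apply, ← integral_smul]
  refine integral_congr_ae ?_
  filter_upwards [coeFn_orbitVec S π ν a ξ] with h hh
  rw [hh, map_mul, map_mul]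
  rfl

/-- The identity `s†(ξ ⊗ f_i ⊗ ē_l) = (h ↦ √d_σ π(α_{h⁻¹}(s(σ)_{il}*)) ξ)`, a consequence of the
equivariance of `s(σ)`, which gives `α_{h⁻¹}(s(σ)_{il}) = ∑_k s(σ)_{ik} σ(h⁻¹)_{kl}`. -/
theorem adjoint_comp_tensorBasis (hs : ∀ f, ⇑(s f) = F.sCoord ν π f) (σ : Irr)
    (i : Fin (F.mult σ)) (l : Fin (R.dim σ)) :
    s.toContinuousLinearMap† ∘L tensorBasis ⟨σ, i, l⟩ =
      orbitVec S π ν ((√(R.dim σ : ℝ) : ℂ) • star (F.s σ i l)) := by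
  ext1 ξ
  refine ext_inner_right ℂ fun f => ?_
  rw [ContinuousLinearMap.comp_apply, ContinuousLinearMap.adjoint_inner_left,
    inner_tensorBasis_left]
  change ⟪ξ, s f ⟨σ, i, l⟩⟫_ℂ = _
  have hi : Integrable (fun h => (√(R.dim σ : ℝ) : ℂ) • π (S.act h⁻¹ (F.s σ i l)) (f h)) ν := by
    have : Integrable (multOp ν (orbitMap S π (F.s σ i l)) f) ν :=
      (Lp.memLp _).integrable (by norm_num)
    exact (this.congr (coeFn_multOp ν _ f)).smul _
  rw [hs, F.sCoord_apply, ← integral_inner hi, L2.inner_def]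
  refine integral_congr_ae ?_
  filter_upwards [coeFn_orbitVec S π ν ((√(R.dim σ : ℝ) : ℂ) • star (F.s σ i l)) ξ] with h hh
  rw [hh, map_smul, map_smul, _root_.smul_apply, inner_smul_left, inner_smul_right, map_star,
    map_star, ContinuousLinearMap.star_eq_adjoint, ContinuousLinearMap.adjoint_inner_left,
    Complex.conj_ofReal]

end Isometry

/-! ### The operators `π_s(x)` are multipliers -/

section CompactColumns

open Filter Topology

theorem isClosed_setOf_tendsto_of_norm_le {E ι : Type*} [NormedAddCommGroup E] [NormedSpace ℂ E]
    {p : ι → E →L[ℂ] E} {l : Filter ι} (hp : ∀ i x, ‖p i x‖ ≤ ‖x‖) :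
    IsClosed {x | Tendsto (fun i => p i x) l (𝓝 x)} := by
  refine isClosed_of_closure_subset fun x hx => Metric.tendsto_nhds.2 fun ε hε => ?_
  obtain ⟨y, hy, hxy⟩ := Metric.mem_closure_iff.1 hx (ε / 3) (by positivity)
  filter_upwards [Metric.tendsto_nhds.1 hy (ε / 3) (by positivity)] with i hi
  have h1 : dist (p i x) (p i y) < ε / 3 := by
    rw [dist_eq_norm, ← map_sub]
    exact lt_of_le_of_lt (hp i _) (dist_eq_norm x y ▸ hxy)
  calc dist (p i x) x ≤ dist (p i x) (p i y) + dist (p i y) y + dist y x := dist_triangle4 _ _ _ _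
    _ < ε / 3 + ε / 3 + ε / 3 := add_lt_add (add_lt_add h1 hi) (by rwa [dist_comm])
    _ = ε := by ring

theorem cauchySeq_of_norm_sub_eq {E E' ι : Type*} [NormedAddCommGroup E] [NormedAddCommGroup E']
    [Nonempty ι] [SemilatticeSup ι] {u : ι → E} {v : ι → E'} (hu : CauchySeq u)
    (h : ∀ i j, ‖u i - u j‖ = ‖v i - v j‖) : CauchySeq v := by
  rw [Metric.cauchySeq_iff'] at hu ⊢
  intro ε hε
  obtain ⟨N, hN⟩ := hu ε hε
  exact ⟨N, fun n hn => by rw [dist_eq_norm, ← h, ← dist_eq_norm]; exact hN n hn⟩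

variable {J B K K₂ : Type*} [Ring B] [StarRing B] [Algebra ℂ B]
  [NormedAddCommGroup K] [InnerProductSpace ℂ K] [CompleteSpace K]
  [NormedAddCommGroup K₂] [InnerProductSpace ℂ K₂] [CompleteSpace K₂]
  {π₁ : B →⋆ₐ[ℂ] (K →L[ℂ] K)} {π₂ : B →⋆ₐ[ℂ] (K₂ →L[ℂ] K₂)}

variable (J K) in
/-- The columns `X : K → ℓ²(J, K)` whose finite parts `P_s X` converge to `X` in norm. -/
def compactColumns : Submodule ℂ (K →L[ℂ] ell2 J K) where
  carrier := {X | Tendsto (fun s : Finset J => coordProj s ∘L X) atTop (𝓝 X)}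
  zero_mem' := by
    simp only [Set.mem_ofPred_eq, ContinuousLinearMap.comp_zero]
    exact tendsto_const_nhds
  add_mem' {X Y} hX hY := by
    simp only [Set.mem_ofPred_eq, ContinuousLinearMap.comp_add]
    exact Tendsto.add hX hY
  smul_mem' c X hX := by
    simp only [Set.mem_ofPred_eq, ContinuousLinearMap.comp_smul]
    exact Tendsto.const_smul hX c

theorem isClosed_compactColumns : IsClosed (SetLike.coe (compactColumns J K)) := by
  refine isClosed_setOf_tendsto_of_norm_le (E := K →L[ℂ] ell2 J K)
    (p := fun s : Finset J => (coordProj s).postcomp K) fun s X => ?_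
  exact (ContinuousLinearMap.opNorm_comp_le _ _).trans
    (mul_le_of_le_one_left (norm_nonneg _) (norm_coordProj_le s))

theorem mem_compactColumns_of_finite (t : Finset J) {X : K →L[ℂ] ell2 J K}
    (h : ∀ j ∉ t, ∀ ξ, X ξ j = 0) : X ∈ compactColumns J K := by
  refine tendsto_const_nhds.congr' ?_
  filter_upwards [eventually_ge_atTop t] with s hs
  ext1 ξ
  rw [ContinuousLinearMap.comp_apply, coordProj_apply]
  refine (hasSum_tensorBasis (X ξ)).unique (hasSum_sum_of_ne_finset_zero fun j hj => ?_)
  rw [h j (fun hjt => hj (hs hjt)), map_zero]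

theorem coordProj_comp_mem_colGraph {X : K →L[ℂ] ell2 J K} {b : J → B}
    (hb : ∀ j, (tensorBasis j)† ∘L X = π₁ (b j)) (s : Finset J) :
    (coordProj s ∘L X, ∑ j ∈ s, tensorBasis j ∘L π₂ (b j)) ∈ colGraph J π₁ π₂ := by
  have h := Submodule.sum_mem (colGraph J π₁ π₂) (t := s)
    fun j _ => tensorBasis_mem_colGraph (π₁ := π₁) (π₂ := π₂) (b j) j
  have h1 : coordProj s ∘L X = ∑ j ∈ s, tensorBasis j ∘L π₁ (b j) := by
    rw [coordProj, ContinuousLinearMap.finsetSum_comp]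
    refine Finset.sum_congr rfl fun j _ => ?_
    rw [ContinuousLinearMap.comp_assoc, hb]
  rw [h1]
  refine (congrArg (· ∈ colGraph J π₁ π₂) (Prod.ext ?_ ?_)).mp h
  · exact Prod.fst_sum
  · exact Prod.snd_sum

theorem norm_sub_eq_of_mem_colGraph (hiso : ∀ b, ‖π₁ b‖ = ‖π₂ b‖) (j : J)
    {X Y : K →L[ℂ] ell2 J K} {X' Y' : K₂ →L[ℂ] ell2 J K₂} (hX : (X, X') ∈ colGraph J π₁ π₂)
    (hY : (Y, Y') ∈ colGraph J π₁ π₂) : ‖X - Y‖ = ‖X' - Y'‖ := by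
  have h := Submodule.sub_mem _ hX hY
  exact norm_fst_eq_norm_snd_of_mem_colGraph (x := (X - Y, X' - Y')) hiso j h

/-- A column in `compactColumns` with entries in `π₁(B)` has a counterpart for `π₂`, because
corresponding finite columns have the same norm. -/
theorem exists_mem_colGraph [Nonempty J] (hiso : ∀ b, ‖π₁ b‖ = ‖π₂ b‖) {X : K →L[ℂ] ell2 J K}
    (hX : X ∈ compactColumns J K) (hent : ∀ j, ∃ b, (tensorBasis j)† ∘L X = π₁ b) :
    ∃ c, (X, c) ∈ colGraph J π₁ π₂ := by
  classical
  choose b hb using hent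
  have hmem := coordProj_comp_mem_colGraph (π₂ := π₂) hb
  have hcauchy : CauchySeq fun s : Finset J => ∑ j ∈ s, tensorBasis j ∘L π₂ (b j) := by
    refine cauchySeq_of_norm_sub_eq (E := K →L[ℂ] ell2 J K) (E' := K₂ →L[ℂ] ell2 J K₂)
      (u := fun s : Finset J => coordProj s ∘L X) (Tendsto.cauchySeq hX) fun s t => ?_
    exact norm_sub_eq_of_mem_colGraph hiso (Classical.arbitrary J) (hmem s) (hmem t)
  obtain ⟨c₀, hc₀⟩ := cauchySeq_tendsto_of_complete hcauchy
  refine ⟨c₀, ?_⟩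
  exact (Submodule.isClosed_topologicalClosure _).mem_of_tendsto (hX.prodMk_nhds hc₀)
    (Eventually.of_forall hmem)

end CompactColumns

section Fixed

variable {A G : Type*} [CStarAlgebra A] [Group G] [TopologicalSpace G] (S : CStarDynSystem A G)

theorem CStarDynSystem.isClosed_fixedAlgebra : IsClosed (SetLike.coe S.fixedAlgebra) := by
  have : SetLike.coe S.fixedAlgebra = ⋂ g, {x | S.act g x = x} := by
    ext x
    exact (Set.mem_iInter (s := fun g => {x | S.act g x = x})).symm
  rw [this]
  exact isClosed_iInter fun g => isClosed_eq
    (S.continuous_act.comp (by fun_prop : Continuous fun a : A => (g, a))) continuous_id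

theorem CStarDynSystem.norm_rep_fixed {K : Type*} [NormedAddCommGroup K] [InnerProductSpace ℂ K]
    [CompleteSpace K] (π : S.fixedAlgebra →⋆ₐ[ℂ] (K →L[ℂ] K)) (hπ : Function.Injective π)
    (b : S.fixedAlgebra) : ‖π b‖ = ‖b‖ := by
  have : IsClosed (SetLike.coe S.fixedAlgebra) := S.isClosed_fixedAlgebra
  exact NonUnitalStarAlgHom.norm_map π hπ b

end Fixed

section Multiplier

variable {A G Irr : Type*} [CStarAlgebra A] [Group G] [TopologicalSpace G] [IsTopologicalGroup G]
  [CompactSpace G] [SecondCountableTopology G] [MeasurableSpace G] [BorelSpace G]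
  {S : CStarDynSystem A G} {R : IrrepSystem G Irr} {F : IsometryFamily S R} {ν : Measure G}
  [ν.IsHaarMeasure] [IsProbabilityMeasure ν]
  {K : Type*} [NormedAddCommGroup K] [InnerProductSpace ℂ K] [CompleteSpace K]
  {π : A →⋆ₐ[ℂ] (K →L[ℂ] K)} {s : Lp K 2 ν →ₗᵢ[ℂ] ell2 F.Basis K}

theorem coeff_tensorL2_entry_of_ne {σ τ : Irr} (h : σ ≠ τ) (l k : Fin (R.dim σ))
    (k' l' : Fin (R.dim τ)) (ξ : K) :
    R.coeff ν (tensorL2 ν ξ (toL2 ν (R.entry σ l k))) τ k' l' = 0 := by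
  have h1 : R.coeff ν (tensorL2 ν ξ (toL2 ν (R.entry σ l k))) τ k' l' =
      ∫ h, ((√(R.dim τ : ℝ) : ℂ) * (star (R.entry τ l' k' h) * R.entry σ l k h)) • ξ ∂ν := by
    refine integral_congr_ae ?_
    filter_upwards [coeFn_tensorL2 ν ξ (toL2 ν (R.entry σ l k)),
      ContinuousMap.coeFn_toLp (p := 2) (𝕜 := ℂ) ν (R.entry σ l k)] with x h1 h2
    rw [h1, toL2, h2, smul_smul, ← R.entry_apply, star_mul', mul_assoc]
    congr 2
    exact Complex.conj_ofReal _
  rw [h1, integral_smul_const, integral_const_mul, R.integral_entry_mul_entry_of_ne ν h, mul_zero,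
    zero_smul]

/-- The columns `s V`, where `V : K → L²(G, K)` is given by an operator-valued `L²`-function, are
norm limits of finite columns. -/
theorem comp_fieldOp_mem_compactColumns (hs : ∀ f, ⇑(s f) = F.sCoord ν π f)
    (Φ : Lp (K →L[ℂ] K) 2 ν) :
    s.toContinuousLinearMap ∘L fieldOp ν Φ ∈ compactColumns F.Basis K := by
  classical
  let T : Lp (K →L[ℂ] K) 2 ν →L[ℂ] (K →L[ℂ] ell2 F.Basis K) :=
    s.toContinuousLinearMap.postcomp K ∘L fieldOp ν
  have h : (compactColumns F.Basis K).comap T.toLinearMap = ⊤ := by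
    refine eq_top_of_tensorL2_entry_mem ν R _ (isClosed_compactColumns.preimage T.continuous) ?_
    intro X σ l k
    refine mem_compactColumns_of_finite (Finset.univ.image (Sigma.mk σ)) ?_
    rintro ⟨τ, i, l'⟩ hj ξ
    change s (fieldOp ν (tensorL2 ν X (toL2 ν (R.entry σ l k))) ξ) ⟨τ, i, l'⟩ = 0
    rw [hs, fieldOp_tensorL2]
    have hne : σ ≠ τ := by
      rintro rfl
      exact hj (Finset.mem_image.2 ⟨(i, l'), Finset.mem_univ _, rfl⟩)
    refine Finset.sum_eq_zero fun m _ => ?_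
    rw [coeff_tensorL2_entry_of_ne hne, map_zero]
  have h' : Φ ∈ (compactColumns F.Basis K).comap T.toLinearMap := h ▸ Submodule.mem_top
  exact h'

/-- All `π_s(x) = s jα(x) s*` are multipliers of `B ⊗ K(H)`, and their images under the extension
of `π₂ ⊗ id` exist. -/
theorem exists_isTensorIdImage_conj {K₂ : Type*} [NormedAddCommGroup K₂] [InnerProductSpace ℂ K₂]
    [CompleteSpace K₂] (hs : ∀ f, ⇑(s f) = F.sCoord ν π f)
    {π₂ : S.fixedAlgebra →⋆ₐ[ℂ] (K₂ →L[ℂ] K₂)}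
    (hiso : ∀ b, ‖π.comp S.fixedAlgebra.subtype b‖ = ‖π₂ b‖) (x : A) :
    ∃ T, IsTensorIdImage (π.comp S.fixedAlgebra.subtype) π₂
      (s.toContinuousLinearMap ∘L orbitRep S π ν x ∘L s.toContinuousLinearMap†) T := by
  have : Nonempty F.Basis :=
    ⟨⟨R.one, Fin.cast F.mult_one.symm 0, Fin.cast R.dim_one.symm 0⟩⟩
  have key : ∀ (x : A) (j : F.Basis), ∃ c, ((s.toContinuousLinearMap ∘L orbitRep S π ν x ∘L
      s.toContinuousLinearMap†) ∘L tensorBasis j, c) ∈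
        colGraph F.Basis (π.comp S.fixedAlgebra.subtype) π₂ := by
    rintro x ⟨σ, i, l⟩
    rw [ContinuousLinearMap.comp_assoc, ContinuousLinearMap.comp_assoc,
      adjoint_comp_tensorBasis hs, orbitRep_comp_orbitVec]
    exact exists_mem_colGraph hiso (comp_fieldOp_mem_compactColumns hs _)
      fun j => exists_entry_comp_orbitVec hs _ j
  refine exists_isTensorIdImage hiso (key x) ?_
  have hadj : (s.toContinuousLinearMap ∘L orbitRep S π ν x ∘L s.toContinuousLinearMap†)† =
      s.toContinuousLinearMap ∘L orbitRep S π ν (star x) ∘L s.toContinuousLinearMap† := by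
    rw [ContinuousLinearMap.adjoint_comp, ContinuousLinearMap.adjoint_comp,
      ContinuousLinearMap.adjoint_adjoint, map_star, ContinuousLinearMap.star_eq_adjoint,
      ContinuousLinearMap.comp_assoc]
  rw [hadj]
  exact key (star x)

end Multiplier

/-! ### The unitary representation `1 ⊗ μ` -/

section Mu

theorem adjoint_eq_of_comp_eq_id {H : Type*} [NormedAddCommGroup H] [InnerProductSpace ℂ H]
    [CompleteSpace H] {U V : H →ₗᵢ[ℂ] H} (h : ∀ x, U (V x) = x) :
    U.toContinuousLinearMap† = V.toContinuousLinearMap := by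
  ext1 x
  conv_lhs => rw [← h x]
  exact isometry_adjoint_apply U (V x)

variable {A G Irr : Type*} [CStarAlgebra A] [Group G] [TopologicalSpace G]
  {S : CStarDynSystem A G} {R : IrrepSystem G Irr} (F : IsometryFamily S R)
  (K : Type*) [NormedAddCommGroup K] [InnerProductSpace ℂ K] [CompleteSpace K]

theorem IsometryFamily.exists_mu (g : G) :
    ∃ U : ell2 F.Basis K →ₗᵢ[ℂ] ell2 F.Basis K, ∀ f, ⇑(U f) = F.muCoord g f := by
  obtain ⟨U, hU⟩ := exists_block_isometry (K := K)
    (X := fun σ => Fin (F.mult σ) × Fin (R.dim σ)) (Y := fun σ => Fin (F.mult σ) × Fin (R.dim σ))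
    (fun σ y x => if y.1 = x.1 then star (R.entry σ y.2 x.2 g) • ContinuousLinearMap.id ℂ K else 0)
    (by
      rintro σ ⟨k, l⟩ ⟨k', l'⟩
      rw [Fintype.sum_prod_type_right]
      have h1 : ∀ m, ∑ i, (if i = k then star (R.entry σ m l g) •
          ContinuousLinearMap.id ℂ K else 0 : K →L[ℂ] K)† ∘L
          (if i = k' then star (R.entry σ m l' g) • ContinuousLinearMap.id ℂ K else 0 : K →L[ℂ] K) =
          if k = k' then (star (R.entry σ m l' g) * R.entry σ m l g) •
            ContinuousLinearMap.id ℂ K else 0 := by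
        intro m
        rw [Finset.sum_eq_single k]
        · rw [if_pos rfl]
          split_ifs
          · ext1 ξ
            refine ext_inner_left ℂ fun ζ => ?_
            rw [ContinuousLinearMap.comp_apply, ContinuousLinearMap.adjoint_inner_right]
            simp only [_root_.smul_apply, ContinuousLinearMap.id_apply, inner_smul_left,
              inner_smul_right]
            rw [starRingEnd_apply, star_star]
            ring
          · exact ContinuousLinearMap.comp_zero _
        · intro i _ hi
          rw [if_neg hi, map_zero, ContinuousLinearMap.zero_comp]
        · exact fun h => absurd (Finset.mem_univ k) h
      simp only [h1]
      by_cases hk : k = k'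
      · simp only [if_pos hk]
        have h2 := congrFun (congrFun (Matrix.mem_unitaryGroup_iff'.1 (R.rep σ g).2) l') l
        rw [Matrix.mul_apply, Matrix.one_apply] at h2
        have h3 : ∑ m, star (R.entry σ m l' g) * R.entry σ m l g = if l' = l then 1 else 0 := h2
        rw [← Finset.sum_smul, h3]
        by_cases hl : l' = l
        · rw [if_pos hl, if_pos (by rw [hk, hl]), one_smul]
        · rw [if_neg hl, if_neg (fun h => hl (congrArg Prod.snd h).symm), zero_smul]
      · simp only [if_neg hk, Finset.sum_const_zero]
        rw [if_neg (fun h => hk (congrArg Prod.fst h))])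
  refine ⟨U, fun f => ?_⟩
  funext ⟨σ, i, l⟩
  refine (hU _ σ (i, l)).trans ?_
  rw [Fintype.sum_prod_type_right]
  refine Finset.sum_congr rfl fun m _ => ?_
  rw [Finset.sum_eq_single i]
  · rw [if_pos rfl]
    rfl
  · intro i' _ hi
    rw [if_neg (fun h => hi h.symm)]
    rfl
  · exact fun h => absurd (Finset.mem_univ i) h

/-- The operator `1 ⊗ μ_g` on `K ⊗ H`. -/
def IsometryFamily.mu (g : G) : ell2 F.Basis K →ₗᵢ[ℂ] ell2 F.Basis K := (F.exists_mu K g).choose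

variable {K}

theorem IsometryFamily.mu_apply (g : G) (f : ell2 F.Basis K) : ⇑(F.mu K g f) = F.muCoord g f :=
  (F.exists_mu K g).choose_spec f

theorem IsometryFamily.mu_apply_apply (g : G) (f : ell2 F.Basis K) (σ : Irr) (i : Fin (F.mult σ))
    (l : Fin (R.dim σ)) : F.mu K g f ⟨σ, i, l⟩ =
      ∑ m, star (R.entry σ l m g) • f ⟨σ, i, m⟩ :=
  congrFun (F.mu_apply g f) _

theorem IsometryFamily.mu_mul_apply (g h : G) (f : ell2 F.Basis K) :
    F.mu K (g * h) f = F.mu K g (F.mu K h f) := by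
  ext ⟨σ, i, l⟩
  simp only [F.mu_apply_apply, R.entry_mul, star_sum, Finset.sum_smul, Finset.smul_sum, smul_smul,
    star_mul']
  exact Finset.sum_comm

theorem IsometryFamily.mu_one_apply (f : ell2 F.Basis K) : F.mu K 1 f = f := by
  ext ⟨σ, i, l⟩
  rw [F.mu_apply_apply, Finset.sum_eq_single l]
  · rw [R.entry_apply, map_one, Submonoid.coe_one, Matrix.one_apply_eq, star_one, one_smul]
  · intro m _ hm
    rw [R.entry_apply, map_one, Submonoid.coe_one, Matrix.one_apply_ne hm.symm, star_zero,
      zero_smul]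
  · exact fun h => absurd (Finset.mem_univ l) h

theorem IsometryFamily.mu_mu_inv_apply (g : G) (f : ell2 F.Basis K) :
    F.mu K g (F.mu K g⁻¹ f) = f := by
  rw [← F.mu_mul_apply, mul_inv_cancel, F.mu_one_apply]

theorem IsometryFamily.mu_adjoint (g : G) :
    (F.mu K g).toContinuousLinearMap† = (F.mu K g⁻¹).toContinuousLinearMap :=
  adjoint_eq_of_comp_eq_id (F.mu_mu_inv_apply g)

theorem IsometryFamily.mu_tensorBasis (g : G) (σ : Irr) (i : Fin (F.mult σ)) (l : Fin (R.dim σ))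
    (ξ : K) : F.mu K g (tensorBasis ⟨σ, i, l⟩ ξ) =
      ∑ m, star (R.entry σ m l g) • tensorBasis ⟨σ, i, m⟩ ξ := by
  refine ext_inner_right ℂ fun f => ?_
  have h1 : ⟪F.mu K g (tensorBasis ⟨σ, i, l⟩ ξ), f⟫_ℂ =
      ⟪tensorBasis ⟨σ, i, l⟩ ξ, F.mu K g⁻¹ f⟫_ℂ := by
    conv_lhs => rw [← F.mu_mu_inv_apply g f]
    exact (F.mu K g).inner_map_map _ _
  rw [h1, inner_tensorBasis_left, F.mu_apply_apply, inner_sum, sum_inner]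
  refine Finset.sum_congr rfl fun m _ => ?_
  rw [inner_smul_left, inner_smul_right, inner_tensorBasis_left, R.entry_inv]
  rfl

theorem IsometryFamily.continuous_mu (x : ell2 F.Basis K) : Continuous fun g => F.mu K g x := by
  have hfin : ∀ s : Finset F.Basis, Continuous fun g => F.mu K g (coordProj s x) := by
    intro s
    simp only [coordProj_apply, map_sum]
    refine continuous_finsetSum _ ?_
    rintro ⟨σ, i, l⟩ _
    simp only [F.mu_tensorBasis]
    exact continuous_finsetSum _ fun m _ =>
      ((R.entry σ m l).continuous.star).smul continuous_const
  have hlim : TendstoUniformly (fun (s : Finset F.Basis) g => F.mu K g (coordProj s x))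
      (fun g => F.mu K g x) Filter.atTop := by
    rw [Metric.tendstoUniformly_iff]
    intro ε hε
    have h := hasSum_tensorBasis x
    filter_upwards [Metric.tendsto_nhds.1 h ε hε] with s hs g
    rw [(F.mu K g).isometry.dist_eq, dist_comm, coordProj_apply]
    exact hs
  exact hlim.continuous (Filter.Eventually.of_forall hfin).frequently

/-- `1 ⊗ μ_g` is a multiplier of `B ⊗ K(H)`, and its image under the extension of `π₂ ⊗ id` is
`1 ⊗ μ_g`. -/
theorem IsometryFamily.isTensorIdImage_mu {B K₁ K₂ : Type*} [Ring B] [StarRing B] [Algebra ℂ B]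
    [NormedAddCommGroup K₁] [InnerProductSpace ℂ K₁] [CompleteSpace K₁]
    [NormedAddCommGroup K₂] [InnerProductSpace ℂ K₂] [CompleteSpace K₂]
    (π₁ : B →⋆ₐ[ℂ] (K₁ →L[ℂ] K₁)) (π₂ : B →⋆ₐ[ℂ] (K₂ →L[ℂ] K₂)) (g : G) :
    IsTensorIdImage π₁ π₂ (F.mu K₁ g).toContinuousLinearMap (F.mu K₂ g).toContinuousLinearMap := by
  have key : ∀ (g : G) (j : F.Basis),
      ((F.mu K₁ g).toContinuousLinearMap ∘L tensorBasis j,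
        (F.mu K₂ g).toContinuousLinearMap ∘L tensorBasis j) ∈ colGraph F.Basis π₁ π₂ := by
    rintro g ⟨σ, i, l⟩
    have h := Submodule.sum_mem (colGraph F.Basis π₁ π₂) (t := Finset.univ) fun m _ =>
      Submodule.smul_mem _ (star (R.entry σ m l g))
        (tensorBasis_mem_colGraph (π₁ := π₁) (π₂ := π₂) 1 (⟨σ, i, m⟩ : F.Basis))
    refine (congrArg (· ∈ colGraph F.Basis π₁ π₂) (Prod.ext ?_ ?_)).mp h
    · rw [Prod.fst_sum]
      ext1 ξ
      rw [_root_.sum_apply]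
      refine Eq.trans ?_ (F.mu_tensorBasis g σ i l ξ).symm
      refine Finset.sum_congr rfl fun m _ => ?_
      rw [map_one π₁]
      rfl
    · rw [Prod.snd_sum]
      ext1 ξ
      rw [_root_.sum_apply]
      refine Eq.trans ?_ (F.mu_tensorBasis g σ i l ξ).symm
      refine Finset.sum_congr rfl fun m _ => ?_
      rw [map_one π₂]
      rfl
  refine isTensorIdImage_of_columns (key g) ?_
  rw [F.mu_adjoint, F.mu_adjoint]
  exact key g⁻¹

end Mu

/-! ### Left translation and covariance -/

section Translation

variable {A G Irr : Type*} [CStarAlgebra A] [Group G] [TopologicalSpace G] [IsTopologicalGroup G]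
  [CompactSpace G] [SecondCountableTopology G] [MeasurableSpace G] [BorelSpace G]
  {S : CStarDynSystem A G} {R : IrrepSystem G Irr} {F : IsometryFamily S R} (ν : Measure G)
  [ν.IsHaarMeasure] [IsProbabilityMeasure ν]
  {K : Type*} [NormedAddCommGroup K] [InnerProductSpace ℂ K] [CompleteSpace K]
  {π : A →⋆ₐ[ℂ] (K →L[ℂ] K)}

variable (K) in
/-- Left translation `(λ_g f)(h) = f(g⁻¹h)` on `L²(G, K)`. -/
def leftTranslate (g : G) : Lp K 2 ν →ₗᵢ[ℂ] Lp K 2 ν :=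
  Lp.compMeasurePreservingₗᵢ ℂ (fun h => g⁻¹ * h) (measurePreserving_mul_left ν g⁻¹)

theorem coeFn_leftTranslate (g : G) (f : Lp K 2 ν) :
    leftTranslate ν K g f =ᵐ[ν] fun h => f (g⁻¹ * h) :=
  Lp.coeFn_compMeasurePreserving f (measurePreserving_mul_left ν g⁻¹)

theorem leftTranslate_inv_apply (g : G) (f : Lp K 2 ν) :
    leftTranslate ν K g (leftTranslate ν K g⁻¹ f) = f := by
  refine Lp.ext ?_
  have h1 := (measurePreserving_mul_left ν g⁻¹).quasiMeasurePreserving.ae_eq_comp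
    (coeFn_leftTranslate ν g⁻¹ f)
  filter_upwards [coeFn_leftTranslate ν g (leftTranslate ν K g⁻¹ f), h1] with h h1 h2
  rw [h1]
  refine h2.trans ?_
  simp

theorem coeff_leftTranslate (g : G) (f : Lp K 2 ν) (σ : Irr) (k l : Fin (R.dim σ)) :
    R.coeff ν (leftTranslate ν K g f) σ k l =
      ∑ m, star (R.entry σ l m g) • R.coeff ν f σ k m := by
  have hi : ∀ m, Integrable (fun h => star ((√(R.dim σ : ℝ) : ℂ) * R.entry σ m k h) • f h) ν := by
    intro m
    have hc : Continuous fun h => star ((√(R.dim σ : ℝ) : ℂ) * R.entry σ m k h) := by fun_prop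
    exact (((Lp.memLp f).integrable (by norm_num)).smul_of_top_right
      (memLp_top_of_continuous ν hc))
  have h1 : R.coeff ν (leftTranslate ν K g f) σ k l =
      ∫ h, star ((√(R.dim σ : ℝ) : ℂ) * R.entry σ l k (g * (g⁻¹ * h))) • f (g⁻¹ * h) ∂ν := by
    refine integral_congr_ae ?_
    filter_upwards [coeFn_leftTranslate ν g f] with h hh
    rw [hh, mul_inv_cancel_left]
    rfl
  rw [h1, integral_mul_left_eq_self
    (fun h => star ((√(R.dim σ : ℝ) : ℂ) * R.entry σ l k (g * h)) • f h) g⁻¹]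
  have h2 : ∀ m, star (R.entry σ l m g) • R.coeff ν f σ k m = ∫ h, star (R.entry σ l m g) •
      star ((√(R.dim σ : ℝ) : ℂ) * R.entry σ m k h) • f h ∂ν :=
    fun m => (integral_smul _ _).symm
  simp only [h2]
  have hi' : ∀ m, Integrable (fun h => star (R.entry σ l m g) •
      star ((√(R.dim σ : ℝ) : ℂ) * R.entry σ m k h) • f h) ν := fun m => (hi m).smul _
  rw [← integral_finsetSum _ fun m _ => hi' m]
  refine integral_congr_ae (Filter.Eventually.of_forall fun h => ?_)
  simp only [R.entry_mul, Finset.mul_sum, star_sum, Finset.sum_smul, smul_smul, star_mul']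
  refine Finset.sum_congr rfl fun m _ => ?_
  congr 1
  ring

/-- `s` intertwines left translation and `μ`. -/
theorem isometry_leftTranslate {s : Lp K 2 ν →ₗᵢ[ℂ] ell2 F.Basis K}
    (hs : ∀ f, ⇑(s f) = F.sCoord ν π f) (g : G) (f : Lp K 2 ν) :
    s (leftTranslate ν K g f) = F.mu K g (s f) := by
  ext ⟨σ, i, l⟩
  rw [F.mu_apply_apply, hs, hs]
  simp only [IsometryFamily.sCoord, coeff_leftTranslate, map_sum, map_smul, Finset.smul_sum]
  exact Finset.sum_comm

theorem orbitRep_act_leftTranslate (g : G) (x : A) (f : Lp K 2 ν) :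
    orbitRep S π ν (S.act g x) (leftTranslate ν K g f) =
      leftTranslate ν K g (orbitRep S π ν x f) := by
  refine Lp.ext ?_
  have h1 := (measurePreserving_mul_left ν g⁻¹).quasiMeasurePreserving.ae_eq_comp
    (coeFn_orbitRep S π ν x f)
  filter_upwards [coeFn_orbitRep S π ν (S.act g x) (leftTranslate ν K g f),
    coeFn_leftTranslate ν g f, coeFn_leftTranslate ν g (orbitRep S π ν x f), h1] with h h1 h2 h3 h4
  rw [h1, h2, h3]
  refine Eq.trans ?_ h4.symm
  change π ((S.act h⁻¹ * S.act g) x) _ = π (S.act (g⁻¹ * h)⁻¹ x) _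
  rw [← map_mul, mul_inv_rev, inv_inv]

/-- The covariance of `π_s` and `μ` on `K ⊗ H`. -/
theorem conj_mu {s : Lp K 2 ν →ₗᵢ[ℂ] ell2 F.Basis K} (hs : ∀ f, ⇑(s f) = F.sCoord ν π f)
    (g : G) (x : A) :
    (F.mu K g).toContinuousLinearMap ∘L (s.toContinuousLinearMap ∘L orbitRep S π ν x ∘L
      s.toContinuousLinearMap†) ∘L (F.mu K g).toContinuousLinearMap† =
    s.toContinuousLinearMap ∘L orbitRep S π ν (S.act g x) ∘L s.toContinuousLinearMap† := by
  have h1 : s.toContinuousLinearMap† ∘L (F.mu K g).toContinuousLinearMap† =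
      (leftTranslate ν K g).toContinuousLinearMap† ∘L s.toContinuousLinearMap† := by
    rw [← ContinuousLinearMap.adjoint_comp, ← ContinuousLinearMap.adjoint_comp]
    congr 1
    ext1 f
    exact (isometry_leftTranslate ν hs g f).symm
  have hl : (leftTranslate ν K g).toContinuousLinearMap† =
      (leftTranslate ν K g⁻¹).toContinuousLinearMap :=
    adjoint_eq_of_comp_eq_id (leftTranslate_inv_apply ν g)
  rw [hl] at h1
  ext1 y
  have h2 : ContinuousLinearMap.adjoint s.toContinuousLinearMap
      (ContinuousLinearMap.adjoint (F.mu K g).toContinuousLinearMap y) =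
      leftTranslate ν K g⁻¹ (ContinuousLinearMap.adjoint s.toContinuousLinearMap y) :=
    DFunLike.congr_fun h1 y
  change F.mu K g (s (orbitRep S π ν x (ContinuousLinearMap.adjoint s.toContinuousLinearMap
      (ContinuousLinearMap.adjoint (F.mu K g).toContinuousLinearMap y)))) =
    s (orbitRep S π ν (S.act g x) (ContinuousLinearMap.adjoint s.toContinuousLinearMap y))
  rw [h2, ← isometry_leftTranslate ν hs, ← orbitRep_act_leftTranslate, leftTranslate_inv_apply]

end Translation

/-! ### The covariant representation on `H_p` and the isometry `t` -/

section Restriction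

variable {A G : Type*} [CStarAlgebra A] [Group G] [TopologicalSpace G] {S : CStarDynSystem A G}
  {H : Type*} [NormedAddCommGroup H] [InnerProductSpace ℂ H] [CompleteSpace H]

theorem subtypeL_adjoint_coe (Hp : Submodule ℂ H) [CompleteSpace Hp] (ξ : Hp) :
    ContinuousLinearMap.adjoint Hp.subtypeL (ξ : H) = ξ :=
  isometry_adjoint_apply Hp.subtypeₗᵢ ξ

/-- A unitary representation `U` on `H` that leaves `Hp` invariant and satisfies the covariance
relation with the representation `rep` on `Hp` restricts to a covariant representation. -/
theorem exists_covariantRep (Hp : Submodule ℂ H) [CompleteSpace Hp] (rep : A →⋆ₐ[ℂ] (Hp →L[ℂ] Hp))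
    (U : G → H →ₗᵢ[ℂ] H) (hone : ∀ x, U 1 x = x) (hmul : ∀ g h x, U (g * h) x = U g (U h x))
    (hcont : ∀ x, Continuous fun g => U g x) (hinv : ∀ g, ∀ x ∈ Hp, U g x ∈ Hp)
    (hcov : ∀ g x, (U g).toContinuousLinearMap ∘L (Hp.subtypeL ∘L rep x ∘L Hp.subtypeL†) ∘L
      (U g).toContinuousLinearMap† = Hp.subtypeL ∘L rep (S.act g x) ∘L Hp.subtypeL†) :
    ∃ D : CovariantRep S Hp, D.rep = rep ∧
      ∀ g (f : Hp), ((D.uni g : Hp →L[ℂ] Hp) f : H) = U g f := by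
  let V : G → Hp →ₗᵢ[ℂ] Hp := fun g =>
    { toLinearMap := (U g).toLinearMap.restrict (hinv g)
      norm_map' := fun x => (U g).norm_map x }
  have hV : ∀ g (f : Hp), (V g f : H) = U g f := fun g f => rfl
  have hVinv : ∀ g (f : Hp), V g (V g⁻¹ f) = f := fun g f => Subtype.ext (by
    rw [hV, hV, ← hmul, mul_inv_cancel, hone])
  have hVadj : ∀ g, star (V g).toContinuousLinearMap = (V g⁻¹).toContinuousLinearMap := fun g =>
    adjoint_eq_of_comp_eq_id (hVinv g)
  have hUadj : ∀ g, (U g).toContinuousLinearMap† = (U g⁻¹).toContinuousLinearMap := fun g =>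
    adjoint_eq_of_comp_eq_id fun x => by rw [← hmul, mul_inv_cancel, hone]
  have hmem : ∀ g, (V g).toContinuousLinearMap ∈ unitary (Hp →L[ℂ] Hp) := by
    intro g
    rw [Unitary.mem_iff, hVadj]
    constructor
    · ext1 f
      have := hVinv g⁻¹ f
      rwa [inv_inv] at this
    · ext1 f
      exact hVinv g f
  refine ⟨{ rep := rep
            uni := ⟨⟨fun g => ⟨(V g).toContinuousLinearMap, hmem g⟩, ?_⟩, ?_⟩
            continuous_uni := fun ξ => (hcont ξ).subtype_mk fun g => hinv g _ ξ.2
            covariant := fun g x => ?_ }, rfl, fun g f => rfl⟩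
  · refine Subtype.ext ?_
    ext1 f
    exact Subtype.ext (hone f)
  · intro g h
    refine Subtype.ext ?_
    ext1 f
    exact Subtype.ext (hmul g h f)
  · change rep (S.act g x) = (V g).toContinuousLinearMap * rep x *
      star (V g).toContinuousLinearMap
    rw [hVadj]
    ext1 ξ
    refine Subtype.ext ?_
    have h := DFunLike.congr_fun (hcov g x) (ξ : H)
    rw [hUadj] at h
    change U g (rep x (ContinuousLinearMap.adjoint Hp.subtypeL ((V g⁻¹ ξ : Hp) : H))) =
      rep (S.act g x) (ContinuousLinearMap.adjoint Hp.subtypeL (ξ : H)) at h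
    rw [subtypeL_adjoint_coe, subtypeL_adjoint_coe] at h
    exact h.symm

end Restriction

section Trivial

variable {A G Irr : Type*} [CStarAlgebra A] [Group G] [TopologicalSpace G] [IsTopologicalGroup G]
  [CompactSpace G] [SecondCountableTopology G] [MeasurableSpace G] [BorelSpace G]
  {S : CStarDynSystem A G} {R : IrrepSystem G Irr} {F : IsometryFamily S R} {ν : Measure G}
  [ν.IsHaarMeasure] [IsProbabilityMeasure ν]
  {K : Type*} [NormedAddCommGroup K] [InnerProductSpace ℂ K] [CompleteSpace K]
  {π : A →⋆ₐ[ℂ] (K →L[ℂ] K)} {s : Lp K 2 ν →ₗᵢ[ℂ] ell2 F.Basis K}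

/-- The index of the basis vector `1_ℂ` of `ℂ = H_1 ⊗ V̄_1`. -/
def IsometryFamily.oneIdx (F : IsometryFamily S R) : F.Basis :=
  ⟨R.one, Fin.cast F.mult_one.symm 0, Fin.cast R.dim_one.symm 0⟩

theorem IsometryFamily.tensorVec_oneVec (ξ : K) :
    tensorVec F.oneVec ξ = tensorBasis F.oneIdx ξ := by
  unfold IsometryFamily.oneVec tensorBasis IsometryFamily.oneIdx
  congr!

theorem orbitVec_fixed_apply (b : S.fixedAlgebra) (ξ : K) :
    orbitVec S π ν b ξ = Lp.const 2 ν (π b ξ) := by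
  refine Lp.ext ?_
  filter_upwards [coeFn_orbitVec S π ν b ξ, Lp.coeFn_const 2 ν (π b ξ)] with h h1 h2
  rw [h1, h2, b.2 h⁻¹]
  rfl

theorem adjoint_tensorBasis_one (hs : ∀ f, ⇑(s f) = F.sCoord ν π f) (ξ : K) :
    ContinuousLinearMap.adjoint s.toContinuousLinearMap (tensorBasis F.oneIdx ξ) =
      Lp.const 2 ν ξ := by
  have h := DFunLike.congr_fun (adjoint_comp_tensorBasis hs R.one (Fin.cast F.mult_one.symm 0)
    (Fin.cast R.dim_one.symm 0)) ξ
  refine h.trans ?_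
  rw [F.s_one, R.dim_one, Nat.cast_one, Real.sqrt_one, Complex.ofReal_one, one_smul, star_one]
  have h1 := orbitVec_fixed_apply (ν := ν) (π := π) (1 : S.fixedAlgebra) ξ
  have h2 : π ((1 : S.fixedAlgebra) : A) = 1 := map_one π
  rw [h2] at h1
  exact h1

/-- The constant functions correspond to `K ⊗ 1_ℂ` under `s`. -/
theorem isometry_const (hs : ∀ f, ⇑(s f) = F.sCoord ν π f) (ξ : K) :
    s (Lp.const 2 ν ξ) = tensorBasis F.oneIdx ξ := by
  have hn : ‖(Lp.const 2 ν ξ : Lp K 2 ν)‖ = ‖ξ‖ := by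
    refine (Lp.norm_const' 2 ν ξ (by norm_num) (by norm_num)).trans ?_
    rw [probReal_univ, Real.one_rpow, mul_one]
  have he : ‖tensorBasis F.oneIdx ξ‖ = ‖ξ‖ := by
    classical
    rw [tensorBasis_apply_eq_single, lp.norm_single (by norm_num)]
  -- `‖s† e‖ = ‖e‖` forces `s s† e = e`
  have h1 : ⟪s (Lp.const 2 ν ξ), tensorBasis F.oneIdx ξ⟫_ℂ = (‖ξ‖ : ℂ) ^ 2 := by
    have := ContinuousLinearMap.adjoint_inner_right s.toContinuousLinearMap (Lp.const 2 ν ξ)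
      (tensorBasis F.oneIdx ξ)
    rw [adjoint_tensorBasis_one hs, inner_self_eq_norm_sq_to_K, hn] at this
    exact this.symm
  rw [← sub_eq_zero, ← inner_self_eq_zero (𝕜 := ℂ), inner_sub_left, inner_sub_right,
    inner_sub_right, h1, ← inner_conj_symm (tensorBasis F.oneIdx ξ), h1,
    inner_self_eq_norm_sq_to_K, inner_self_eq_norm_sq_to_K, s.norm_map, hn, he]
  simp

theorem conj_comp_tensorBasis_one (hs : ∀ f, ⇑(s f) = F.sCoord ν π f) (b : S.fixedAlgebra) :
    (s.toContinuousLinearMap ∘L orbitRep S π ν b ∘L s.toContinuousLinearMap†) ∘L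
      tensorBasis F.oneIdx = tensorBasis F.oneIdx ∘L π.comp S.fixedAlgebra.subtype b := by
  ext1 ξ
  change s (orbitRep S π ν b (ContinuousLinearMap.adjoint s.toContinuousLinearMap
    (tensorBasis F.oneIdx ξ))) = tensorBasis F.oneIdx (π b ξ)
  rw [adjoint_tensorBasis_one hs, ← isometry_const hs]
  congr 1
  refine Lp.ext ?_
  filter_upwards [coeFn_orbitRep S π ν b (Lp.const 2 ν ξ), Lp.coeFn_const 2 ν ξ,
    Lp.coeFn_const 2 ν (π b ξ)] with h h1 h2 h3
  rw [h1, h2, h3, b.2 h⁻¹]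
  rfl

end Trivial

end LiftCovRep

end

open LiftCovRep in
/-- `s`, `jα`, `π_s(x) = s jα(x) s*`, the projection onto `H_p` (the image of `s s*` under
`π_B ⊗ id`), `π_A`, `u_A` and `t` are each uniquely determined by the formulas below; their
existence is part of the claim. -/
theorem theorem5p5
    -- a compact Lie group with its normalized Haar measure
    {n : ℕ} {G : Type*} [Group G] [TopologicalSpace G] [IsTopologicalGroup G] [CompactSpace G]
    [T2Space G] [ChartedSpace (EuclideanSpace ℝ (Fin n)) G] [LieGroup (𝓡 n) ∞ G]
    [MeasurableSpace G] [BorelSpace G] (ν : Measure G) [ν.IsHaarMeasure] [IsProbabilityMeasure ν]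
    -- a free C*-dynamical system
    {A : Type*} [CStarAlgebra A] (S : CStarDynSystem A G) (_hfree : S.IsFree)
    -- the family of isometries
    {Irr : Type*} (R : IrrepSystem G Irr) (F : IsometryFamily S R)
    -- the faithful representation of the fixed point algebra
    {HB : Type*} [NormedAddCommGroup HB] [InnerProductSpace ℂ HB] [CompleteSpace HB]
    (πB : S.fixedAlgebra →⋆ₐ[ℂ] (HB →L[ℂ] HB)) (_hπB : Function.Injective πB)
    -- the faithful covariant representation that is chosen to define `π_s`
    {HA : Type*} [NormedAddCommGroup HA] [InnerProductSpace ℂ HA] [CompleteSpace HA]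
    (C : CovariantRep S HA) (_hC : C.IsFaithful) :
    -- the isometry `s`
    ∃ s : Lp HA 2 ν →ₗᵢ[ℂ] ell2 F.Basis HA, (∀ f, ⇑(s f) = F.sCoord ν C.rep f) ∧
    -- the homomorphism `jα`
    ∃ jα : A →⋆ₐ[ℂ] (Lp HA 2 ν →L[ℂ] Lp HA 2 ν),
      (∀ x f, ⇑(jα x f) =ᵐ[ν] fun h => C.rep (S.act h⁻¹ x) (f h)) ∧
    -- the space `H_p` with `p = (π_B ⊗ id)(s s*)`
    ∃ (Hp : Submodule ℂ (ell2 F.Basis HB)) (_ : CompleteSpace Hp),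
      (∀ q, IsTensorIdImage C.restrictFixed πB
        (s.toContinuousLinearMap ∘L s.toContinuousLinearMap†) q ↔ q = Hp.starProjection) ∧
    -- the faithful covariant representation `(π_A, u_A)`
    ∃ D : CovariantRep S Hp, D.IsFaithful ∧
      -- `π_A(x) = (π_B ⊗ id)(π_s(x))`, an operator on `H_p`
      (∀ x T, IsTensorIdImage C.restrictFixed πB
        (s.toContinuousLinearMap ∘L jα x ∘L s.toContinuousLinearMap†) T ↔
          T = Hp.subtypeL ∘L D.rep x ∘L Hp.subtypeL†) ∧
      -- `u_A = 1 ⊗ μ`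
      (∀ g (f : Hp), ⇑((D.uni g : Hp →L[ℂ] Hp) f : ell2 F.Basis HB) =
        F.muCoord g ⇑(f : ell2 F.Basis HB)) ∧
    -- the isometry `t` with `t(ξ) = ξ ⊗ 1_ℂ`
    ∃ t : HB →ₗᵢ[ℂ] Hp, (∀ ξ, (t ξ : ell2 F.Basis HB) = tensorVec F.oneVec ξ) ∧
      ∀ (b : S.fixedAlgebra) (ξ : HB), D.rep (b : A) (t ξ) = t (πB b ξ) := by
  have : SecondCountableTopology G :=
    ChartedSpace.secondCountable_of_sigmaCompact (EuclideanSpace ℝ (Fin n)) G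
  have hiso : ∀ b, ‖C.restrictFixed b‖ = ‖πB b‖ := by
    intro b
    rw [S.norm_rep_fixed πB _hπB b]
    exact S.norm_rep_fixed C.restrictFixed (fun x y h => Subtype.ext (_hC h)) b
  obtain ⟨s, hs⟩ := F.exists_isometry ν C.rep
  obtain ⟨Hp, hcomp, hp, rep, hrep, hinj⟩ := exists_compressed_rep hiso (orbitRep S C.rep ν) s
    (exists_isTensorIdImage_conj hs hiso)
  have himg : ∀ x, IsTensorIdImage C.restrictFixed πB
      (s.toContinuousLinearMap ∘L orbitRep S C.rep ν x ∘L s.toContinuousLinearMap†)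
      (Hp.subtypeL ∘L rep x ∘L Hp.subtypeL†) := fun x => (hrep x _).2 rfl
  have hcov : ∀ g x, (F.mu HB g).toContinuousLinearMap ∘L
      (Hp.subtypeL ∘L rep x ∘L Hp.subtypeL†) ∘L (F.mu HB g).toContinuousLinearMap† =
      Hp.subtypeL ∘L rep (S.act g x) ∘L Hp.subtypeL† := by
    intro g x
    have hμ := F.isTensorIdImage_mu C.restrictFixed πB g
    have h := hμ.comp ((himg x).comp hμ.adjoint)
    rw [conj_mu ν hs g x] at h
    exact h.unique hiso (himg (S.act g x))
  have hinv : ∀ g, ∀ x ∈ Hp, F.mu HB g x ∈ Hp := by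
    intro g x hx
    have h := DFunLike.congr_fun (hcov g 1) (F.mu HB g x)
    rw [map_one (S.act g), map_one rep] at h
    change F.mu HB g (Hp.subtypeL ((1 : Hp →L[ℂ] Hp) (ContinuousLinearMap.adjoint Hp.subtypeL
      (ContinuousLinearMap.adjoint (F.mu HB g).toContinuousLinearMap (F.mu HB g x))))) = _ at h
    have hx' : ContinuousLinearMap.adjoint Hp.subtypeL x = ⟨x, hx⟩ :=
      subtypeL_adjoint_coe Hp ⟨x, hx⟩
    rw [isometry_adjoint_apply, hx'] at h
    have h' : F.mu HB g x = Hp.subtypeL (ContinuousLinearMap.adjoint Hp.subtypeL (F.mu HB g x)) := h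
    rw [h']
    exact Subtype.coe_prop _
  obtain ⟨D, hD, hDu⟩ := exists_covariantRep Hp rep (F.mu HB) F.mu_one_apply F.mu_mul_apply
    F.continuous_mu hinv hcov
  have hone : ∀ b : S.fixedAlgebra, ∀ ξ, rep b (ContinuousLinearMap.adjoint Hp.subtypeL
      (tensorBasis F.oneIdx ξ)) = (tensorBasis F.oneIdx (πB b ξ) : ell2 F.Basis HB) := by
    intro b ξ
    exact DFunLike.congr_fun
      ((himg b).comp_tensorBasis_eq hiso (conj_comp_tensorBasis_one hs b)) ξ
  have hmem : ∀ ξ : HB, tensorBasis F.oneIdx ξ ∈ Hp := by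
    intro ξ
    have h := hone 1 ξ
    rw [map_one] at h
    exact h ▸ Subtype.coe_prop _
  let t : HB →ₗᵢ[ℂ] Hp :=
    { toLinearMap := (tensorBasis F.oneIdx).toLinearMap.codRestrict Hp hmem
      norm_map' := fun ξ => by
        classical
        change ‖(tensorBasis F.oneIdx ξ : ell2 F.Basis HB)‖ = ‖ξ‖
        rw [tensorBasis_apply_eq_single, lp.norm_single (by norm_num)] }
  refine ⟨s, hs, orbitRep S C.rep ν, coeFn_orbitRep S C.rep ν, Hp, hcomp, fun q => hp q, D, ?_, ?_,
    ?_, t, fun ξ => (F.tensorVec_oneVec ξ).symm, fun b ξ => ?_⟩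
  · rw [CovariantRep.IsFaithful, hD]
    exact hinj (orbitRep_injective S C.rep ν _hC)
  · rw [hD]; exact hrep
  · intro g f
    rw [hDu, F.mu_apply]
  · refine Subtype.ext ?_
    rw [hD]
    have h := hone b ξ
    have ht : ContinuousLinearMap.adjoint Hp.subtypeL (tensorBasis F.oneIdx ξ) = t ξ :=
      subtypeL_adjoint_coe Hp (t ξ)
    rw [ht] at h
    exact h
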